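/- Throughout, a strong Gelfand pair $(G,H)$ is a finite group $G$ with a subgroup $H$ such that every irreducible complex character $\psi$ of $H$ induces a multiplicity-free character of $G$, i.e. $\langle\chi,\psi{\uparrow}^G\rangle\le 1$ for every irreducible complex character $\chi$ of $G$. Let $p$ be a prime, let $G=\mathrm{SL}(2,p)$, let $U\le G$ be the subgroup of upper triangular matrices and, for $p$ odd, let $H_2\le U$ be the subgroup of those upper triangular matrices whose diagonal entries are squares in $\mathbb F_p$ (the subgroup of index $2$ in $U$). Up to conjugacy in $G$, the strong Gelfand pairs $(G,H)$ with $H$ a proper subgroup of $G$ are the following. (i) $p=2$. Here $G\cong\Sigma_3$, and the strong Gelfand pairs are $(G,\mathcal C_2)$ and $(G,\mathcal C_3)$. The subgroups of $G$ isomorphic to $\mathcal C_2$ form one conjugacy class, and so do those isomorphic to $\mathcal C_3$. (ii) $p=3$. The strong Gelfand pairs are $(G,\mathcal C_3)$, $(G,\mathcal C_6)$ and $(G,Q_8)$, where $Q_8$ is the quaternion group of order $8$; here $U\cong\mathcal C_6$. For each of $\mathcal C_3$, $\mathcal C_6$, $Q_8$, the subgroups of $G$ isomorphic to it form one conjugacy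 class. (iii) $p=5$. The strong Gelfand pairs are $(G,\mathrm{SL}(2,3))$ and $(G,U)$. The subgroups of $G$ isomorphic to $\mathrm{SL}(2,3)$ form one conjugacy class and are maximal in $G$. (iv) $p=7$. The strong Gelfand pairs are $(G,U)$, $(G,H_2)$ and $(G,K)$, where $K$ is the full preimage in $G$ of a subgroup of $\mathrm{PSL}(2,7)$ isomorphic to $\Sigma_4$. These subgroups $K$ form exactly two conjugacy classes of $G$, and both occur. (v) $p=11$. The strong Gelfand pairs are $(G,H_2)$, $(G,U)$ and $(G,2\mathrm I)$, where $2\mathrm I=\langle r,s,t\mid r^2=s^3=t^5=rst\rangle$ is the binary icosahedral group. The subgroups of $G$ isomorphic to $2\mathrm I$ form exactly two conjugacy classes of $G$, and both occur. -/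

import Mathlib

open scoped MatrixGroups

noncomputable section

/-- The inner product `⟨ρ, τ⟩ = |G|⁻¹ ∑ g, χ_τ(g) χ_ρ(g⁻¹)` of the characters of two complex
representations of a finite group. -/
def charInner {G : Type*} [Group G] [Fintype G] {V W : Type*}
    [AddCommGroup V] [Module ℂ V] [AddCommGroup W] [Module ℂ W]
    (ρ : Representation ℂ G V) (τ : Representation ℂ G W) : ℂ :=
  (Nat.card G : ℂ)⁻¹ * ∑ g : G, τ.character g * ρ.character g⁻¹

/-- The character of a representation `τ` of a finite group `G` is multiplicity-free if its inner
product with every irreducible complex character of `G` is at most one. -/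
def IsMultiplicityFree {G : Type*} [Group G] [Fintype G] {W : Type*}
    [AddCommGroup W] [Module ℂ W] (τ : Representation ℂ G W) : Prop :=
  ∀ (V : Type) [AddCommGroup V] [Module ℂ V] [FiniteDimensional ℂ V] (ρ : Representation ℂ G V),
    ρ.IsIrreducible → (charInner ρ τ).re ≤ 1

/-- `(G, H)` is a strong Gelfand pair: every irreducible complex character of `H` induces a
multiplicity-free character of `G`. -/
def IsStrongGelfandPair {G : Type} [Group G] [Fintype G] (H : Subgroup G) : Prop :=
  ∀ (W : Type) [AddCommGroup W] [Module ℂ W] [FiniteDimensional ℂ W] (σ : Representation ℂ H W),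
    σ.IsIrreducible → IsMultiplicityFree (Representation.ind H.subtype σ)

/-- Two subgroups are conjugate. -/
def SubgroupConj {G : Type*} [Group G] (H K : Subgroup G) : Prop :=
  ∃ g : G, H = K.map (MulAut.conj g).toMonoidHom

/-- The subgroups of `G` with property `P` form exactly one conjugacy class. -/
def OneConjClass {G : Type*} [Group G] (P : Subgroup G → Prop) : Prop :=
  ∃ K, ∀ H, P H ↔ SubgroupConj H K

/-- The subgroups of `G` with property `P` form exactly two conjugacy classes. -/
def TwoConjClasses {G : Type*} [Group G] (P : Subgroup G → Prop) : Prop :=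
  ∃ K₁ K₂, ¬ SubgroupConj K₁ K₂ ∧ ∀ H, P H ↔ SubgroupConj H K₁ ∨ SubgroupConj H K₂

/-- The subgroup `H` is isomorphic to the group `Q`. -/
def HasIsoType {G : Type*} [Group G] (Q : Type*) [Group Q] (H : Subgroup G) : Prop :=
  Nonempty (H ≃* Q)

/-- The subgroup of upper triangular matrices in `SL(2, p)`. -/
def upperTriangular (p : ℕ) : Subgroup SL(2, ZMod p) where
  carrier := {A | A 1 0 = 0}
  one_mem' := by simp
  mul_mem' := by
    intro A B hA hB
    simp only [Set.mem_ofPred_eq] at hA hB ⊢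
    simp [Matrix.mul_apply, Fin.sum_univ_two, hA, hB]
  inv_mem' := by
    intro A hA
    simp only [Set.mem_ofPred_eq] at hA ⊢
    simp [Matrix.SpecialLinearGroup.SL2_inv_expl, hA]

/-- The subgroup of upper triangular matrices in `SL(2, p)` whose diagonal entries are squares
(for odd primes `p` this is the subgroup of index two of `upperTriangular p`). -/
def upperTriangularSq (p : ℕ) : Subgroup SL(2, ZMod p) where
  carrier := {A | A 1 0 = 0 ∧ IsSquare (A 0 0) ∧ IsSquare (A 1 1)}
  one_mem' := by simp
  mul_mem' := by
    rintro A B ⟨hA, hA0, hA1⟩ ⟨hB, hB0, hB1⟩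
    simpa [Matrix.mul_apply, Fin.sum_univ_two, hA, hB] using ⟨hA0.mul hB0, hA1.mul hB1⟩
  inv_mem' := by
    rintro A ⟨hA, hA0, hA1⟩
    refine ⟨?_, ?_, ?_⟩ <;> simp [Matrix.SpecialLinearGroup.SL2_inv_expl, hA, hA0, hA1]

/-- `H` is the full preimage in `SL(2, p)` of a subgroup of `PSL(2, p)` that is isomorphic to the
symmetric group on four letters. -/
def IsPreimageOfS4 (p : ℕ) (H : Subgroup SL(2, ZMod p)) : Prop :=
  ∃ S : Subgroup (Matrix.ProjectiveSpecialLinearGroup (Fin 2) (ZMod p)),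
    Nonempty (S ≃* Equiv.Perm (Fin 4)) ∧
      H = S.comap (QuotientGroup.mk' (Subgroup.center SL(2, ZMod p)))

/-- The relators of `⟨r, s, t | r² = s³ = t⁵ = rst⟩`, with `r, s, t` the generators
indexed by `0, 1, 2`. -/
def binaryIcosahedralRels : Set (FreeGroup (Fin 3)) :=
  let r := FreeGroup.of (0 : Fin 3)
  let s := FreeGroup.of (1 : Fin 3)
  let t := FreeGroup.of (2 : Fin 3)
  {r ^ 2 * (r * s * t)⁻¹, s ^ 3 * (r * s * t)⁻¹, t ^ 5 * (r * s * t)⁻¹}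

/-- The binary icosahedral group `⟨r, s, t | r² = s³ = t⁵ = rst⟩`. -/
abbrev BinaryIcosahedral : Type := PresentedGroup binaryIcosahedralRels

/-- The cyclic group of order `n`, written multiplicatively. -/
abbrev Cyc (n : ℕ) : Type := Multiplicative (ZMod n)

end

/-! Schur's lemma turns the multiplicity condition into commutativity. For an irreducible
representation V of G, every irreducible representation of H occurs in V at most once exactly when
End_H(V) is commutative. Since G spans End(V), averaging over H shows that End_H(V) is spanned by
the images of the conjugation sums ∑_{h ∈ H} h x h⁻¹. So (G, H) is a strong Gelfand pair if and only
if these sums commute in ℂ[G] (`isStrongGelfandPair_of_conjSum_commute`,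
`IsStrongGelfandPair.conjSum_commute`). The condition passes to larger subgroups and is preserved by
automorphisms of G.

The criterion gives finite certificates in both directions. If the sums of x and y commute, then x y
is also a product of an H-conjugate of y and an H-conjugate of x, in that order. One pair x, y
violating this for a set of matrices refutes every subgroup inside that set
(`not_isStrongGelfandPair_of_noProduct`). Conversely, the sums are shown to commute by comparing
multisets of H-classes, for representatives up to conjugation and sign
(`isStrongGelfandPair_ofCodes`). Both tests are evaluated on matrices coded by natural numbers.

The subgroups are found through their orders. If p divides |H| and H is proper, some conjugate of H
lies between the upper unitriangular and the upper triangular group, because the unitriangular group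
and any matrix outside the triangular group generate G. Otherwise |H| divides p² - 1. If a suitable
prime l with Sylow subgroups of order l divides |H|, a conjugate of H contains a fixed x of order l.
For each y of order dividing l, either y lies in ⟨x⟩, or some short word in x and y has an
impossible order or is one of a few listed elements. Hence H normalizes ⟨x⟩ or contains a listed
element, which together with x generates a copy of SL(2, 3) or of the binary icosahedral group. The
2-groups and 3-groups that remain lie in a Sylow subgroup. Bounds on the orders of the refuted
subgroups are carried along, so that the same case distinction also finds all subgroups of a given
isomorphism type. -/

/-! ### Multiplicities as dimensions of spaces of intertwining maps -/

open Representation in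
/-- Frobenius reciprocity for intertwining maps out of an induced representation. -/
noncomputable def Representation.indLinearEquiv {G K V W : Type*} [Group G] [Group K] (φ : K →* G)
    [AddCommGroup V] [Module ℂ V] [AddCommGroup W] [Module ℂ W]
    (σ : Representation ℂ K W) (ρ : Representation ℂ G V) :
    IntertwiningMap (ind φ σ) ρ ≃ₗ[ℂ] IntertwiningMap σ (ρ.comp φ) where
  toFun f := ⟨f.toLinearMap ∘ₗ IndV.mk φ σ 1, fun g ↦ by
    ext x
    have := (f.isIntertwining _ _ (φ g) (IndV.mk φ σ 1 x)).symm
    simp_all [← Coinvariants.mk_inv_tmul] ⟩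
  map_add' _ _ := rfl
  map_smul' _ _ := rfl
  -- The class of h ⊗ x is sent to ρ h⁻¹ (f x); this descends to the coinvariants because f
  -- intertwines.
  invFun f := ⟨Representation.Coinvariants.lift _
    (TensorProduct.lift <| (Finsupp.lift _ _ _ fun h => ρ h⁻¹ ∘ₗ f.toLinearMap) ∘ₗ
      (MonoidAlgebra.coeffLinearEquiv ℂ).toLinearMap)
    fun g ↦ by
      ext h x
      simp only [LinearMap.coe_comp, Function.comp_apply, MonoidAlgebra.lsingle_apply]
      have := f.isIntertwining _ _ g
      simp_all [ofMulAction_single, mul_inv_rev], fun g ↦ by ext; simp⟩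
  left_inv f := by
    ext h a
    have := f.isIntertwining _ _ h⁻¹ (IndV.mk φ σ 1 a)
    simp_all
  right_inv f := by
    ext; simp

section SimpleSpan

open Representation MonoidAlgebra

/-- A linear endomorphism vanishing on the image of every irreducible representation vanishes. -/
theorem eq_zero_of_comp_irreducible {K W : Type} [Group K] [Finite K]
    [AddCommGroup W] [Module ℂ W] [FiniteDimensional ℂ W] (τ : Representation ℂ K W)
    (D : W →ₗ[ℂ] W)
    (hD : ∀ (N : Type) [AddCommGroup N] [Module ℂ N] [FiniteDimensional ℂ N]
      (σ : Representation ℂ K N), σ.IsIrreducible → ∀ f : IntertwiningMap σ τ,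
        D ∘ₗ f.toLinearMap = 0) : D = 0 := by
  have key : ∀ N : Submodule ℂ[K] τ.asModule, IsSimpleModule ℂ[K] N →
      ∀ v ∈ N, D (τ.asModuleEquiv v) = 0 := by
    intro N hN v hv
    let N' : Subrepresentation τ := Subrepresentation.ofSubmodule' N
    let σ := N'.toRepresentation
    have hσ : σ.IsIrreducible := by
      rw [irreducible_iff_isSimpleModule_asModule]
      -- The underlying map is the identity; linearity over the group algebra is checked on
      -- monomials.
      let e : σ.asModule →ₗ[ℂ[K]] N :=
        { toFun := fun x => ⟨x.1, x.2⟩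
          map_add' := fun _ _ => rfl
          map_smul' := fun r x => by
            induction r using MonoidAlgebra.induction_linear with
            | zero => exact Subtype.ext (by simp; rfl)
            | add a b ha hb =>
              rw [add_smul, RingHom.id_apply, add_smul]
              exact congrArg₂ (· + ·) ha hb
            | single g a =>
              rw [single_smul]
              refine Subtype.ext ?_
              change _ = MonoidAlgebra.single g a • (show τ.asModule from x.1)
              rw [single_smul]
              rfl }
      exact IsSimpleModule.congr (LinearEquiv.ofBijective e
        ⟨fun x y h => Subtype.ext (congrArg Subtype.val h :), fun x => ⟨⟨x.1, x.2⟩, rfl⟩⟩)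
    let f : IntertwiningMap σ τ := ⟨N'.toSubmodule.subtype, fun g => rfl⟩
    exact LinearMap.congr_fun (hD _ σ hσ f) ⟨v, hv⟩
  ext v
  have hv : τ.asModuleEquiv.symm v ∈ (⊤ : Submodule ℂ[K] τ.asModule) := trivial
  -- By Maschke's theorem the simple submodules span the whole space.
  rw [← IsSemisimpleModule.sSup_simples_eq_top, sSup_eq_iSup'] at hv
  have : D (τ.asModuleEquiv (τ.asModuleEquiv.symm v)) = 0 := by
    refine Submodule.iSup_induction _ (motive := fun x => D (τ.asModuleEquiv x) = 0) hv ?_ ?_ ?_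
    · rintro ⟨N, hN⟩ x hx
      exact key N hN x hx
    · simp
    · intro x y hx hy
      simp [hx, hy]
  simpa using this

end SimpleSpan

open Representation MonoidAlgebra

section Multiplicity

variable {G : Type} [Group G] [Fintype G]

/-- The inner product counts intertwining maps out of the induced representation, and Frobenius
reciprocity moves these to H. The substitution g ↦ g⁻¹ reconciles the two ways of writing the sum.
-/
theorem charInner_ind {V W : Type} [AddCommGroup V] [Module ℂ V] [FiniteDimensional ℂ V]
    [AddCommGroup W] [Module ℂ W] [FiniteDimensional ℂ W] (H : Subgroup G)
    (σ : Representation ℂ H W) (ρ : Representation ℂ G V) :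
    charInner ρ (ind H.subtype σ) =
      Module.finrank ℂ (IntertwiningMap σ (ρ.comp H.subtype)) := by
  have : Invertible (Nat.card G : ℂ) :=
    invertibleOfNonzero (by exact_mod_cast Nat.card_pos.ne')
  rw [← (indLinearEquiv H.subtype σ ρ).finrank_eq, ← card_inv_mul_sum_char_mul_char_eq_finrank,
    charInner]
  congr 1
  refine Fintype.sum_equiv (Equiv.inv G) _ _ fun g => ?_
  simp [mul_comm]

theorem isStrongGelfandPair_iff_finrank_le (H : Subgroup G) :
    IsStrongGelfandPair H ↔
      ∀ (W : Type) [AddCommGroup W] [Module ℂ W] [FiniteDimensional ℂ W]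
        (σ : Representation ℂ H W), σ.IsIrreducible →
      ∀ (V : Type) [AddCommGroup V] [Module ℂ V] [FiniteDimensional ℂ V]
        (ρ : Representation ℂ G V), ρ.IsIrreducible →
        Module.finrank ℂ (IntertwiningMap σ (ρ.comp H.subtype)) ≤ 1 := by
  refine forall_congr' fun W => forall_congr' fun _ => forall_congr' fun _ => forall_congr' fun _ =>
    forall_congr' fun σ => forall_congr' fun _ => forall_congr' fun V => forall_congr' fun _ =>
    forall_congr' fun _ => forall_congr' fun _ => forall_congr' fun ρ => forall_congr' fun _ => ?_
  rw [charInner_ind, Complex.natCast_re, Nat.cast_le_one]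

end Multiplicity

/-! ### Strong Gelfand pairs and commuting conjugation sums -/

section Density

variable {G V : Type} [Group G] [Finite G] [AddCommGroup V] [Module ℂ V] [FiniteDimensional ℂ V]

/-- Burnside's theorem. By Schur's lemma the endomorphism ring of the simple module is ℂ, so every
linear map commutes with it, and Jacobson density produces an element of the group algebra that
agrees with the map on a basis. -/
theorem span_range_eq_top_of_isIrreducible (ρ : Representation ℂ G V) (hρ : ρ.IsIrreducible) :
    Submodule.span ℂ (Set.range ρ) = ⊤ := by
  refine eq_top_iff.2 fun T _ => ?_
  have hs : Function.Bijective (algebraMap ℂ (Module.End ℂ[G] ρ.asModule)) :=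
    IsSimpleModule.algebraMap_end_bijective_of_isAlgClosed ℂ
  let T' : Module.End (Module.End ℂ[G] ρ.asModule) ρ.asModule :=
    { toFun := T
      map_add' := T.map_add
      map_smul' := fun c v => by
        obtain ⟨a, rfl⟩ := hs.2 c
        exact T.map_smul a v }
  let b := Module.finBasis ℂ V
  classical
  have key : ∀ r : ℂ[G], ρ.asAlgebraHom r ∈ Submodule.span ℂ (Set.range ρ) := fun r => by
    induction r using MonoidAlgebra.induction_linear with
    | zero => simp
    | add x y hx hy => rw [map_add]; exact add_mem hx hy
    | single g a =>
      rw [asAlgebraHom_single]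
      exact Submodule.smul_mem _ _ (Submodule.subset_span ⟨g, rfl⟩)
  obtain ⟨r, hr⟩ := jacobson_density (R := ℂ[G]) (M := ρ.asModule) T'
    (Finset.image (β := V) b Finset.univ)
  have hT : T = ρ.asAlgebraHom r :=
    b.ext fun i => hr (b i) (Finset.mem_image_of_mem _ (Finset.mem_univ i))
  exact hT ▸ key r

end Density


section Commuting

variable {G : Type} [Group G] [Fintype G]

/-- The sum of the conjugates of `x` by the elements of `H`, in the group algebra. -/
noncomputable def conjSum (H : Subgroup G) (x : G) : ℂ[G] :=
  ∑ᶠ h : H, single (h * x * h⁻¹ : G) 1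

omit [Fintype G] in
theorem conjSum_eq_sum (H : Subgroup G) [Fintype H] (x : G) :
    conjSum H x = ∑ h : H, single (h * x * h⁻¹ : G) (1 : ℂ) :=
  finsum_eq_sum_of_fintype _

omit [Fintype G] in
theorem asAlgebraHom_conjSum {V : Type} [AddCommGroup V] [Module ℂ V] (H : Subgroup G) [Fintype H]
    (ρ : Representation ℂ G V) (x : G) :
    ρ.asAlgebraHom (conjSum H x) = ∑ h : H, ρ (h : G) * ρ x * ρ (h⁻¹ : G) := by
  simp [conjSum_eq_sum, map_sum, asAlgebraHom_single]

/-- Averaging over H multiplies an operator commuting with H by |H|, and it sends ρ x to the image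
of the conjugation sum of x. Since the ρ x span all operators, these images span the commutant of H.
-/
theorem mem_span_conjSum_of_commute {V : Type} [AddCommGroup V] [Module ℂ V]
    [FiniteDimensional ℂ V] (H : Subgroup G) (ρ : Representation ℂ G V) (hρ : ρ.IsIrreducible)
    (A : Module.End ℂ V) (hA : ∀ h ∈ H, ρ h * A = A * ρ h) :
    A ∈ Submodule.span ℂ (Set.range fun x => ρ.asAlgebraHom (conjSum H x)) := by
  classical
  let E : Module.End ℂ V →ₗ[ℂ] Module.End ℂ V :=
    ∑ h : H, LinearMap.mulLeftRight ℂ (ρ (h : G), ρ (h⁻¹ : G))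
  have hE : ∀ X, E X = ∑ h : H, ρ (h : G) * X * ρ (h⁻¹ : G) := fun X => by
    simp [E, LinearMap.sum_apply]
  have hEA : E A = (Nat.card H : ℂ) • A := by
    rw [hE, Finset.sum_congr rfl (g := fun _ => A)]
    · simp [Nat.cast_smul_eq_nsmul]
    · intro h _
      rw [hA _ h.2, mul_assoc, ← map_mul, mul_inv_cancel, map_one, mul_one]
  have hmem : E A ∈ Submodule.span ℂ (Set.range fun x => ρ.asAlgebraHom (conjSum H x)) := by
    have : A ∈ Submodule.span ℂ (Set.range ρ) := by
      rw [span_range_eq_top_of_isIrreducible ρ hρ]; trivial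
    have := Submodule.mem_map_of_mem (f := E) this
    rw [Submodule.map_span, ← Set.range_comp] at this
    convert this using 4 with x
    rw [asAlgebraHom_conjSum, Function.comp_apply, hE]
  rw [hEA] at hmem
  exact (Submodule.smul_mem_iff _ (by exact_mod_cast Nat.card_pos.ne')).1 hmem

/-- Maschke's theorem, read through the correspondence of intertwining maps with module maps. -/
theorem exists_leftInverse_intertwining {K V W : Type} [Group K] [Finite K]
    [AddCommGroup V] [Module ℂ V] [AddCommGroup W] [Module ℂ W]
    (σ : Representation ℂ K W) (τ : Representation ℂ K V) (f : IntertwiningMap σ τ)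
    (hf : Function.Injective f) : ∃ r : IntertwiningMap τ σ, ∀ w, r (f w) = w := by
  obtain ⟨g, hg⟩ := MonoidAlgebra.exists_leftInverse_of_injective
    (IntertwiningMap.equivLinearMapAsModule σ τ f) (LinearMap.ker_eq_bot.2 hf)
  exact ⟨(IntertwiningMap.equivLinearMapAsModule τ σ).symm g, fun w => LinearMap.congr_fun hg w⟩

/-- If the `H`-conjugation sums commute, then `(G, H)` is a strong Gelfand pair. -/
theorem isStrongGelfandPair_of_conjSum_commute (H : Subgroup G)
    (hc : ∀ x y, Commute (conjSum H x) (conjSum H y)) : IsStrongGelfandPair H := by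
  rw [isStrongGelfandPair_iff_finrank_le]
  intro W _ _ _ σ hσ V _ _ _ ρ hρ
  set τ : Representation ℂ H V := ρ.comp H.subtype with hτ
  -- The commutant of H is spanned by images of commuting elements, hence commutative. Two
  -- independent copies of σ in V will contradict this by supplying noncommuting matrix units.
  have hcomm : ∀ A B : IntertwiningMap τ τ, A.toLinearMap * B.toLinearMap =
      B.toLinearMap * A.toLinearMap := by
    have hspan : ∀ A : IntertwiningMap τ τ, A.toLinearMap ∈
        Submodule.span ℂ (Set.range fun x => ρ.asAlgebraHom (conjSum H x)) := fun A =>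
      mem_span_conjSum_of_commute H ρ hρ _ fun h hh => (A.isIntertwining' ⟨h, hh⟩).symm
    intro A B
    have h1 : ∀ x, ∀ Y ∈ Submodule.span ℂ (Set.range fun x => ρ.asAlgebraHom (conjSum H x)),
        ρ.asAlgebraHom (conjSum H x) * Y = Y * ρ.asAlgebraHom (conjSum H x) := by
      intro x Y hY
      induction hY using Submodule.span_induction with
      | mem Y hY => obtain ⟨y, rfl⟩ := hY; exact ((hc x y).map ρ.asAlgebraHom).eq
      | zero => simp
      | add a b _ _ ha hb => rw [mul_add, add_mul, ha, hb]
      | smul c a _ ha => rw [mul_smul_comm, smul_mul_assoc, ha]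
    have hA := hspan A
    generalize A.toLinearMap = X at hA
    induction hA using Submodule.span_induction with
    | mem Y hY => obtain ⟨y, rfl⟩ := hY; exact h1 y _ (hspan B)
    | zero => simp
    | add a b _ _ ha hb => rw [mul_add, add_mul, ha, hb]
    | smul c a _ ha => rw [mul_smul_comm, smul_mul_assoc, ha]
  by_contra hcon
  push Not at hcon
  have : Module.Finite ℂ (IntertwiningMap σ τ) := inferInstance
  have hnt : Nontrivial W := by
    have := hσ.toNontrivial
    by_contra h
    rw [not_nontrivial_iff_subsingleton] at h
    obtain ⟨a, b, hab⟩ := exists_pair_ne (Subrepresentation σ)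
    exact hab (Subrepresentation.toSubmodule_injective (Subsingleton.elim _ _))
  obtain ⟨f₁, hf₁⟩ : ∃ f : IntertwiningMap σ τ, f ≠ 0 := by
    have : Nontrivial (IntertwiningMap σ τ) :=
      Module.nontrivial_of_finrank_pos (R := ℂ) (by omega)
    exact exists_ne 0
  have inj : ∀ f : IntertwiningMap σ τ, f ≠ 0 → Function.Injective f := fun f hf =>
    (IsIrreducible.injective_or_eq_zero f).resolve_right hf
  obtain ⟨r, hr⟩ := exists_leftInverse_intertwining σ τ f₁ (inj _ hf₁)
  obtain ⟨g, hg⟩ : ∃ g : IntertwiningMap σ τ, ∀ c : ℂ, c • f₁ ≠ g := by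
    by_contra h
    push Not at h
    have := finrank_le_one f₁ h
    omega
  -- By Schur's lemma r ∘ g is a scalar c, so that r vanishes on the image of g - c • f₁.
  obtain ⟨c, hcg⟩ := (IsIrreducible.algebraMap_intertwiningMap_bijective_of_isAlgClosed
    (ρ := σ) (k := ℂ)).2 (r.comp g)
  let f₂ := g - c • f₁
  have hf₂ : f₂ ≠ 0 := fun h => hg c (sub_eq_zero.1 h).symm
  have hrf₂ : ∀ w, r (f₂ w) = 0 := fun w => by
    have h1 : r (g w) = c • w := (DFunLike.congr_fun hcg w).symm
    have h2 : f₂ w = g w - c • f₁ w := rfl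
    rw [h2, map_sub, map_smul, hr, h1, sub_self]
  obtain ⟨r', hr'⟩ := exists_leftInverse_intertwining σ τ f₂ (inj _ hf₂)
  obtain ⟨w, hw⟩ := exists_ne (0 : W)
  -- One order of composition sends f₁ w to f₁ w, the other into the image of f₂, which r kills;
  -- applying r gives w = 0.
  have h := LinearMap.congr_fun (hcomm (f₂.comp r) (f₁.comp r')) (f₁ w)
  have h1 : f₂ (r (f₁ (r' (f₁ w)))) = f₁ (r' (f₂ (r (f₁ w)))) := h
  rw [hr, hr, hr'] at h1
  apply hw
  rw [← hr w, ← h1, hrf₂]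

/-- The `H`-conjugation sums of a strong Gelfand pair commute. -/
theorem IsStrongGelfandPair.conjSum_commute {H : Subgroup G} (hH : IsStrongGelfandPair H)
    (x y : G) : Commute (conjSum H x) (conjSum H y) := by
  classical
  rw [isStrongGelfandPair_iff_finrank_le] at hH
  have irr : ∀ (V : Type) [AddCommGroup V] [Module ℂ V] [FiniteDimensional ℂ V]
        (ρ : Representation ℂ G V), ρ.IsIrreducible →
        ρ.asAlgebraHom (conjSum H x * conjSum H y - conjSum H y * conjSum H x) = 0 := by
    intro V _ _ _ ρ hρ
    set τ : Representation ℂ H V := ρ.comp H.subtype with hτ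
    have hP : ∀ z, ∃ A : IntertwiningMap τ τ, A.toLinearMap = ρ.asAlgebraHom (conjSum H z) := by
      intro z
      refine ⟨⟨ρ.asAlgebraHom (conjSum H z), fun k => ?_⟩, rfl⟩
      change ρ.asAlgebraHom (conjSum H z) * ρ (k : G) = ρ (k : G) * ρ.asAlgebraHom (conjSum H z)
      rw [asAlgebraHom_conjSum, Finset.mul_sum, Finset.sum_mul]
      refine Fintype.sum_equiv (Equiv.mulLeft k⁻¹) _ _ fun h => ?_
      simp [mul_assoc, ← map_mul]
    obtain ⟨A, hA⟩ := hP x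
    obtain ⟨B, hB⟩ := hP y
    -- The intertwining maps N → V form a space of dimension at most one, on which A and B act by
    -- scalars, so their commutator kills the image of f.
    refine eq_zero_of_comp_irreducible τ _ fun N _ _ _ σ hσ f => ?_
    have hle := hH N σ hσ V ρ hρ
    by_cases hf : f = 0
    · rw [hf]; simp
    have hsc := fun g => exists_smul_eq_of_finrank_eq_one
      (le_antisymm hle (Nat.one_le_iff_ne_zero.2 fun h0 => hf
        (by rw [Module.finrank_eq_zero_iff_of_free] at h0; exact Subsingleton.elim _ _))) hf g
    obtain ⟨a, ha⟩ := hsc (A.comp f)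
    obtain ⟨b, hb⟩ := hsc (B.comp f)
    ext v
    have ha' : ∀ v, A (f v) = a • f v := fun v => (DFunLike.congr_fun ha v).symm
    have hb' : ∀ v, B (f v) = b • f v := fun v => (DFunLike.congr_fun hb v).symm
    have : A (B (f v)) - B (A (f v)) = 0 := by
      rw [hb', ha', map_smul, map_smul, ha', hb', smul_comm, sub_self]
    rw [map_sub, map_mul, map_mul, ← hA, ← hB]
    exact this
  -- The group algebra acts faithfully on its regular representation, so vanishing on all
  -- irreducibles forces the commutator to be zero.
  let L : Representation ℂ G ℂ[G] := Representation.leftRegular ℂ G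
  have h0 : L.asAlgebraHom (conjSum H x * conjSum H y - conjSum H y * conjSum H x) = 0 := by
    refine eq_zero_of_comp_irreducible L _ fun N _ _ _ σ hσ f => ?_
    have h := irr N σ hσ
    have hf : ∀ r, L.asAlgebraHom r ∘ₗ f.toLinearMap = f.toLinearMap ∘ₗ σ.asAlgebraHom r := by
      intro r
      induction r using MonoidAlgebra.induction_linear with
      | zero => simp
      | add x y hx hy => rw [map_add, map_add, LinearMap.add_comp, LinearMap.comp_add, hx, hy]
      | single g a =>
        rw [asAlgebraHom_single, asAlgebraHom_single, LinearMap.smul_comp, LinearMap.comp_smul,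
          f.isIntertwining' g]
    rw [hf, h, LinearMap.comp_zero]
  have h1 := LinearMap.congr_fun h0 (1 : ℂ[G])
  rw [Representation.asAlgebraHom_ofMulAction_smul_eq_mul] at h1
  exact sub_eq_zero.1 (by simpa using h1)

end Commuting

open Representation MonoidAlgebra

/-! ### Certificates for and against, invariance and monotonicity -/

section Criteria

variable {G : Type} [Group G] [Fintype G]

/-- The coefficient of x * y in the product of the sums of x and y is positive, so it is nonzero in
the reversed product too. All refutations rest on this weak consequence of commutativity. -/
theorem IsStrongGelfandPair.exists_conj_mul_conj_eq {H : Subgroup G} (hH : IsStrongGelfandPair H)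
    (x y : G) : ∃ h₁ ∈ H, ∃ h₂ ∈ H, h₁ * y * h₁⁻¹ * (h₂ * x * h₂⁻¹) = x * y := by
  classical
  by_contra hcon
  push Not at hcon
  have h := congrArg (fun r : ℂ[G] => r.coeff (x * y)) (hH.conjSum_commute x y).eq
  simp only [conjSum_eq_sum, Finset.sum_mul_sum, single_mul_single, mul_one, coeff_sum,
    Finsupp.finsetSum_apply, coeff_single, Finsupp.single_apply] at h
  have h2 : ∀ a b : H, ((a * y * a⁻¹ * (b * x * b⁻¹) : G) = x * y) = False := fun a b =>
    eq_false (hcon a a.2 b b.2)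
  simp only [h2, if_false, Finset.sum_const_zero] at h
  norm_cast at h
  rw [Finset.sum_eq_zero_iff] at h
  have h3 := h 1 (Finset.mem_univ _)
  rw [Finset.sum_eq_zero_iff] at h3
  simpa using h3 1 (Finset.mem_univ _)

theorem conjSum_conj {H : Subgroup G} {h : G} (hh : h ∈ H) (x : G) :
    conjSum H (h * x * h⁻¹) = conjSum H x := by
  classical
  rw [conjSum_eq_sum, conjSum_eq_sum]
  refine Fintype.sum_equiv (Equiv.mulRight ⟨h, hh⟩) _ _ fun k => ?_
  simp [mul_assoc]

theorem conjSum_center_mul {H : Subgroup G} {c : G} (hc : c ∈ Subgroup.center G) (x : G) :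
    conjSum H (c * x) = single c 1 * conjSum H x := by
  classical
  rw [conjSum_eq_sum, conjSum_eq_sum, Finset.mul_sum]
  refine Finset.sum_congr rfl fun k _ => ?_
  have := Subgroup.mem_center_iff.1 hc k
  rw [single_mul_single, mul_one]
  simp only [← mul_assoc, this]

-- In the double sum over h and k, the substitution k ↦ h k turns h into an overall conjugation,
-- which leaves a single sum of conjugation sums.
omit [Fintype G] in
theorem conjSum_mul_conjSum (H : Subgroup G) [Fintype H] (x y : G) :
    conjSum H x * conjSum H y = ∑ k : H, conjSum H (x * (k * y * (k : G)⁻¹)) := by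
  simp only [conjSum_eq_sum, Finset.sum_mul_sum, single_mul_single, mul_one]
  rw [Finset.sum_comm (γ := H)]
  conv_rhs => rw [Finset.sum_comm]
  rw [Finset.sum_comm]
  refine Finset.sum_congr rfl fun h _ => ?_
  refine Fintype.sum_equiv (Equiv.mulLeft h⁻¹) _ _ fun k => ?_
  simp [mul_assoc]

omit [Fintype G] in
theorem conjSum_mul_conjSum' (H : Subgroup G) [Fintype H] (x y : G) :
    conjSum H y * conjSum H x = ∑ k : H, conjSum H (k * y * (k : G)⁻¹ * x) := by
  simp only [conjSum_eq_sum, Finset.sum_mul_sum, single_mul_single, mul_one]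
  rw [Finset.sum_comm]
  conv_rhs => rw [Finset.sum_comm]
  refine Finset.sum_congr rfl fun h _ => ?_
  refine Fintype.sum_equiv (Equiv.mulLeft h⁻¹) _ _ fun k => ?_
  simp [mul_assoc]

/-- By `hcl` the conjugation sum of z depends only on cl z, so a product of two sums is determined
by a multiset of values of cl. Representatives up to the center suffice, since a central factor only
multiplies the sum by a central element. Commuting being symmetric, each pair needs a test in one
order only. -/
theorem isStrongGelfandPair_of_perm (H : Subgroup G) (L : List G) (hL : L.Nodup)
    (hLH : ∀ g, g ∈ L ↔ g ∈ H) (cl : G → ℕ)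
    (hcl : ∀ z z', cl z = cl z' → ∃ h ∈ H, z' = h * z * h⁻¹) (R : Set G)
    (hR : ∀ z, ∃ r ∈ R, ∃ h ∈ H, ∃ c ∈ Subgroup.center G, z = c * (h * r * h⁻¹))
    (hperm : ∀ x ∈ R, ∀ y ∈ R, x = y ∨
      (L.map fun k => cl (x * (k * y * k⁻¹))).Perm (L.map fun k => cl (k * y * k⁻¹ * x)) ∨
      (L.map fun k => cl (y * (k * x * k⁻¹))).Perm (L.map fun k => cl (k * x * k⁻¹ * y))) :
    IsStrongGelfandPair H := by
  classical
  apply isStrongGelfandPair_of_conjSum_commute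
  have key : ∀ x y : G,
      (L.map fun k => cl (x * (k * y * k⁻¹))).Perm (L.map fun k => cl (k * y * k⁻¹ * x)) →
      Commute (conjSum H x) (conjSum H y) := by
    intro x y hxy
    rw [Commute, SemiconjBy, conjSum_mul_conjSum, conjSum_mul_conjSum']
    have hsum : ∀ f : G → ℂ[G], ∑ k : H, f k = (L.map f).sum := by
      intro f
      rw [← List.sum_toFinset f hL]
      exact (Finset.sum_subtype _ (fun g => by rw [List.mem_toFinset, hLH]) f).symm
    have hfac : ∃ F : ℕ → ℂ[G], ∀ z, conjSum H z = F (cl z) := by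
      refine ⟨fun n => if hn : ∃ z, cl z = n then conjSum H hn.choose else 0, fun z => ?_⟩
      have hn : ∃ z', cl z' = cl z := ⟨z, rfl⟩
      beta_reduce
      rw [dif_pos hn]
      obtain ⟨h, hh, he⟩ := hcl _ _ hn.choose_spec
      conv_lhs => rw [he]
      exact conjSum_conj hh _
    obtain ⟨F, hF⟩ := hfac
    rw [hsum fun k => conjSum H (x * (k * y * k⁻¹)), hsum fun k => conjSum H (k * y * k⁻¹ * x)]
    simp only [hF]
    have := (hxy.map F).sum_eq
    simpa [List.map_map, Function.comp_def] using this
  have key : ∀ x ∈ R, ∀ y ∈ R, Commute (conjSum H x) (conjSum H y) := by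
    intro x hx y hy
    rcases hperm x hx y hy with rfl | h | h
    exacts [Commute.refl _, key x y h, (key y x h).symm]
  intro x y
  obtain ⟨x, hx, h, hh, c, hc, rfl⟩ := hR x
  obtain ⟨y, hy, k, hk, d, hd, rfl⟩ := hR y
  rw [conjSum_center_mul hc, conjSum_center_mul hd, conjSum_conj hh, conjSum_conj hk]
  have hcen : ∀ c ∈ Subgroup.center G, ∀ r : ℂ[G], Commute (single c (1 : ℂ)) r := by
    intro c hc r
    induction r using MonoidAlgebra.induction_linear with
    | zero => exact Commute.zero_right _
    | add a b ha hb => exact ha.add_right hb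
    | single g a =>
      rw [Commute, SemiconjBy, single_mul_single, single_mul_single, one_mul, mul_one,
        Subgroup.mem_center_iff.1 hc g]
  exact ((hcen c hc _).mul_left ((hcen d hd _).symm.mul_right (key x hx y hy)))

/-- The induced automorphism of the group algebra carries conjugation sums for H to those for the
image. Besides conjugations this serves for the outer automorphism `flipEquiv`. -/
theorem IsStrongGelfandPair.map_equiv {H : Subgroup G} (hH : IsStrongGelfandPair H) (e : G ≃* G) :
    IsStrongGelfandPair (H.map e.toMonoidHom) := by
  classical
  apply isStrongGelfandPair_of_conjSum_commute
  have key : ∀ x, conjSum (H.map e.toMonoidHom) x =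
      MonoidAlgebra.mapDomainRingHom ℂ e.toMonoidHom (conjSum H (e.symm x)) := by
    intro x
    rw [conjSum_eq_sum, conjSum_eq_sum, map_sum]
    refine (Fintype.sum_equiv (H.equivMapOfInjective e.toMonoidHom e.injective).toEquiv _ _
      fun k => ?_).symm
    simp
    rfl
  intro x y
  rw [key, key]
  exact (hH.conjSum_commute _ _).map _

theorem isStrongGelfandPair_map_equiv_iff {H : Subgroup G} (e : G ≃* G) :
    IsStrongGelfandPair (H.map e.toMonoidHom) ↔ IsStrongGelfandPair H := by
  refine ⟨fun h => ?_, fun h => h.map_equiv e⟩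
  have := h.map_equiv e.symm
  rw [Subgroup.map_map] at this
  convert this
  rw [show e.symm.toMonoidHom.comp e.toMonoidHom = MonoidHom.id G by ext; simp, Subgroup.map_id]

end Criteria

section SubgroupConj

variable {G : Type*} [Group G] {H K L : Subgroup G}

theorem SubgroupConj.symm (h : SubgroupConj H K) : SubgroupConj K H := by
  obtain ⟨g, rfl⟩ := h
  refine ⟨g⁻¹, ?_⟩
  rw [Subgroup.map_map]
  convert (Subgroup.map_id K).symm
  ext; simp [mul_assoc]

theorem SubgroupConj.trans (h : SubgroupConj H K) (h' : SubgroupConj K L) : SubgroupConj H L := by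
  obtain ⟨g, rfl⟩ := h
  obtain ⟨g', rfl⟩ := h'
  refine ⟨g * g', ?_⟩
  rw [Subgroup.map_map]
  congr 1
  ext; simp

end SubgroupConj

theorem SubgroupConj.isStrongGelfandPair_iff {G : Type} [Group G] [Fintype G] {H K : Subgroup G}
    (h : SubgroupConj H K) : IsStrongGelfandPair H ↔ IsStrongGelfandPair K := by
  obtain ⟨g, rfl⟩ := h
  exact isStrongGelfandPair_map_equiv_iff _

/-- A subgroup containing the small group of a strong Gelfand pair gives a strong Gelfand pair. -/
theorem IsStrongGelfandPair.mono {G : Type} [Group G] [Fintype G] {H K : Subgroup G}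
    (hH : IsStrongGelfandPair H) (hHK : H ≤ K) : IsStrongGelfandPair K := by
  classical
  apply isStrongGelfandPair_of_conjSum_commute
  -- Each sum over K decomposes into sums over H, so commutation is inherited by K.
  have key : ∀ x, (Nat.card H : ℂ) • conjSum K x = ∑ k : K, conjSum H (k * x * (k : G)⁻¹) := by
    intro x
    simp only [conjSum_eq_sum]
    have hk : ∀ h : H, ∑ k : K, single (h * (k * x * (k : G)⁻¹) * h⁻¹ : G) (1 : ℂ) =
        ∑ k : K, single (k * x * k⁻¹ : G) (1 : ℂ) := fun h => by
      refine Fintype.sum_equiv (Equiv.mulLeft ⟨h, hHK h.2⟩) _ _ fun k => ?_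
      simp [mul_assoc]
    rw [Finset.sum_comm, Finset.sum_congr rfl fun h _ => hk h, Finset.sum_const,
      Finset.card_univ, Nat.cast_smul_eq_nsmul, Nat.card_eq_fintype_card]
  have hne : (Nat.card H : ℂ) ≠ 0 := by exact_mod_cast Nat.card_pos.ne'
  intro x y
  have h : Commute ((Nat.card H : ℂ) • conjSum K x) ((Nat.card H : ℂ) • conjSum K y) := by
    rw [key, key]
    exact Commute.sum_left _ _ _ fun i _ =>
      Commute.sum_right _ _ _ fun j _ => hH.conjSum_commute _ _
  have := (h.smul_left (Nat.card H : ℂ)⁻¹).smul_right (Nat.card H : ℂ)⁻¹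
  rwa [inv_smul_smul₀ hne, inv_smul_smul₀ hne] at this

/-! ### Arithmetic of matrices modulo p on natural numbers -/

/-- A `2 × 2` matrix of natural numbers, used to compute with matrices over `ZMod p`. -/
structure Code where
  /-- top left entry -/
  a : ℕ
  /-- top right entry -/
  b : ℕ
  /-- bottom left entry -/
  c : ℕ
  /-- bottom right entry -/
  d : ℕ
deriving DecidableEq

namespace Code

/-- `a * b + c * d` modulo `p`. -/
def dot (p a b c d : ℕ) : ℕ := Nat.mod (Nat.add (Nat.mul a b) (Nat.mul c d)) p

/-- Matrix multiplication modulo `p`. -/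
def mul (p : ℕ) : Code → Code → Code
  | ⟨a, b, c, d⟩, ⟨e, f, g, h⟩ => ⟨dot p a e b g, dot p a f b h, dot p c e d g, dot p c f d h⟩

/-- The inverse modulo `p` of a matrix of determinant one. -/
def inv (p : ℕ) : Code → Code
  | ⟨a, b, c, d⟩ => ⟨d, (p - b) % p, (p - c) % p, a⟩

/-- The identity matrix. -/
def one : Code := ⟨1, 0, 0, 1⟩

/-- `k * x * k⁻¹` modulo `p`. -/
def conj (p : ℕ) (k x : Code) : Code := mul p (mul p k x) (inv p k)

/-- An injective numbering of the matrices of determinant one with entries below `p`. -/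
def idx (p : ℕ) : Code → ℕ
  | ⟨0, b, _, d⟩ => Nat.add (Nat.mul b p) d
  | ⟨a + 1, b, c, _⟩ => Nat.add (Nat.mul (Nat.add (Nat.mul (a + 1) p) b) p) c

/-- Boolean equality. -/
def eqb : Code → Code → Bool
  | ⟨a, b, c, d⟩, ⟨e, f, g, h⟩ => Nat.beq a e && Nat.beq b f && Nat.beq c g && Nat.beq d h

theorem eqb_iff {x y : Code} : eqb x y = true ↔ x = y := by
  obtain ⟨a, b, c, d⟩ := x
  obtain ⟨e, f, g, h⟩ := y
  simp [eqb, and_assoc]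

/-- Membership in a list. -/
def memb (x : Code) (L : List Code) : Bool := L.any (eqb x)

theorem memb_iff {x : Code} {L : List Code} : memb x L = true ↔ x ∈ L := by
  simp [memb, eqb_iff]

/-- The matrix has entries below `p` and determinant one modulo `p`. -/
def valid (p : ℕ) : Code → Bool
  | ⟨a, b, c, d⟩ => Nat.blt a p && Nat.blt b p && Nat.blt c p && Nat.blt d p &&
      Nat.beq (Nat.mod (a * d) p) (Nat.mod (b * c + 1) p)

/-- The `n`-th power modulo `p`. -/
def npow (p n : ℕ) (x : Code) : Code := Nat.rec one (fun _ y => mul p y x) n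

/-- The power of `x` whose exponent is the product of the list `ns`. -/
def powProd (p : ℕ) (ns : List ℕ) (x : Code) : Code := ns.foldl (fun y n => npow p n y) x

/-- The value of a word in two letters. -/
def word (p : ℕ) (x y : Code) : List Bool → Code
  | [] => one
  | true :: w => mul p x (word p x y w)
  | false :: w => mul p y (word p x y w)

/-- All matrices of determinant one modulo `p`. -/
def enum (p : ℕ) : List Code :=
  ((List.range (p - 1)).flatMap fun a => (List.range p).flatMap fun b => (List.range p).map fun c =>
    ⟨a + 1, b, c, Nat.mod ((a + 1) ^ (p - 2) * (b * c + 1)) p⟩) ++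
  ((List.range (p - 1)).flatMap fun b => (List.range p).map fun d =>
    ⟨0, b + 1, Nat.mod ((p - 1) * (b + 1) ^ (p - 2)) p, d⟩)

/-- The set of numbers of a list of matrices, as a bit mask. -/
def mask (p : ℕ) (L : List Code) : ℕ := L.foldl (fun m x => m ||| 1 <<< idx p x) 0

theorem testBit_mask {p : ℕ} {L : List Code} {n : ℕ} :
    (mask p L).testBit n = true ↔ ∃ x ∈ L, idx p x = n := by
  have : ∀ m, (L.foldl (fun m x => m ||| 1 <<< idx p x) m).testBit n = true ↔
      m.testBit n = true ∨ ∃ x ∈ L, idx p x = n := by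
    induction L with
    | nil => simp
    | cons y L ih =>
      intro m
      rw [List.foldl_cons, ih]
      simp only [Nat.testBit_or, Nat.one_shiftLeft, Nat.testBit_two_pow, Bool.or_eq_true,
        decide_eq_true_eq, List.mem_cons, exists_eq_or_imp, or_assoc]
  simpa [mask] using this 0

end Code

/-! ### Correctness of the coding -/

namespace Matrix.SpecialLinearGroup

open Code

variable {p : ℕ} [hp : Fact p.Prime]

/-- The representatives below `p` of the entries of a matrix over `ZMod p`. -/
def enc (A : SL(2, ZMod p)) : Code := ⟨(A 0 0).val, (A 0 1).val, (A 1 0).val, (A 1 1).val⟩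

theorem enc_injective : Function.Injective (enc : SL(2, ZMod p) → Code) := by
  intro A B h
  simp only [enc, Code.mk.injEq] at h
  obtain ⟨h1, h2, h3, h4⟩ := h
  have := ZMod.val_injective p
  ext i j
  fin_cases i <;> fin_cases j
  exacts [this h1, this h2, this h3, this h4]

theorem enc_inj {A B : SL(2, ZMod p)} : enc A = enc B ↔ A = B := enc_injective.eq_iff

theorem enc_one : enc (1 : SL(2, ZMod p)) = Code.one := by
  have : Fact (1 < p) := ⟨hp.out.one_lt⟩
  simp [enc, Code.one, ZMod.val_one]

theorem enc_mul (A B : SL(2, ZMod p)) : enc (A * B) = Code.mul p (enc A) (enc B) := by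
  have : ∀ a b c d : ZMod p, (a * b + c * d).val = dot p a.val b.val c.val d.val := by
    intro a b c d
    rw [ZMod.val_add, ZMod.val_mul, ZMod.val_mul, ← Nat.add_mod]
    rfl
  simp [enc, Code.mul, Matrix.mul_apply, Fin.sum_univ_two, this]

theorem enc_inv (A : SL(2, ZMod p)) : enc A⁻¹ = Code.inv p (enc A) := by
  have : ∀ a : ZMod p, (-a).val = (p - a.val) % p := by
    intro a
    rw [ZMod.neg_val]
    split_ifs with h
    · simp [h]
    · rw [Nat.mod_eq_of_lt]
      have := (ZMod.val_ne_zero a).2 h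
      have := hp.out.pos
      omega
  simp [enc, Code.inv, SL2_inv_expl, this]

theorem enc_conj (A B : SL(2, ZMod p)) : enc (A * B * A⁻¹) = Code.conj p (enc A) (enc B) := by
  simp [Code.conj, enc_mul, enc_inv]

theorem enc_pow (A : SL(2, ZMod p)) (n : ℕ) : enc (A ^ n) = Code.npow p n (enc A) := by
  induction n with
  | zero => simp [enc_one, npow]
  | succ n ih => rw [pow_succ, enc_mul, ih]; rfl

theorem enc_pow_prod (A : SL(2, ZMod p)) (ns : List ℕ) :
    enc (A ^ ns.prod) = Code.powProd p ns (enc A) := by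
  induction ns generalizing A with
  | nil => simp [powProd]
  | cons n ns ih => rw [List.prod_cons, pow_mul, ih, enc_pow]; rfl

theorem det_eq (A : SL(2, ZMod p)) : A 0 0 * A 1 1 = A 0 1 * A 1 0 + 1 := by
  have := A.det_coe
  rw [Matrix.det_fin_two] at this
  linear_combination this

theorem valid_enc (A : SL(2, ZMod p)) : valid p (enc A) = true := by
  have h := congrArg ZMod.val (det_eq A)
  rw [ZMod.val_mul, ZMod.val_add, ZMod.val_mul, ZMod.val_one'' hp.out.ne_one, Nat.mod_add_mod] at h
  simp only [enc, valid, Bool.and_eq_true, Nat.blt_eq, Nat.beq_eq, ZMod.val_lt, and_self, true_and]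
  exact h

theorem exists_enc_eq {x : Code} (hx : valid p x = true) : ∃ A : SL(2, ZMod p), enc A = x := by
  obtain ⟨a, b, c, d⟩ := x
  simp only [valid, Bool.and_eq_true, Nat.blt_eq, Nat.beq_eq] at hx
  obtain ⟨⟨⟨⟨ha, hb⟩, hc⟩, hd⟩, h⟩ := hx
  have h' : ((a * d : ℕ) : ZMod p) = ((b * c + 1 : ℕ) : ZMod p) :=
    (ZMod.natCast_eq_natCast_iff _ _ _).2 h
  push_cast at h'
  refine ⟨⟨!![(a : ZMod p), b; c, d], ?_⟩, ?_⟩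
  · rw [Matrix.det_fin_two_of, h']; ring
  · simp [enc, ZMod.val_natCast, Nat.mod_eq_of_lt, ha, hb, hc, hd]

/-- The matrix over `ZMod p` with the given entries, if these have determinant one. -/
noncomputable def dec (p : ℕ) [Fact p.Prime] (x : Code) : SL(2, ZMod p) :=
  if h : valid p x = true then (exists_enc_eq h).choose else 1

theorem enc_dec {x : Code} (hx : valid p x = true) : enc (dec p x) = x := by
  rw [dec, dif_pos hx]
  exact (exists_enc_eq hx).choose_spec

theorem dec_enc (A : SL(2, ZMod p)) : dec p (enc A) = A := enc_injective (enc_dec (valid_enc A))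

/-- The entry left out of the number is recovered from the determinant: the last one if the first is
nonzero, and otherwise the lower left one. The two cases have disjoint ranges, below p ^ 2 and from
p ^ 2 on. -/
theorem idx_enc_injective : Function.Injective fun A : SL(2, ZMod p) => idx p (enc A) := by
  intro A B h
  have hdA := det_eq A
  have hdB := det_eq B
  have hval : ∀ a b : ZMod p, a.val = b.val → a = b := fun _ _ h => ZMod.val_injective p h
  have hlt : ∀ a : ZMod p, a.val < p := fun a => ZMod.val_lt a
  have hp0 : 0 < p := hp.out.pos
  have dig : ∀ {a b c d : ℕ}, b < p → d < p → a * p + b = c * p + d → a = c ∧ b = d := by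
    intro a b c d hb hd h
    have h1 := congrArg (· / p) h
    have h2 := congrArg (· % p) h
    simp only [Nat.mul_add_mod_self_right, Nat.mod_eq_of_lt hb, Nat.mod_eq_of_lt hd] at h2
    rw [h2] at h
    exact ⟨Nat.eq_of_mul_eq_mul_right hp0 (Nat.add_right_cancel h), h2⟩
  have big : ∀ a b c b' d' : ℕ, b' < p → d' < p → (((a + 1) * p + b) * p + c) ≠ b' * p + d' := by
    intro a b c b' d' hb' hd' h
    have h1 : (b' + 1) * p ≤ p * p := Nat.mul_le_mul_right p hb'
    have h2 : 1 * p ≤ (a + 1) * p := Nat.mul_le_mul_right p (by omega)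
    have h3 : p * p ≤ ((a + 1) * p + b) * p := Nat.mul_le_mul_right p (by omega)
    rw [Nat.add_mul, Nat.one_mul] at h1
    omega
  have entries : ∀ (i j : Fin 2), A i j = B i j := by
    rcases ha : (A 0 0).val with _ | a <;> rcases hb : (B 0 0).val with _ | b <;>
      simp only [enc, ha, hb, idx, Nat.add_eq, Nat.mul_eq] at h
    · obtain ⟨h1, h2⟩ := dig (hlt _) (hlt _) h
      have ha0 : A 0 0 = 0 := by simpa using ha
      have hb0 : B 0 0 = 0 := by simpa using hb
      have h1 := hval _ _ h1
      have h2 := hval _ _ h2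
      have hne : A 0 1 ≠ 0 := by
        intro h0
        rw [h0, ha0] at hdA
        simp at hdA
      have h3 : A 1 0 = B 1 0 := by
        rw [ha0] at hdA
        rw [hb0, ← h1] at hdB
        exact mul_left_cancel₀ hne (by linear_combination hdB - hdA)
      intro i j
      fin_cases i <;> fin_cases j
      exacts [ha0.trans hb0.symm, h1, h3, h2]
    · exact (big _ _ _ _ _ (hlt _) (hlt _) h.symm).elim
    · exact (big _ _ _ _ _ (hlt _) (hlt _) h).elim
    · obtain ⟨h1, h2⟩ := dig (hlt _) (hlt _) h
      obtain ⟨h0, h1⟩ := dig (hlt _) (hlt _) h1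
      have h0 : A 0 0 = B 0 0 := hval _ _ (by rw [ha, hb, h0])
      have h1 := hval _ _ h1
      have h2 := hval _ _ h2
      have hne : A 0 0 ≠ 0 := by
        intro h0
        rw [h0] at ha
        simp at ha
      have h3 : A 1 1 = B 1 1 := by
        rw [← h0, ← h1, ← h2] at hdB
        exact mul_left_cancel₀ hne (by linear_combination hdA - hdB)
      intro i j
      fin_cases i <;> fin_cases j
      exacts [h0, h1, h2, h3]
  ext i j
  exact entries i j

/-- The enumeration solves the determinant equation for one entry, writing inverses as powers with
exponent p - 2 by Fermat's little theorem. -/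
theorem enc_mem_enum (A : SL(2, ZMod p)) : enc A ∈ enum p := by
  have hd := det_eq A
  have hp1 := hp.out.one_lt
  have hinv : ∀ a : ZMod p, a ≠ 0 → a ^ (p - 2) = a⁻¹ := by
    intro a ha
    have := ZMod.pow_card_sub_one_eq_one ha
    rw [show p - 1 = p - 2 + 1 by omega, pow_succ] at this
    exact eq_inv_of_mul_eq_one_left this
  have hval : ∀ (n : ℕ) (a : ZMod p), (n : ZMod p) = a → n % p = a.val := by
    rintro n a rfl
    rw [ZMod.val_natCast]
  have hlt : ∀ a : ZMod p, a.val < p := fun a => ZMod.val_lt a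
  rcases ha : (A 0 0).val with _ | a
  · have ha0 : A 0 0 = 0 := by simpa using ha
    have hne : A 0 1 ≠ 0 := by
      intro h0
      rw [h0, ha0] at hd
      simp at hd
    have hb := (ZMod.val_ne_zero _).2 hne
    refine List.mem_append_right _ (List.mem_flatMap.2 ⟨(A 0 1).val - 1, ?_, ?_⟩)
    · have := hlt (A 0 1)
      rw [List.mem_range]; omega
    · refine List.mem_map.2 ⟨(A 1 1).val, List.mem_range.2 (hlt _), ?_⟩
      rw [Nat.sub_add_cancel (by omega)]
      simp only [enc, ha, Code.mk.injEq, true_and, and_true]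
      refine hval _ _ ?_
      push_cast [Nat.cast_sub hp1.le]
      rw [ZMod.natCast_zmod_val, CharP.cast_eq_zero, hinv _ hne]
      rw [ha0] at hd
      field_simp
      linear_combination hd
  · have hne : A 0 0 ≠ 0 := by
      intro h0
      rw [h0] at ha
      simp at ha
    refine List.mem_append_left _ (List.mem_flatMap.2 ⟨a, ?_, ?_⟩)
    · have := hlt (A 0 0)
      rw [List.mem_range]; omega
    · refine List.mem_flatMap.2 ⟨(A 0 1).val, List.mem_range.2 (hlt _), ?_⟩
      refine List.mem_map.2 ⟨(A 1 0).val, List.mem_range.2 (hlt _), ?_⟩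
      simp only [enc, ha, Code.mk.injEq, true_and]
      refine hval _ _ ?_
      rw [← ha]
      push_cast
      simp only [ZMod.natCast_zmod_val]
      rw [hinv _ hne]
      field_simp
      linear_combination -hd

theorem forall_of_all_enum {f : Code → Bool} (h : (enum p).all f = true) (A : SL(2, ZMod p)) :
    f (enc A) = true :=
  List.all_eq_true.1 h _ (enc_mem_enum A)

/-- The value of a word in two matrices. -/
def evalWord (X Y : SL(2, ZMod p)) : List Bool → SL(2, ZMod p)
  | [] => 1
  | true :: w => X * evalWord X Y w
  | false :: w => Y * evalWord X Y w

theorem enc_evalWord (X Y : SL(2, ZMod p)) (w : List Bool) :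
    enc (evalWord X Y w) = word p (enc X) (enc Y) w := by
  induction w with
  | nil => exact enc_one
  | cons b w ih => cases b <;> simp [evalWord, word, enc_mul, ih]

omit hp in
theorem evalWord_mem {H : Subgroup SL(2, ZMod p)} {X Y : SL(2, ZMod p)} (hX : X ∈ H) (hY : Y ∈ H)
    (w : List Bool) : evalWord X Y w ∈ H := by
  induction w with
  | nil => exact one_mem H
  | cons b w ih =>
    cases b
    exacts [mul_mem hY ih, mul_mem hX ih]

end Matrix.SpecialLinearGroup

/-! ### Executable tests and their soundness -/

/-- A list of fewer than `256` numbers is determined up to order by the sum of the corresponding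
powers of `256`. -/
theorem List.perm_of_sum_pow_eq {L M : List ℕ} (hL : L.length < 256) (hM : M.length < 256)
    (h : (L.map (256 ^ ·)).sum = (M.map (256 ^ ·)).sum) : L.Perm M := by
  -- Here u collects the powers below the c-th and m those above it. With fewer than 256 terms
  -- nothing carries into digit c, so this digit is the count of c.
  have key : ∀ (L : List ℕ) (c : ℕ), ∃ u m, (L.map (256 ^ ·)).sum =
      u + L.count c * 256 ^ c + m * 256 ^ (c + 1) ∧ u * 256 ≤ (L.length - L.count c) * 256 ^ c := by
    intro L c
    induction L with
    | nil => exact ⟨0, 0, by simp⟩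
    | cons a L ih =>
      obtain ⟨u, m, h1, h2⟩ := ih
      have hc : L.count c ≤ L.length := List.count_le_length
      rcases lt_trichotomy a c with hac | rfl | hac
      · refine ⟨256 ^ a + u, m, ?_, ?_⟩
        · rw [List.map_cons, List.sum_cons, h1, List.count_cons_of_ne hac.ne]
          ring
        · rw [List.count_cons_of_ne hac.ne, List.length_cons,
            show L.length + 1 - L.count c = (L.length - L.count c) + 1 by omega, add_mul, add_mul,
            one_mul, add_comm, ← pow_succ]
          exact add_le_add h2 (Nat.pow_le_pow_right (by norm_num) hac)
      · refine ⟨u, m, ?_, ?_⟩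
        · rw [List.map_cons, List.sum_cons, h1, List.count_cons_self]
          ring
        · rw [List.count_cons_self, List.length_cons, Nat.add_sub_add_right]
          exact h2
      · refine ⟨u, m + 256 ^ (a - (c + 1)), ?_, ?_⟩
        · rw [List.map_cons, List.sum_cons, h1, List.count_cons_of_ne hac.ne', add_mul, ← pow_add,
            Nat.sub_add_cancel hac]
          ring
        · rw [List.count_cons_of_ne hac.ne', List.length_cons]
          exact h2.trans (Nat.mul_le_mul_right _ (by omega))
  have digit : ∀ (L : List ℕ) (c : ℕ), L.length < 256 →
      (L.map (256 ^ ·)).sum / 256 ^ c % 256 = L.count c := by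
    intro L c hlen
    obtain ⟨u, m, h1, h2⟩ := key L c
    have hc : L.count c ≤ L.length := List.count_le_length
    have hpos : 0 < 256 ^ c := by positivity
    have hu : u < 256 ^ c := by
      have : (L.length - L.count c) * 256 ^ c < 256 * 256 ^ c :=
        Nat.mul_lt_mul_of_pos_right (by omega) hpos
      omega
    rw [h1, pow_succ, show u + L.count c * 256 ^ c + m * (256 ^ c * 256) =
      u + (L.count c + m * 256) * 256 ^ c by ring, Nat.add_mul_div_right _ _ hpos,
      Nat.div_eq_of_lt hu, zero_add, Nat.add_mul_mod_self_right, Nat.mod_eq_of_lt (by omega)]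
  rw [List.perm_iff_count]
  intro c
  rw [← digit L c hL, ← digit M c hM, h]

namespace Code

/-- No product of an `L`-conjugate of `y` and an `L`-conjugate of `x` equals `x * y`. -/
def noProduct (p : ℕ) (L : List Code) (x y : Code) : Bool :=
  valid p x && valid p y &&
    (L.map fun k => conj p k y).all fun u => (L.map fun k => conj p k x).all fun v =>
      !eqb (mul p u v) (mul p x y)

/-- Some word in `x` and `y` is a member of `ts`, or has nontrivial `ns.prod`-th power. -/
def wordTest (p : ℕ) (ns : List ℕ) (ws : List (List Bool)) (ts : List Code) (x y : Code) : Bool :=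
  (ws.map (word p x y)).any fun z => memb z ts || !eqb (powProd p ns z) one

/-- Every matrix `y` of order dividing `l` is a member of `xs` or passes `wordTest` with `x`. -/
def pairTest (p l : ℕ) (xs : List Code) (ns : List ℕ) (ws : List (List Bool)) (ts : List Code)
    (x : Code) : Bool :=
  (enum p).all fun y => !eqb (npow p l y) one || memb y xs || wordTest p ns ws ts x y

/-- The matrices conjugating `x` into `xs`. -/
def conjInto (p : ℕ) (xs : List Code) (x : Code) : List Code :=
  (enum p).filter fun k => memb (conj p k x) xs

/-- The list consists of distinct matrices of determinant one, contains the identity and is closed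
under multiplication. -/
def isGroup (p : ℕ) (L : List Code) : Bool :=
  L.all (valid p) && memb one L &&
    L.all (fun x => L.all fun y => Nat.testBit (mask p L) (idx p (mul p x y))) &&
    decide (L.map (idx p)).Nodup

/-- A table of the number of the conjugacy class under `L` of each matrix, the classes being those
of the members of `rs`. -/
def classTable (p : ℕ) (L rs : List Code) : ℕ :=
  rs.zipIdx.foldl (fun t r =>
    t ||| L.foldl (fun s k => s ||| r.2 <<< (6 * idx p (conj p k r.1))) 0) 0

/-- The entry for `x` of a table with `6` bits per matrix. -/
def lookup (p t : ℕ) (x : Code) : ℕ := (t >>> (6 * idx p x)) &&& 63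

/-- `-x` modulo `p`. -/
def neg (p : ℕ) (x : Code) : Code := mul p ⟨p - 1, 0, 0, p - 1⟩ x

/-- The class sums of `x` and `y` under conjugation by `L` commute. -/
def commuteTest (p t : ℕ) (L : List Code) (x y : Code) : Bool :=
  Nat.beq (((L.map fun k => conj p k y).map fun u => 256 ^ lookup p t (mul p x u)).sum)
    (((L.map fun k => conj p k y).map fun u => 256 ^ lookup p t (mul p u x)).sum)

/-- The members of the list pass a test pairwise. -/
def pairwiseTest (f : Code → Code → Bool) : List Code → Bool
  | [] => true
  | x :: l => l.all (f x) && pairwiseTest f l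

/-- The class sums under conjugation by `L` commute, where `rs ++ ss` represents the classes and
`rs` represents them up to sign. -/
def gelfandTest (p : ℕ) (L rs ss : List Code) : Bool :=
  Nat.blt L.length 256 && (rs ++ ss).all (valid p) &&
    ((enum p).all fun z =>
      Nat.testBit (((rs ++ ss).map fun r => mask p (L.map fun k => conj p k r)).getD
        (lookup p (classTable p L (rs ++ ss)) z) 0) (idx p z) &&
      (Nat.blt (lookup p (classTable p L (rs ++ ss)) z) rs.length ||
        Nat.blt (lookup p (classTable p L (rs ++ ss)) (neg p z)) rs.length)) &&
    pairwiseTest (commuteTest p (classTable p L (rs ++ ss)) L) rs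

end Code

namespace Matrix.SpecialLinearGroup

open Code

variable {p : ℕ} [hp : Fact p.Prime]

/-- The list need only contain the elements of H and need not be a group, so that one test disposes
of all subgroups within it. -/
theorem not_isStrongGelfandPair_of_noProduct {H : Subgroup SL(2, ZMod p)} {L : List Code}
    (hL : ∀ A ∈ H, enc A ∈ L) {x y : Code} (h : noProduct p L x y = true) :
    ¬ IsStrongGelfandPair H := by
  simp only [noProduct, Bool.and_eq_true, List.all_eq_true, List.mem_map, forall_exists_index,
    and_imp, forall_apply_eq_imp_iff₂, Bool.not_eq_true', ← Bool.not_eq_true, eqb_iff] at h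
  obtain ⟨⟨hx, hy⟩, h⟩ := h
  intro hH
  obtain ⟨A, hA, B, hB, hAB⟩ := hH.exists_conj_mul_conj_eq (dec p x) (dec p y)
  apply h _ (hL A hA) _ (hL B hB)
  rw [← enc_dec hx, ← enc_dec hy, ← enc_conj, ← enc_conj, ← enc_mul, ← enc_mul, hAB]

/-- Words in elements of H stay in H, where the power with exponent `ns.prod` is trivial. The word
found by the test therefore has to lie in `ts`. -/
theorem exists_mem_of_wordTest {H : Subgroup SL(2, ZMod p)} {X Y : SL(2, ZMod p)} (hX : X ∈ H)
    (hY : Y ∈ H) {ns : List ℕ} (hH : ∀ A ∈ H, A ^ ns.prod = 1) {ws : List (List Bool)}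
    {ts : List Code} (h : wordTest p ns ws ts (enc X) (enc Y) = true) :
    ∃ A ∈ H, enc A ∈ ts := by
  simp only [wordTest, List.any_map, List.any_eq_true, Function.comp_apply, Bool.or_eq_true,
    memb_iff, Bool.not_eq_true', ← Bool.not_eq_true, eqb_iff, ← enc_evalWord, ← enc_pow_prod,
    ← enc_one (p := p), enc_inj] at h
  obtain ⟨w, -, hw⟩ := h
  have hmem := evalWord_mem hX hY w
  exact ⟨_, hmem, hw.resolve_right fun h => h (hH _ hmem)⟩

/-- The test is applied to the conjugates of X by elements of H: they lie in H and satisfy the same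
power relation as X. If H avoids `ts`, all of them fall into `xs`, so H lies in the set of matrices
conjugating X into `xs`. -/
theorem conj_mem_or_exists_mem_of_pairTest {H : Subgroup SL(2, ZMod p)} {X : SL(2, ZMod p)}
    (hX : X ∈ H) {l : ℕ} (hl : X ^ l = 1) {xs : List Code} {ns : List ℕ}
    (hH : ∀ A ∈ H, A ^ ns.prod = 1) {ws : List (List Bool)} {ts : List Code}
    (h : pairTest p l xs ns ws ts (enc X) = true) :
    (∀ A ∈ H, enc A ∈ conjInto p xs (enc X)) ∨ ∃ A ∈ H, enc A ∈ ts := by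
  by_cases hex : ∃ A ∈ H, enc A ∈ ts
  · exact Or.inr hex
  refine Or.inl fun A hA => ?_
  have hmem : A * X * A⁻¹ ∈ H := mul_mem (mul_mem hA hX) (inv_mem hA)
  have h1 := forall_of_all_enum h (A * X * A⁻¹)
  simp only [Bool.or_eq_true, Bool.not_eq_true', ← Bool.not_eq_true, eqb_iff, ← enc_pow,
    ← enc_one (p := p), conj_pow, hl, mul_one, mul_inv_cancel, not_true_eq_false,
    false_or, memb_iff] at h1
  refine List.mem_filter.2 ⟨enc_mem_enum A, ?_⟩
  rw [memb_iff, ← enc_conj]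
  exact h1.resolve_right fun h2 => hex (exists_mem_of_wordTest hX hmem hH h2)

theorem enc_mul_mem {L : List Code} (h : isGroup p L = true) {A B : SL(2, ZMod p)}
    (hA : enc A ∈ L) (hB : enc B ∈ L) : enc (A * B) ∈ L := by
  simp only [isGroup, Bool.and_eq_true, List.all_eq_true, testBit_mask] at h
  obtain ⟨c, hc, hcA⟩ := h.1.2 _ hA _ hB
  have hv := h.1.1.1 c hc
  rw [← enc_dec hv, ← enc_mul] at hcA
  have := idx_enc_injective hcA
  rwa [← this, enc_dec hv]

theorem enc_one_mem {L : List Code} (h : isGroup p L = true) : enc (1 : SL(2, ZMod p)) ∈ L := by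
  simp only [isGroup, Bool.and_eq_true, memb_iff] at h
  simpa [enc_one] using h.1.1.2

/-- The subgroup whose elements have codes in a given list. -/
def ofCodes (p : ℕ) [hp : Fact p.Prime] (L : List Code) (h : isGroup p L = true) :
    Subgroup SL(2, ZMod p) where
  carrier := {A | enc A ∈ L}
  one_mem' := enc_one_mem h
  mul_mem' := enc_mul_mem h
  inv_mem' := by
    intro A hA
    have hpow : ∀ n : ℕ, enc (A ^ n) ∈ L := fun n => by
      induction n with
      | zero => exact enc_one_mem h
      | succ n ih => rw [pow_succ]; exact enc_mul_mem h ih hA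
    have : A⁻¹ = A ^ (orderOf A - 1) := by
      rw [inv_eq_iff_mul_eq_one, ← pow_succ', Nat.sub_add_cancel (orderOf_pos A),
        pow_orderOf_eq_one]
    change enc A⁻¹ ∈ L
    rw [this]
    exact hpow _

section ofCodes

variable {L : List Code} (h : isGroup p L = true)

theorem mem_ofCodes {A : SL(2, ZMod p)} : A ∈ ofCodes p L h ↔ enc A ∈ L := Iff.rfl

include h

omit hp in
theorem valid_of_isGroup {x : Code} (hx : x ∈ L) : valid p x = true := by
  simp only [isGroup, Bool.and_eq_true, List.all_eq_true] at h
  exact h.1.1.1 x hx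

omit hp in
theorem nodup_of_isGroup : L.Nodup := by
  simp only [isGroup, Bool.and_eq_true, decide_eq_true_eq] at h
  exact List.Nodup.of_map _ h.2

theorem nodup_map_dec : (L.map (dec p)).Nodup := by
  refine List.Nodup.of_map enc ?_
  rw [List.map_map, List.map_congr_left (g := id), List.map_id]
  · exact nodup_of_isGroup h
  · exact fun x hx => enc_dec (valid_of_isGroup h hx)

theorem mem_map_dec {A : SL(2, ZMod p)} : A ∈ L.map (dec p) ↔ A ∈ ofCodes p L h := by
  rw [mem_ofCodes, List.mem_map]
  constructor
  · rintro ⟨x, hx, rfl⟩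
    rwa [enc_dec (valid_of_isGroup h hx)]
  · exact fun hA => ⟨_, hA, dec_enc A⟩

theorem card_ofCodes : Nat.card (ofCodes p L h) = L.length := by
  classical
  rw [← List.length_map (dec p), ← List.toFinset_card_of_nodup (nodup_map_dec h)]
  exact Nat.subtype_card _ fun A => by rw [List.mem_toFinset, mem_map_dec h]

theorem ofCodes_le {H : Subgroup SL(2, ZMod p)} {X Y : SL(2, ZMod p)} (hX : X ∈ H) (hY : Y ∈ H)
    {ws : List (List Bool)} (hL : L = ws.map (word p (enc X) (enc Y))) : ofCodes p L h ≤ H := by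
  intro A hA
  rw [mem_ofCodes, hL, List.mem_map] at hA
  obtain ⟨w, -, hw⟩ := hA
  rw [← enc_evalWord, enc_inj] at hw
  exact hw ▸ evalWord_mem hX hY w

theorem isStrongGelfandPair_ofCodes {rs ss : List Code} (ht : gelfandTest p L rs ss = true) :
    IsStrongGelfandPair (ofCodes p L h) := by
  simp only [gelfandTest, Bool.and_eq_true, Bool.or_eq_true, Nat.blt_eq, List.all_eq_true] at ht
  obtain ⟨⟨⟨hlen, hv⟩, hcov⟩, hpair⟩ := ht
  -- How the table was built is irrelevant: the coverage test certifies that the entry of every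
  -- matrix names a representative of its class.
  generalize classTable p L (rs ++ ss) = t at hcov hpair
  have hcls : ∀ Z : SL(2, ZMod p), ∃ r, (rs ++ ss)[lookup p t (enc Z)]? = some r ∧
      ∃ k ∈ ofCodes p L h, Z = k * dec p r * k⁻¹ := by
    intro Z
    have h1 := (hcov _ (enc_mem_enum Z)).1
    rw [List.getD_eq_getElem?_getD, List.getElem?_map] at h1
    rcases hr : (rs ++ ss)[lookup p t (enc Z)]? with _ | r
    · simp [hr] at h1
    · rw [hr, Option.map_some, Option.getD_some, testBit_mask] at h1
      obtain ⟨x, hx, hxZ⟩ := h1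
      obtain ⟨k, hk, rfl⟩ := List.mem_map.1 hx
      have hk' := enc_dec (valid_of_isGroup h hk)
      refine ⟨r, rfl, dec p k, by rwa [mem_ofCodes, hk'], ?_⟩
      rw [← hk', ← enc_dec (hv r (List.mem_of_getElem? hr)), ← enc_conj] at hxZ
      exact (idx_enc_injective hxZ).symm
  have hneg : ∀ Z : SL(2, ZMod p), Code.neg p (enc Z) = enc (-1 * Z) := by
    intro Z
    have h0 := hp.out.pos
    rw [Code.neg, enc_mul]
    congr 1
    simp [enc, ZMod.neg_val, ZMod.val_one'' hp.out.ne_one]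
  have hc : (-1 : SL(2, ZMod p)) ∈ Subgroup.center SL(2, ZMod p) :=
    Subgroup.mem_center_iff.2 fun g => by simp
  refine isStrongGelfandPair_of_perm _ (L.map (dec p)) (nodup_map_dec h) (fun A => mem_map_dec h)
    (fun Z => lookup p t (enc Z)) ?_ {A | enc A ∈ rs} ?_ ?_
  · intro z z' hz
    obtain ⟨r, hr, k, hk, hzk⟩ := hcls z
    obtain ⟨r', hr', k', hk', hzk'⟩ := hcls z'
    rw [← hz, hr, Option.some_inj] at hr'
    subst hr'
    refine ⟨k' * k⁻¹, mul_mem hk' (inv_mem hk), ?_⟩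
    rw [hzk, hzk']
    group
  · have hR : ∀ Z : SL(2, ZMod p), lookup p t (enc Z) < rs.length →
        ∃ r ∈ {A : SL(2, ZMod p) | enc A ∈ rs}, ∃ k ∈ ofCodes p L h, Z = k * r * k⁻¹ := by
      intro Z hZ
      obtain ⟨r, hr, k, hk, hzk⟩ := hcls Z
      refine ⟨dec p r, ?_, k, hk, hzk⟩
      rw [List.getElem?_append_left hZ] at hr
      have := List.mem_of_getElem? hr
      rwa [Set.mem_ofPred_eq, enc_dec (hv r (List.mem_append_left _ this))]
    intro Z
    rcases (hcov _ (enc_mem_enum Z)).2 with hZ | hZ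
    · obtain ⟨r, hr, k, hk, hzk⟩ := hR Z hZ
      exact ⟨r, hr, k, hk, 1, one_mem _, by rw [hzk, one_mul]⟩
    · rw [hneg] at hZ
      obtain ⟨r, hr, k, hk, hzk⟩ := hR _ hZ
      refine ⟨r, hr, k, hk, -1, hc, ?_⟩
      rw [← hzk, ← mul_assoc]
      simp
  · have key : ∀ l : List Code, pairwiseTest (commuteTest p t L) l = true → ∀ x ∈ l, ∀ y ∈ l,
        x = y ∨ commuteTest p t L x y = true ∨ commuteTest p t L y x = true := by
      intro l
      induction l with
      | nil => simp
      | cons a l ih =>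
        intro hl
        simp only [pairwiseTest, Bool.and_eq_true, List.all_eq_true] at hl
        intro x hx y hy
        rcases List.mem_cons.1 hx with hx | hx <;> rcases List.mem_cons.1 hy with hy | hy
        · exact Or.inl (hx.trans hy.symm)
        · exact Or.inr (Or.inl (hx ▸ hl.1 y hy))
        · exact Or.inr (Or.inr (hy ▸ hl.1 x hx))
        · exact ih hl.2 x hx y hy
    have perm : ∀ X Y : SL(2, ZMod p), commuteTest p t L (enc X) (enc Y) = true →
        ((L.map (dec p)).map fun k => lookup p t (enc (X * (k * Y * k⁻¹)))).Perm
          ((L.map (dec p)).map fun k => lookup p t (enc (k * Y * k⁻¹ * X))) := by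
      intro X Y hXY
      refine List.perm_of_sum_pow_eq (by simpa using hlen) (by simpa using hlen) ?_
      rw [commuteTest, Nat.beq_eq] at hXY
      simp only [List.map_map] at hXY ⊢
      convert hXY using 2 <;> refine List.map_congr_left fun k hk => ?_ <;>
      simp only [Function.comp_apply, enc_mul, Code.conj, enc_inv, enc_dec (valid_of_isGroup h hk)]
    intro X hX Y hY
    rcases key rs hpair _ hX _ hY with he | he | he
    exacts [Or.inl (enc_injective he), Or.inr (Or.inl (perm X Y he)), Or.inr (Or.inr (perm Y X he))]

end ofCodes

end Matrix.SpecialLinearGroup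

/-! ### Sylow subgroups and conjugacy of subgroups -/

section Sylow

variable {G : Type*} [Group G] [Finite G] {l : ℕ} [hl : Fact l.Prime]

/-- If `X` generates a Sylow subgroup of prime order `l`, then every subgroup of order divisible by
`l` has a conjugate containing `X`. -/
theorem exists_subgroupConj_mem {X : G} (hX : orderOf X = l)
    (hG : (Nat.card G).factorization l = 1) (H : Subgroup G) (hH : l ∣ Nat.card H) :
    ∃ K, SubgroupConj H K ∧ X ∈ K := by
  obtain ⟨⟨y, hyH⟩, hy⟩ := exists_prime_orderOf_dvd_card' l hH
  rw [Subgroup.orderOf_mk] at hy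
  let P : Sylow l G := Sylow.ofCard (Subgroup.zpowers X) (by rw [Nat.card_zpowers, hX, hG, pow_one])
  let Q : Sylow l G := Sylow.ofCard (Subgroup.zpowers y) (by rw [Nat.card_zpowers, hy, hG, pow_one])
  obtain ⟨g, hg⟩ := MulAction.exists_smul_eq G Q P
  refine ⟨H.map (MulAut.conj g).toMonoidHom, SubgroupConj.symm ⟨g, rfl⟩, ?_⟩
  have h1 : X ∈ (P : Subgroup G) := Subgroup.mem_zpowers X
  rw [← hg, Sylow.smul_def, Sylow.pointwise_smul_def, Subgroup.pointwise_smul_def] at h1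
  have h2 : (Q : Subgroup G) ≤ H := (Subgroup.zpowers_le (g := y) (H := H)).2 hyH
  exact Subgroup.map_mono h2 h1

theorem exists_subgroupConj_le {Q : Subgroup G}
    (hQ : Nat.card Q = l ^ (Nat.card G).factorization l) (H : Subgroup G) (hH : IsPGroup l H) :
    ∃ K, SubgroupConj H K ∧ K ≤ Q := by
  obtain ⟨P, hP⟩ := hH.exists_le_sylow
  obtain ⟨g, hg⟩ := MulAction.exists_smul_eq G P (Sylow.ofCard Q hQ)
  refine ⟨H.map (MulAut.conj g).toMonoidHom, SubgroupConj.symm ⟨g, rfl⟩, ?_⟩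
  have h1 : ((Sylow.ofCard Q hQ : Sylow l G) : Subgroup G) = Q := rfl
  rw [← h1, ← hg, Sylow.smul_def, Sylow.pointwise_smul_def, Subgroup.pointwise_smul_def]
  exact Subgroup.map_mono hP

omit [Finite G] in
theorem SubgroupConj.card_eq {H K : Subgroup G} (h : SubgroupConj H K) :
    Nat.card H = Nat.card K := by
  obtain ⟨g, rfl⟩ := h
  exact Nat.card_congr (Subgroup.equivMapOfInjective K _ (MulAut.conj g).injective).toEquiv.symm

end Sylow

theorem SubgroupConj.nonempty_mulEquiv {G : Type*} [Group G] {H K : Subgroup G}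
    (h : SubgroupConj H K) : Nonempty (H ≃* K) := by
  obtain ⟨g, rfl⟩ := h
  exact ⟨(Subgroup.equivMapOfInjective K _ (MulAut.conj g).injective).symm⟩

theorem SubgroupConj.hasIsoType_iff {G Q : Type*} [Group G] [Group Q] {H K : Subgroup G}
    (h : SubgroupConj H K) : HasIsoType Q H ↔ HasIsoType Q K := by
  obtain ⟨e⟩ := h.nonempty_mulEquiv
  exact ⟨fun ⟨f⟩ => ⟨e.symm.trans f⟩, fun ⟨f⟩ => ⟨e.trans f⟩⟩

theorem SubgroupConj.eq_top_iff {G : Type*} [Group G] {H K : Subgroup G}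
    (h : SubgroupConj H K) : H = ⊤ ↔ K = ⊤ := by
  have key : ∀ {H K : Subgroup G}, SubgroupConj H K → K = ⊤ → H = ⊤ := by
    rintro H K ⟨g, rfl⟩ rfl
    exact Subgroup.map_top_of_surjective _ (MulAut.conj g).surjective
  exact ⟨key h.symm, key h⟩

/-! ### The order of SL(2, p) and subgroups of order divisible by p -/

namespace Matrix.SpecialLinearGroup

variable {p : ℕ} [hp : Fact p.Prime]

theorem card_SL2 : Nat.card SL(2, ZMod p) = p * (p ^ 2 - 1) := by
  have h1 : Nat.card SL(2, ZMod p) =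
      Nat.card (MonoidHom.ker (GeneralLinearGroup.det : GL (Fin 2) (ZMod p) →* (ZMod p)ˣ)) := by
    have h := Nat.card_range_of_injective
      (f := (toGL : SL(2, ZMod p) → GL (Fin 2) (ZMod p))) toGL_injective
    rw [range_toGL] at h
    rw [← h]
    rfl
  have h2 : Nat.card (MonoidHom.ker (GeneralLinearGroup.det : GL (Fin 2) (ZMod p) →* (ZMod p)ˣ)) *
      (p - 1) = (p ^ 2 - 1) * (p ^ 2 - p) := by
    have := Matrix.card_GL_field (𝔽 := ZMod p) 2
    rw [Fin.prod_univ_two, ZMod.card] at this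
    simp only [Fin.val_zero, pow_zero, Fin.val_one, pow_one] at this
    rw [← this, ← Subgroup.card_mul_index (MonoidHom.ker
      (GeneralLinearGroup.det : GL (Fin 2) (ZMod p) →* (ZMod p)ˣ)), Subgroup.index_ker,
      MonoidHom.range_eq_top.2, Subgroup.card_top, Nat.card_eq_fintype_card (α := (ZMod p)ˣ),
      ZMod.card_units]
    intro u
    refine ⟨GeneralLinearGroup.mkOfDetNeZero !![(u : ZMod p), 0; 0, 1] ?_, ?_⟩
    · rw [Matrix.det_fin_two_of]
      simp
    · apply Units.ext
      change Matrix.det !![(u : ZMod p), 0; 0, 1] = u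
      rw [Matrix.det_fin_two_of]
      ring
  have hp1 := hp.out.one_lt
  rw [h1]
  refine Nat.eq_of_mul_eq_mul_right (show 0 < p - 1 by omega) ?_
  rw [h2, show p ^ 2 - p = p * (p - 1) by rw [Nat.mul_sub, mul_one, sq]]
  ring

/-- The upper unitriangular matrix with entry `x`. -/
def upper (x : ZMod p) : SL(2, ZMod p) := ⟨!![1, x; 0, 1], by simp⟩

/-- The lower unitriangular matrix with entry `x`. -/
def lower (x : ZMod p) : SL(2, ZMod p) := ⟨!![1, 0; x, 1], by simp⟩

theorem coe_upper (x : ZMod p) : (upper x : Matrix (Fin 2) (Fin 2) (ZMod p)) = !![1, x; 0, 1] := rfl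

theorem coe_lower (x : ZMod p) : (lower x : Matrix (Fin 2) (Fin 2) (ZMod p)) = !![1, 0; x, 1] := rfl

theorem upper_pow (n : ℕ) : (upper 1 : SL(2, ZMod p)) ^ n = upper n := by
  induction n with
  | zero => ext i j; fin_cases i <;> fin_cases j <;> simp [coe_upper]
  | succ n ih =>
    rw [pow_succ, ih]
    ext i j
    fin_cases i <;> fin_cases j <;> simp [coe_upper, Matrix.mul_apply, add_comm]

theorem upper_mem {H : Subgroup SL(2, ZMod p)} (hH : upper 1 ∈ H) (x : ZMod p) : upper x ∈ H := by
  have := pow_mem hH x.val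
  rwa [upper_pow, ZMod.natCast_zmod_val] at this

theorem orderOf_upper : orderOf (upper 1 : SL(2, ZMod p)) = p := by
  refine orderOf_eq_prime ?_ fun h => ?_
  · rw [upper_pow, CharP.cast_eq_zero]
    ext i j; fin_cases i <;> fin_cases j <;> simp [coe_upper]
  · have := congrArg (fun A : SL(2, ZMod p) => A 0 1) h
    simp [coe_upper] at this

/-- Multiplying h on both sides by unitriangular matrices clears its diagonal. The resulting
antidiagonal matrix w conjugates upper into lower unitriangular matrices. Every g with nonzero lower
left entry is a product upper · lower · upper, and any other g acquires such an entry after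
multiplication by `lower 1`. -/
theorem eq_top_of_upper_mem {H : Subgroup SL(2, ZMod p)} (hH : upper 1 ∈ H)
    {h : SL(2, ZMod p)} (hh : h ∈ H) (hc : h 1 0 ≠ 0) : H = ⊤ := by
  have hdet := det_eq h
  have hl : ∀ y, lower y ∈ H := by
    intro y
    obtain ⟨w, hw⟩ : ∃ w, w = upper (-(h 0 0 / h 1 0)) * h * upper (-(h 1 1 / h 1 0)) := ⟨_, rfl⟩
    have hwH : w ∈ H := hw ▸ mul_mem (mul_mem (upper_mem hH _) hh) (upper_mem hH _)
    have hwe : lower y = w * upper (-(y / (h 1 0) ^ 2)) * w⁻¹ := by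
      rw [eq_mul_inv_iff_mul_eq]
      have hw' : (w : Matrix (Fin 2) (Fin 2) (ZMod p)) = !![0, -(1 / h 1 0); h 1 0, 0] := by
        ext i j
        fin_cases i <;> fin_cases j <;>
          simp [hw, coe_upper, Matrix.mul_apply, Matrix.vecMul, dotProduct,
            Fin.sum_univ_two] <;> (try field_simp) <;>
          first | ring1 | linear_combination hdet | linear_combination -hdet
      ext i j
      rw [coe_mul, coe_mul, hw']
      fin_cases i <;> fin_cases j <;>
        simp [coe_upper, coe_lower, Matrix.mul_apply, Fin.sum_univ_two]; try field_simp
    rw [hwe]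
    exact mul_mem (mul_mem hwH (upper_mem hH _)) (inv_mem hwH)
  have key : ∀ g : SL(2, ZMod p), g 1 0 ≠ 0 → g ∈ H := by
    intro g hg
    have hdet := det_eq g
    have : g = upper ((g 0 0 - 1) / g 1 0) * lower (g 1 0) * upper ((g 1 1 - 1) / g 1 0) := by
      ext i j
      fin_cases i <;> fin_cases j <;>
        simp [coe_upper, coe_lower, Matrix.mul_apply, Fin.sum_univ_two] <;> field_simp <;>
        first | ring1 | linear_combination hdet | linear_combination -hdet
    rw [this]
    exact mul_mem (mul_mem (upper_mem hH _) (hl _)) (upper_mem hH _)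
  refine eq_top_iff.2 fun g _ => ?_
  by_cases hg : g 1 0 = 0
  · have h1 : g * lower 1 ∈ H := by
      refine key _ ?_
      have hdet := det_eq g
      have : (g * lower 1 : SL(2, ZMod p)) 1 0 = g 1 0 + g 1 1 := by
        simp [coe_lower, Matrix.mul_apply, Fin.sum_univ_two]
      rw [this, hg, zero_add]
      intro h0
      rw [hg, h0] at hdet
      simp at hdet
    simpa using mul_mem h1 (inv_mem (hl 1))
  · exact key g hg

/-- A proper subgroup of order divisible by `p` has a conjugate between the upper unitriangular and
the upper triangular group. -/
theorem exists_subgroupConj_le_upperTriangular {H : Subgroup SL(2, ZMod p)} (hH : H ≠ ⊤)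
    (hcard : p ∣ Nat.card H) :
    ∃ K, SubgroupConj H K ∧ upper 1 ∈ K ∧ K ≤ upperTriangular p := by
  have hp1 := hp.out.one_lt
  obtain ⟨K, hK, hu⟩ := exists_subgroupConj_mem orderOf_upper (by
    rw [card_SL2, Nat.factorization_mul hp.out.ne_zero
      (Nat.sub_ne_zero_of_lt (Nat.one_lt_pow two_ne_zero hp1)), Finsupp.add_apply,
      hp.out.factorization_self, Nat.factorization_eq_zero_of_not_dvd, add_zero]
    intro h
    have h1 : p ∣ p ^ 2 - (p ^ 2 - 1) := Nat.dvd_sub (dvd_pow_self p two_ne_zero) h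
    rw [Nat.sub_sub_self (Nat.one_le_pow _ _ (by omega))] at h1
    exact hp.out.one_lt.not_ge (Nat.le_of_dvd one_pos h1)) H hcard
  refine ⟨K, hK, hu, fun A hA => ?_⟩
  by_contra hA'
  exact hH (hK.eq_top_iff.2 (eq_top_of_upper_mem hu hA hA'))

/-- Triangular matrices with equal upper left entries have equal diagonals, so they differ by a
unitriangular factor. Hence the group K is determined by the entries occurring there. -/
theorem mem_of_upper_mem {K : Subgroup SL(2, ZMod p)} (hK : upper 1 ∈ K) {A B : SL(2, ZMod p)}
    (hA : A ∈ K) (hA0 : A 1 0 = 0) (hB0 : B 1 0 = 0) (hAB : A 0 0 = B 0 0) : B ∈ K := by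
  have hdA := det_eq A
  have hdB := det_eq B
  rw [hA0, mul_zero, zero_add] at hdA
  rw [hB0, mul_zero, zero_add] at hdB
  have hne : A 0 0 ≠ 0 := left_ne_zero_of_mul_eq_one hdA
  have hd : A 1 1 = B 1 1 := by
    rw [← hAB] at hdB
    exact mul_left_cancel₀ hne (hdA.trans hdB.symm)
  have : B = upper ((B 0 1 - A 0 1) / A 1 1) * A := by
    have hne' : A 1 1 ≠ 0 := right_ne_zero_of_mul_eq_one hdA
    ext i j
    fin_cases i <;> fin_cases j <;>
      simp [coe_upper, Matrix.mul_apply, Fin.sum_univ_two, hA0, hB0, hAB, hd]; grind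
  rw [this]
  exact mul_mem (upper_mem hK _) hA

end Matrix.SpecialLinearGroup

/-! ### Lists for concrete subgroups, and the passage from tests to subgroups -/

namespace Code

/-- The word with alternating blocks of letters of the given lengths. -/
def altWord : Bool → List ℕ → List Bool
  | _, [] => []
  | b, n :: l => List.replicate n b ++ altWord (!b) l

/-- The words consisting of a power of the first letter with exponent below `l` and a word with
block lengths in the list `rs`. -/
def words (l : ℕ) (rs : List (List ℕ)) : List (List Bool) :=
  (List.range l).flatMap fun i => rs.map fun r => List.replicate i true ++ altWord true r

/-- The values of the words given by `words`. -/
def gen (p l : ℕ) (rs : List (List ℕ)) (x y : Code) : List Code := (words l rs).map (word p x y)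

/-- The powers of `x` with exponent below `l`. -/
def powers (p l : ℕ) (x : Code) : List Code := (List.range l).map fun n => npow p n x

/-- Change of sign off the diagonal. -/
def flip (p : ℕ) : Code → Code
  | ⟨a, b, c, d⟩ => ⟨a, (p - b) % p, (p - c) % p, d⟩

/-- Conjugation by `k` maps `L` into `M`. -/
def conjTest (p : ℕ) (k : Code) (L M : List Code) : Bool :=
  valid p k && L.all fun x => memb (conj p k x) M

/-- The upper triangular matrices whose diagonal entries are squares. -/
def triangularSq (p : ℕ) : List Code :=
  (enum p).filter fun x => Nat.beq x.c 0 &&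
    (List.range p).any (fun r => Nat.beq (Nat.mod (Nat.mul r r) p) x.a) &&
      (List.range p).any fun r => Nat.beq (Nat.mod (Nat.mul r r) p) x.d

/-- The upper triangular matrices. -/
def triangular (p : ℕ) : List Code := (enum p).filter fun x => Nat.beq x.c 0

/-- The upper triangular matrices with diagonal entries `1` or `-1`. -/
def triangularSign (p : ℕ) : List Code :=
  (enum p).filter fun x => Nat.beq x.c 0 && (Nat.beq x.a 1 || Nat.beq x.a (p - 1))

end Code

theorem isPGroup_of_card_dvd {G : Type*} [Group G] {H : Subgroup G} {l n : ℕ} (hl : l.Prime)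
    (h : Nat.card H ∣ l ^ n) : IsPGroup l H := by
  obtain ⟨k, -, hk⟩ := (Nat.dvd_prime_pow hl).1 h
  exact IsPGroup.of_card hk

theorem Subgroup.eq_of_le_of_card_dvd {G : Type*} [Group G] [Finite G] {H K : Subgroup G}
    (hle : K ≤ H) (h : Nat.card H ∣ Nat.card K) : H = K :=
  (Subgroup.eq_of_le_of_card_ge hle (Nat.le_of_dvd Nat.card_pos h)).symm

namespace Matrix.SpecialLinearGroup

open Code

variable {p : ℕ} [hp : Fact p.Prime]

omit hp in
theorem ext_two {A B : SL(2, ZMod p)} (h₁ : A 0 0 = B 0 0) (h₂ : A 0 1 = B 0 1)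
    (h₃ : A 1 0 = B 1 0) (h₄ : A 1 1 = B 1 1) : A = B := by
  ext i j
  fin_cases i <;> fin_cases j
  exacts [h₁, h₂, h₃, h₄]

theorem mul_apply_two (A B : SL(2, ZMod p)) (i j : Fin 2) :
    (A * B : SL(2, ZMod p)) i j = A i 0 * B 0 j + A i 1 * B 1 j := by
  rw [coe_mul, Matrix.mul_apply, Fin.sum_univ_two]

/-- Change of sign off the diagonal. -/
def flip (A : SL(2, ZMod p)) : SL(2, ZMod p) :=
  ⟨!![A 0 0, -A 0 1; -A 1 0, A 1 1], by
    rw [Matrix.det_fin_two_of, neg_mul_neg, ← Matrix.det_fin_two, A.det_coe]⟩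

theorem flip_flip (A : SL(2, ZMod p)) : flip (flip A) = A :=
  ext_two rfl (neg_neg _) (neg_neg _) rfl

theorem flip_mul (A B : SL(2, ZMod p)) : flip (A * B) = flip A * flip B := by
  have h₁ : ∀ C : SL(2, ZMod p), flip C 0 0 = C 0 0 := fun _ => rfl
  have h₂ : ∀ C : SL(2, ZMod p), flip C 0 1 = -C 0 1 := fun _ => rfl
  have h₃ : ∀ C : SL(2, ZMod p), flip C 1 0 = -C 1 0 := fun _ => rfl
  have h₄ : ∀ C : SL(2, ZMod p), flip C 1 1 = C 1 1 := fun _ => rfl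
  apply ext_two <;> simp only [mul_apply_two, h₁, h₂, h₃, h₄] <;> ring

/-- Conjugation by the diagonal matrix with entries `1` and `-1`. -/
def flipEquiv (p : ℕ) [Fact p.Prime] : SL(2, ZMod p) ≃* SL(2, ZMod p) where
  toFun := flip
  invFun := flip
  left_inv := flip_flip
  right_inv := flip_flip
  map_mul' := flip_mul

theorem enc_flipEquiv (A : SL(2, ZMod p)) : enc (flipEquiv p A) = Code.flip p (enc A) := by
  have : ∀ a : ZMod p, (-a).val = (p - a.val) % p := by
    intro a
    rw [ZMod.neg_val]
    split_ifs with h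
    · simp [h]
    · rw [Nat.mod_eq_of_lt]
      have := (ZMod.val_ne_zero a).2 h
      have := hp.out.pos
      omega
  change enc (flip A) = _
  simp only [enc, Code.flip, ← this]
  rfl

theorem card_le_of_enc_mem {H : Subgroup SL(2, ZMod p)} {L : List Code}
    (h : ∀ A ∈ H, enc A ∈ L) : Nat.card H ≤ L.length := by
  classical
  rw [Nat.card_eq_fintype_card, Fintype.card]
  refine le_trans ?_ L.toFinset_card_le
  refine Finset.card_le_card_of_injOn (fun A : H => enc (A : SL(2, ZMod p))) ?_ ?_
  · intro A _
    simpa using h A A.2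
  · exact fun A _ B _ hAB => Subtype.ext (enc_injective hAB)

theorem subgroupConj_ofCodes {L M : List Code} (hL : isGroup p L = true) (hM : isGroup p M = true)
    {k : Code} (hk : conjTest p k L M = true) (hcard : M.length = L.length) :
    SubgroupConj (ofCodes p M hM) (ofCodes p L hL) := by
  simp only [conjTest, Bool.and_eq_true, List.all_eq_true, memb_iff] at hk
  refine ⟨dec p k, Subgroup.eq_of_le_of_card_dvd ?_ ?_⟩
  · rintro _ ⟨A, hA, rfl⟩
    change enc (dec p k * A * (dec p k)⁻¹) ∈ M
    rw [enc_conj, enc_dec hk.1]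
    exact hk.2 _ hA
  · rw [card_ofCodes, hcard, ← card_ofCodes hL]
    exact (SubgroupConj.card_eq ⟨dec p k, rfl⟩).symm.dvd

/-- The flip is conjugation by a matrix of determinant -1. As -1 is not a square modulo 7 or 11, it
is an outer automorphism for these primes. It carries one exceptional subgroup to a representative
of the other class, so that only one of them needs the Gelfand test. -/
theorem map_flipEquiv_ofCodes {L M : List Code} (hL : isGroup p L = true)
    (hM : isGroup p M = true) (h : M = L.map (Code.flip p)) :
    (ofCodes p L hL).map (flipEquiv p).toMonoidHom = ofCodes p M hM := by
  ext A
  simp only [Subgroup.mem_map, mem_ofCodes, h, List.mem_map]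
  constructor
  · rintro ⟨B, hB, rfl⟩
    exact ⟨_, hB, (enc_flipEquiv B).symm⟩
  · rintro ⟨x, hx, hxA⟩
    have hv := enc_dec (valid_of_isGroup hL hx)
    refine ⟨dec p x, by rwa [hv], enc_injective ?_⟩
    exact (enc_flipEquiv _).trans (by rw [hv, hxA])

/-- The dichotomy for subgroups of order divisible by `l`, when the Sylow `l`-subgroups have prime
order and are generated by conjugates of the matrix with code `x`. -/
theorem exists_subgroupConj_of_pairTest {l : ℕ} [Fact l.Prime] {x : Code} {ns : List ℕ}
    {ws : List (List Bool)} {ts : List Code} (h : pairTest p l (powers p l x) ns ws ts x = true)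
    (hx : (valid p x && !eqb x Code.one && eqb (npow p l x) Code.one) = true)
    (hG : (Nat.card SL(2, ZMod p)).factorization l = 1) {H : Subgroup SL(2, ZMod p)}
    (hH : l ∣ Nat.card H) (hcard : Nat.card H ∣ ns.prod) :
    ∃ K, SubgroupConj H K ∧ enc (dec p x) = x ∧ dec p x ∈ K ∧
      ((∀ A ∈ K, enc A ∈ conjInto p (powers p l x) x) ∨ ∃ A ∈ K, enc A ∈ ts) := by
  simp only [Bool.and_eq_true, Bool.not_eq_true', ← Bool.not_eq_true, eqb_iff] at hx
  obtain ⟨⟨hv, hx1⟩, hxl⟩ := hx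
  have he := enc_dec hv
  have hpow : dec p x ^ l = 1 := enc_injective (by rw [enc_pow, he, hxl, enc_one])
  have hord : orderOf (dec p x) = l := orderOf_eq_prime hpow fun h1 => hx1 (by
    rw [← he, h1, enc_one])
  obtain ⟨K, hHK, hmem⟩ := exists_subgroupConj_mem hord hG H hH
  refine ⟨K, hHK, he, hmem, conj_mem_or_exists_mem_of_pairTest hmem hpow (l := l) ?_ (he.symm ▸ h)
    |>.imp_left (by rw [he]; exact id)⟩
  intro A hA
  have : (⟨A, hA⟩ : K) ^ ns.prod = 1 := by
    rw [← orderOf_dvd_iff_pow_eq_one]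
    exact (orderOf_dvd_natCard _).trans (hHK.card_eq ▸ hcard)
  simpa using congrArg (Subgroup.subtype K) this

theorem ofCodes_gen_le {K : Subgroup SL(2, ZMod p)} {x y : Code} {l : ℕ} {rs : List (List ℕ)}
    {L : List Code} (hL : isGroup p L = true) (h : L = gen p l rs x y) (hx : dec p x ∈ K)
    (hxe : enc (dec p x) = x) {A : SL(2, ZMod p)} (hA : A ∈ K) (hy : enc A = y) :
    ofCodes p L hL ≤ K :=
  ofCodes_le hL hx hA (by rw [hxe, hy]; exact h)

theorem eq_ofCodes {K : Subgroup SL(2, ZMod p)} {L : List Code} (hL : isGroup p L = true)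
    (hle : ofCodes p L hL ≤ K) {n : ℕ} (hcard : Nat.card K ∣ n) (hn : L.length = n) :
    K = ofCodes p L hL :=
  Subgroup.eq_of_le_of_card_dvd hle (by rwa [card_ofCodes, hn])

/-! ### Subgroups between the unitriangular and the triangular group -/

section Triangular

theorem mem_upperTriangular {A : SL(2, ZMod p)} : A ∈ upperTriangular p ↔ A 1 0 = 0 := Iff.rfl

theorem mem_upperTriangularSq {A : SL(2, ZMod p)} :
    A ∈ upperTriangularSq p ↔ A 1 0 = 0 ∧ IsSquare (A 0 0) ∧ IsSquare (A 1 1) := Iff.rfl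

omit hp in
theorem upperTriangularSq_le : upperTriangularSq p ≤ upperTriangular p := fun _ h => h.1

theorem mul_eq_one_of_mem_upperTriangular {A : SL(2, ZMod p)} (hA : A ∈ upperTriangular p) :
    A 0 0 * A 1 1 = 1 := by
  rw [det_eq, mem_upperTriangular.1 hA, mul_zero, zero_add]

theorem pow_apply_of_mem_upperTriangular {A : SL(2, ZMod p)} (hA : A ∈ upperTriangular p) (n : ℕ) :
    (A ^ n : SL(2, ZMod p)) 0 0 = A 0 0 ^ n := by
  induction n with
  | zero => simp
  | succ n ih =>
    rw [pow_succ, coe_mul, Matrix.mul_apply, Fin.sum_univ_two, ih, mem_upperTriangular.1 hA,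
      mul_zero, add_zero, pow_succ]

theorem isSquare_of_mem_upperTriangular {A : SL(2, ZMod p)} (hA : A ∈ upperTriangular p)
    (h : IsSquare (A 0 0)) : A ∈ upperTriangularSq p := by
  have h1 := mul_eq_one_of_mem_upperTriangular hA
  refine ⟨hA, h, ?_⟩
  rw [eq_inv_of_mul_eq_one_right h1]
  exact h.inv

theorem isSquare_zmod_iff {a : ZMod p} :
    IsSquare a ↔ ((List.range p).any fun r => Nat.beq (Nat.mod (Nat.mul r r) p) a.val) = true := by
  simp only [List.any_eq_true, List.mem_range, Nat.beq_eq]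
  constructor
  · rintro ⟨r, rfl⟩
    exact ⟨r.val, ZMod.val_lt r, by rw [ZMod.val_mul]; rfl⟩
  · rintro ⟨r, -, hr⟩
    refine ⟨(r : ZMod p), ?_⟩
    rw [← ZMod.natCast_zmod_val a, ← hr, ← Nat.cast_mul]
    exact ZMod.natCast_mod _ _

theorem mem_upperTriangularSq_iff_enc {A : SL(2, ZMod p)} :
    A ∈ upperTriangularSq p ↔ enc A ∈ triangularSq p := by
  rw [mem_upperTriangularSq, triangularSq, List.mem_filter, isSquare_zmod_iff, isSquare_zmod_iff]
  simp only [enc_mem_enum, true_and, Bool.and_eq_true, Nat.beq_eq, and_assoc]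
  simp only [enc, ZMod.val_eq_zero]

theorem mem_upperTriangular_iff_enc {A : SL(2, ZMod p)} :
    A ∈ upperTriangular p ↔ enc A ∈ triangular p := by
  rw [mem_upperTriangular, triangular, List.mem_filter]
  simp only [enc_mem_enum, true_and, Nat.beq_eq]
  simp only [enc, ZMod.val_eq_zero]

theorem upperTriangularSq_eq_ofCodes (h : isGroup p (triangularSq p) = true) :
    upperTriangularSq p = ofCodes p _ h :=
  Subgroup.ext fun _ => mem_upperTriangularSq_iff_enc

theorem upperTriangular_eq_ofCodes (h : isGroup p (triangular p) = true) :
    upperTriangular p = ofCodes p _ h :=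
  Subgroup.ext fun _ => mem_upperTriangular_iff_enc

/-- If every square is a power of `a ^ 2` for all `a` except `0`, `1` and `-1`, and the squares have
index at most two, then a subgroup between the upper unitriangular and the upper triangular group
is contained in the group of upper triangular matrices with diagonal `±1`, or consists of all upper
triangular matrices, or of those with squares on the diagonal. -/
theorem eq_of_le_upperTriangular
    (hpow : ∀ a r : ZMod p, a = 0 ∨ a = 1 ∨ a = -1 ∨ r = 0 ∨
      ∃ n : Fin 6, r * r = a ^ (2 * n : ℕ))
    (hsq : ∀ a b : ZMod p, (∃ r, r * r = a) ∨ (∃ r, r * r = b) ∨ ∃ r, r * r = b * a)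
    {K : Subgroup SL(2, ZMod p)} (hK : upper 1 ∈ K) (hle : K ≤ upperTriangular p) :
    (∀ A ∈ K, enc A ∈ triangularSign p) ∨ K = upperTriangularSq p ∨ K = upperTriangular p := by
  have hsquare : ∀ {a : ZMod p}, (∃ r, r * r = a) ↔ IsSquare a :=
    fun {a} => ⟨fun ⟨r, hr⟩ => ⟨r, hr.symm⟩, fun ⟨r, hr⟩ => ⟨r, hr.symm⟩⟩
  have hne : ∀ {A}, A ∈ upperTriangular p → A 0 0 ≠ 0 := fun hA =>
    left_ne_zero_of_mul_eq_one (mul_eq_one_of_mem_upperTriangular hA)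
  by_cases hsign : ∀ A ∈ K, A 0 0 = 1 ∨ A 0 0 = -1
  · left
    intro A hA
    have h1 : (1 : ZMod p).val = 1 := ZMod.val_one'' hp.out.ne_one
    refine List.mem_filter.2 ⟨enc_mem_enum A, ?_⟩
    simp only [Bool.and_eq_true, Bool.or_eq_true, Nat.beq_eq, enc]
    refine ⟨by rw [mem_upperTriangular.1 (hle hA), ZMod.val_zero], ?_⟩
    rcases hsign A hA with h | h
    · left; rw [h, h1]
    · right
      rw [h, ZMod.neg_val, h1, if_neg]
      exact one_ne_zero
  · right
    push Not at hsign
    obtain ⟨A, hA, hA1, hA2⟩ := hsign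
    -- For p = 5, 7, 11 the group of nonzero squares has prime order (p - 1) / 2 ≤ 5, so the square
    -- of any diagonal entry other than ±1 generates it. This is why `hpow` holds with exponents 2 *
    -- n for n < 6.
    have hsub : upperTriangularSq p ≤ K := by
      intro B hB
      obtain ⟨r, hr⟩ := hB.2.1
      have hr0 : r ≠ 0 := by
        rintro rfl
        exact hne hB.1 (by rw [hr, mul_zero])
      obtain h | h | h | h | ⟨n, hn⟩ := hpow (A 0 0) r
      exacts [(hne (hle hA) h).elim, (hA1 h).elim, (hA2 h).elim, (hr0 h).elim,
        mem_of_upper_mem hK (pow_mem hA (2 * n)) (hle (pow_mem hA _)) hB.1 (by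
          rw [pow_apply_of_mem_upperTriangular (hle hA), hr, hn])]
    by_cases hex : ∀ C ∈ K, IsSquare (C 0 0)
    · exact Or.inl (le_antisymm (fun C hC => isSquare_of_mem_upperTriangular (hle hC) (hex C hC))
        hsub)
    · right
      push Not at hex
      obtain ⟨C, hC, hCs⟩ := hex
      refine le_antisymm hle fun B hB => ?_
      rcases hsq (C 0 0) (B 0 0) with h | h | h
      · exact (hCs (hsquare.1 h)).elim
      · exact hsub (isSquare_of_mem_upperTriangular hB (hsquare.1 h))
      -- Neither diagonal entry need be a square but their product is; thus B * C lies in K, and C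
      -- can be cancelled.
      · have h1 : (B * C : SL(2, ZMod p)) 0 0 = B 0 0 * C 0 0 := by
          rw [coe_mul, Matrix.mul_apply, Fin.sum_univ_two, mem_upperTriangular.1 (hle hC),
            mul_zero, add_zero]
        have h2 : B * C ∈ K := hsub (isSquare_of_mem_upperTriangular (mul_mem hB (hle hC))
          (h1 ▸ hsquare.1 h))
        exact (Subgroup.mul_mem_cancel_right K hC).1 h2

end Triangular

end Matrix.SpecialLinearGroup

/-! ### Tests for isomorphisms and permutation actions -/

namespace Code

/-- The map taking the members of `L` to the corresponding members of `M`. -/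
def assoc (L M : List Code) (x : Code) : Code :=
  match (L.zip M).find? fun z => eqb x z.1 with
  | some z => z.2
  | none => one

/-- `assoc` is an injective homomorphism on `L`. -/
def isoTest (p q : ℕ) (L M : List Code) : Bool :=
  (L.all fun x => memb (assoc L M x) M && L.all fun y =>
    eqb (assoc L M (mul p x y)) (mul q (assoc L M x) (assoc L M y))) &&
  (L.all fun x => eqb x one || !eqb (assoc L M x) one) && Nat.beq L.length M.length

/-- The action of `x` by conjugation on the blocks in a list, represented by their first members. -/
def act (p : ℕ) (Ps : List (List Code)) (x : Code) (i : ℕ) : ℕ :=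
  Ps.findIdx fun P => memb (conj p x ((Ps.getD i []).headD one)) P

/-- `act` is a homomorphism on `L` with values in the permutations of `n` blocks and with kernel
`Z`. -/
def actTest (p n : ℕ) (Ps : List (List Code)) (L Z : List Code) : Bool :=
  (L.all fun x => (List.range n).all fun i => Nat.blt (act p Ps x i) n) &&
  (L.all fun x => L.all fun y => (List.range n).all fun i =>
    Nat.beq (act p Ps (mul p x y) i) (act p Ps x (act p Ps y i))) &&
  (List.range n).all (fun i => Nat.beq (act p Ps one i) i) &&
  (L.all fun x => memb x Z == (List.range n).all fun i => Nat.beq (act p Ps x i) i)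

end Code

theorem Nat.factorization_eq_of_eq_mul {n l k m : ℕ} (hl : l.Prime) (h : n = l ^ k * m)
    (hm : ¬ l ∣ m) : n.factorization l = k := by
  have hm0 : m ≠ 0 := fun h0 => hm (h0 ▸ dvd_zero l)
  rw [h, Nat.factorization_mul (pow_ne_zero _ hl.ne_zero) hm0, Finsupp.add_apply,
    hl.factorization_pow, Finsupp.single_eq_same, Nat.factorization_eq_zero_of_not_dvd hm, add_zero]

namespace Matrix.SpecialLinearGroup

open Code

variable {p q : ℕ} [hp : Fact p.Prime] [hq : Fact q.Prime]

theorem nonempty_mulEquiv_ofCodes {G : Type*} [Group G] {L : List Code} (hL : isGroup p L = true)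
    (f : G → Code) (hmem : ∀ g, f g ∈ L) (hmul : ∀ g h, f (g * h) = Code.mul p (f g) (f h))
    (hone : ∀ g, f g = Code.one → g = 1) (hcard : Nat.card G = L.length) :
    Nonempty (G ≃* ofCodes p L hL) := by
  have hv : ∀ g, enc (dec p (f g)) = f g := fun g => enc_dec (valid_of_isGroup hL (hmem g))
  let φ : G →* ofCodes p L hL := MonoidHom.mk' (fun g => ⟨dec p (f g), by
    rw [mem_ofCodes, hv]; exact hmem g⟩) fun g h => Subtype.ext (enc_injective (by
      change enc (dec p (f (g * h))) = enc (dec p (f g) * dec p (f h))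
      rw [enc_mul, hv, hv, hv, hmul]))
  have hφ : Function.Injective φ := by
    rw [injective_iff_map_eq_one]
    intro g hg
    have hg : dec p (f g) = 1 := congrArg Subtype.val hg
    exact hone g (by rw [← hv g, hg, enc_one])
  exact ⟨MulEquiv.ofBijective φ ((Nat.bijective_iff_injective_and_card φ).2
    ⟨hφ, by rw [hcard, card_ofCodes]⟩)⟩

theorem nonempty_mulEquiv_of_isoTest {L M : List Code} (hL : isGroup p L = true)
    (hM : isGroup q M = true) (h : isoTest p q L M = true) :
    Nonempty (ofCodes p L hL ≃* ofCodes q M hM) := by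
  simp only [isoTest, Bool.and_eq_true, List.all_eq_true, memb_iff, eqb_iff, Bool.or_eq_true,
    Bool.not_eq_true', ← Bool.not_eq_true, Nat.beq_eq] at h
  obtain ⟨⟨h1, h2⟩, h3⟩ := h
  refine nonempty_mulEquiv_ofCodes hM (fun A => assoc L M (enc (A : SL(2, ZMod p))))
    (fun A => (h1 _ A.2).1) (fun A B => ?_) (fun A hA => ?_) (by rw [card_ofCodes, h3])
  · rw [← (h1 _ A.2).2 _ B.2, ← enc_mul]
    rfl
  · refine Subtype.ext (enc_injective ?_)
    rw [(h2 _ A.2).resolve_right fun h => h hA]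
    exact enc_one.symm

theorem le_zpowers_of_enc_mem {K : Subgroup SL(2, ZMod p)} {x : Code} {l : ℕ}
    (hx : valid p x = true) (h : ∀ A ∈ K, enc A ∈ powers p l x) :
    K ≤ Subgroup.zpowers (dec p x) := by
  intro A hA
  obtain ⟨n, -, hn⟩ := List.mem_map.1 (h A hA)
  rw [← enc_dec hx, ← enc_pow, enc_inj] at hn
  exact hn ▸ Subgroup.npow_mem_zpowers _ n

theorem ofCodes_powers_le {K : Subgroup SL(2, ZMod p)} {x : Code} {l : ℕ}
    (hL : isGroup p (powers p l x) = true) {A : SL(2, ZMod p)} (hA : A ∈ K) (hx : enc A = x) :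
    ofCodes p _ hL ≤ K := by
  subst hx
  have h := le_zpowers_of_enc_mem (K := ofCodes p _ hL) (valid_enc A) fun _ h => h
  rw [dec_enc] at h
  exact h.trans ((Subgroup.zpowers_le).2 hA)

/-- The test yields a homomorphism into the monoid of self-maps of the blocks; coming from a group,
it takes values in permutations. -/
theorem exists_monoidHom_perm_of_actTest {n : ℕ} {Ps : List (List Code)} {L Z : List Code}
    (hL : isGroup p L = true) (h : actTest p n Ps L Z = true) :
    ∃ φ : ofCodes p L hL →* Equiv.Perm (Fin n), ∀ A, φ A = 1 ↔ enc (A : SL(2, ZMod p)) ∈ Z := by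
  simp only [actTest, Bool.and_eq_true, List.all_eq_true, List.mem_range, Nat.blt_eq,
    Nat.beq_eq, beq_iff_eq] at h
  obtain ⟨⟨⟨h1, h2⟩, h3⟩, h4⟩ := h
  let f : ofCodes p L hL →* Function.End (Fin n) :=
    { toFun := fun A i => ⟨act p Ps (enc (A : SL(2, ZMod p))) i, h1 _ A.2 i i.2⟩
      map_one' := by
        funext i
        refine Fin.ext ?_
        change act p Ps (enc 1) i = i
        rw [enc_one]
        exact h3 i i.2
      map_mul' := by
        rintro ⟨A, hA⟩ ⟨B, hB⟩
        funext i
        refine Fin.ext ?_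
        change act p Ps (enc (A * B)) i = act p Ps (enc A) (act p Ps (enc B) i)
        rw [enc_mul]
        exact h2 _ hA _ hB i i.2 }
  refine ⟨f.toHomPerm, fun A => ?_⟩
  rw [← memb_iff, h4 _ A.2, List.all_eq_true]
  simp only [List.mem_range, Nat.beq_eq]
  constructor
  · intro hA i hi
    exact congrArg Fin.val (DFunLike.congr_fun hA (⟨i, hi⟩ : Fin n))
  · intro hA
    refine Equiv.ext fun i => Fin.ext (hA i i.2)

theorem ofCodes_eq_top {L : List Code} (hL : isGroup p L = true)
    (hcard : L.length = p * (p ^ 2 - 1)) : ofCodes p L hL = ⊤ :=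
  Subgroup.eq_top_of_card_eq _ (by rw [card_ofCodes, hcard, card_SL2])

theorem hasIsoType_cyc_iff {G : Type*} [Group G] {l : ℕ} (hl : l.Prime) {H : Subgroup G} :
    HasIsoType (Cyc l) H ↔ Nat.card H = l := by
  have := Fact.mk hl
  have hc : Nat.card (Cyc l) = l := by simp
  exact ⟨fun ⟨e⟩ => (Nat.card_congr e.toEquiv).trans hc, fun h => ⟨mulEquivOfPrimeCardEq h hc⟩⟩

theorem card_dvd_of_not_dvd {H : Subgroup SL(2, ZMod p)} (h : ¬ p ∣ Nat.card H) :
    Nat.card H ∣ p ^ 2 - 1 := by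
  have h1 := Subgroup.card_subgroup_dvd_card H
  rw [card_SL2] at h1
  exact (((Nat.Prime.coprime_iff_not_dvd hp.out).2 h).symm).dvd_of_dvd_mul_left h1

/-- The order bound accompanies the refutation because isomorphism types are later separated by
their orders. -/
theorem not_isStrongGelfandPair_of_subgroupConj {H K : Subgroup SL(2, ZMod p)}
    (hHK : SubgroupConj H K) {L : List Code} (hL : ∀ A ∈ K, enc A ∈ L) {x y : Code}
    (h : noProduct p L x y = true) : ¬ IsStrongGelfandPair H ∧ Nat.card H ≤ L.length :=
  ⟨fun hH => not_isStrongGelfandPair_of_noProduct hL h (hHK.isStrongGelfandPair_iff.1 hH),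
    hHK.card_eq ▸ card_le_of_enc_mem hL⟩

end Matrix.SpecialLinearGroup

/-! ### The case p = 5 -/

namespace Code

/-- A subgroup of `SL(2, 5)` isomorphic to `SL(2, 3)`. -/
def tetrahedral5 : List Code :=
  gen 5 3 [[], [0, 1], [0, 1, 1], [0, 2], [0, 1, 2], [0, 2, 1], [0, 1, 2, 1], [0, 2, 2]]
    ⟨0, 4, 1, 4⟩ ⟨0, 2, 2, 4⟩

/-- A second subgroup of `SL(2, 5)` isomorphic to `SL(2, 3)`. -/
def tetrahedral5' : List Code :=
  gen 5 3 [[], [0, 1], [0, 1, 1], [0, 2], [0, 1, 2], [0, 2, 1], [0, 1, 2, 1], [0, 2, 2]]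
    ⟨0, 4, 1, 4⟩ ⟨0, 3, 3, 4⟩

/-- A subgroup of order eight of `SL(2, 5)`. -/
def quaternion5 : List Code := gen 5 4 [[], [0, 1]] ⟨0, 1, 4, 0⟩ ⟨0, 2, 2, 0⟩

/-- The members of `SL(2, 3)`, in an order that corresponds to that of `tetrahedral5`. -/
def tetrahedral3 : List Code :=
  gen 3 3 [[], [0, 1], [0, 1, 1], [0, 2], [0, 1, 2], [0, 2, 1], [0, 1, 2, 1], [0, 2, 2]]
    ⟨0, 1, 2, 2⟩ ⟨1, 1, 0, 1⟩

end Code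

namespace Matrix.SpecialLinearGroup

open Code

local instance : Fact (Nat.Prime 5) := ⟨by norm_num⟩

theorem isGroup_tetrahedral5 : isGroup 5 tetrahedral5 = true := by decide +kernel

theorem isGroup_tetrahedral5' : isGroup 5 tetrahedral5' = true := by decide +kernel

theorem isGroup_quaternion5 : isGroup 5 quaternion5 = true := by decide +kernel

theorem isGroup_triangular5 : isGroup 5 (triangular 5) = true := by decide +kernel

theorem isGroup_tetrahedral3 : isGroup 3 tetrahedral3 = true := by decide +kernel

theorem isoTest_tetrahedral : isoTest 3 5 tetrahedral3 tetrahedral5 = true := by decide +kernel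

/-- A subgroup of order prime to 5 has order dividing 24. If 3 divides the order, it normalizes a
group of order three or contains one of two copies of SL(2, 3), which are conjugate. Otherwise it
lies, up to conjugation, in a Sylow 2-subgroup of order eight. -/
theorem subgroupConj_or_not_isStrongGelfandPair_five {H : Subgroup SL(2, ZMod 5)} (hH : H ≠ ⊤) :
    SubgroupConj H (ofCodes 5 _ isGroup_tetrahedral5) ∨ SubgroupConj H (upperTriangular 5) ∨
      (¬ IsStrongGelfandPair H ∧ Nat.card H < 20) := by
  by_cases h5 : 5 ∣ Nat.card H
  · obtain ⟨K, hHK, hu, hle⟩ := exists_subgroupConj_le_upperTriangular hH h5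
    have hsign : (∀ A ∈ K, enc A ∈ triangularSign 5) → ¬ IsStrongGelfandPair H ∧ Nat.card H < 20 :=
      fun h => (not_isStrongGelfandPair_of_subgroupConj hHK h (x := ⟨0, 1, 4, 0⟩)
        (y := ⟨0, 2, 2, 0⟩) (by decide +kernel)).imp id fun h => h.trans_lt (by decide +kernel)
    rcases eq_of_le_upperTriangular (by decide +kernel) (by decide +kernel) hu hle
      with h | rfl | rfl
    · exact Or.inr (Or.inr (hsign h))
    -- The nonzero squares modulo 5 are 1 and -1, so this group is covered by the refutation for
    -- diagonal ±1.
    · refine Or.inr (Or.inr (hsign fun A hA => ?_))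
      exact (by decide +kernel : triangularSq 5 ⊆ triangularSign 5)
        (mem_upperTriangularSq_iff_enc.1 hA)
    · exact Or.inr (Or.inl hHK)
  · have hdvd : Nat.card H ∣ 24 := card_dvd_of_not_dvd h5
    by_cases h3 : 3 ∣ Nat.card H
    · obtain ⟨K, hHK, he, hx, h | ⟨A, hA, hAt⟩⟩ := exists_subgroupConj_of_pairTest (p := 5) (l := 3)
        (x := ⟨0, 4, 1, 4⟩) (ns := [2, 2, 2, 3])
        (ws := [[0, 1, 1, 1, 1], [0, 1, 1, 2], [0, 1], [0, 2], [0, 2, 1, 1]].map (altWord true))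
        (ts := [⟨0, 2, 2, 4⟩, ⟨0, 3, 3, 4⟩]) (by decide +kernel) (by decide +kernel)
        (Nat.factorization_eq_of_eq_mul (k := 1) (m := 40) Nat.prime_three
          (by rw [card_SL2]; norm_num) (by norm_num)) h3 hdvd
      · refine Or.inr (Or.inr ?_)
        exact (not_isStrongGelfandPair_of_subgroupConj hHK h (x := ⟨0, 1, 4, 0⟩)
          (y := ⟨0, 2, 2, 1⟩) (by decide +kernel)).imp id fun h => h.trans_lt (by decide +kernel)
      · left
        rw [hHK.card_eq] at hdvd
        simp only [List.mem_cons, List.not_mem_nil, or_false] at hAt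
        rcases hAt with hAt | hAt
        · rwa [eq_ofCodes isGroup_tetrahedral5
            (ofCodes_gen_le _ rfl hx he hA hAt) hdvd (by decide +kernel)] at hHK
        · rw [eq_ofCodes isGroup_tetrahedral5'
            (ofCodes_gen_le _ rfl hx he hA hAt) hdvd (by decide +kernel)] at hHK
          exact hHK.trans (subgroupConj_ofCodes isGroup_tetrahedral5 isGroup_tetrahedral5'
            (k := ⟨0, 1, 4, 4⟩) (by decide +kernel) (by decide +kernel))
    · have h8 : Nat.card H ∣ 2 ^ 3 :=
        ((Nat.Prime.coprime_iff_not_dvd Nat.prime_three).2 h3).symm.dvd_of_dvd_mul_left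
          (show _ ∣ 3 * 8 from hdvd)
      obtain ⟨K, hHK, hle⟩ := exists_subgroupConj_le (l := 2)
        (Q := ofCodes 5 _ isGroup_quaternion5) (by
          rw [Nat.factorization_eq_of_eq_mul (k := 3) (m := 15) Nat.prime_two
            (by rw [card_SL2]; norm_num) (by norm_num), card_ofCodes]
          decide +kernel) H (isPGroup_of_card_dvd Nat.prime_two h8)
      exact Or.inr (Or.inr ((not_isStrongGelfandPair_of_subgroupConj hHK hle (x := ⟨0, 1, 4, 1⟩)
        (y := ⟨0, 1, 4, 2⟩) (by decide +kernel)).imp id fun h => h.trans_lt (by decide +kernel)))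

theorem isStrongGelfandPair_tetrahedral5 :
    IsStrongGelfandPair (ofCodes 5 _ isGroup_tetrahedral5) :=
  isStrongGelfandPair_ofCodes _
    (rs := [⟨0, 1, 4, 0⟩, ⟨0, 1, 4, 1⟩, ⟨0, 1, 4, 2⟩, ⟨0, 1, 4, 4⟩, ⟨0, 2, 2, 2⟩, ⟨1, 0, 0, 1⟩,
      ⟨1, 1, 3, 4⟩, ⟨1, 2, 2, 0⟩])
    (ss := [⟨0, 4, 1, 0⟩, ⟨0, 4, 1, 4⟩, ⟨0, 4, 1, 3⟩, ⟨0, 4, 1, 1⟩, ⟨0, 3, 3, 3⟩, ⟨4, 0, 0, 4⟩,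
      ⟨4, 3, 3, 0⟩]) (by decide +kernel)

theorem isStrongGelfandPair_upperTriangular_five : IsStrongGelfandPair (upperTriangular 5) := by
  rw [upperTriangular_eq_ofCodes isGroup_triangular5]
  exact isStrongGelfandPair_ofCodes _
    (rs := [⟨0, 1, 4, 0⟩, ⟨0, 1, 4, 1⟩, ⟨0, 1, 4, 2⟩, ⟨0, 2, 2, 0⟩, ⟨0, 2, 2, 1⟩, ⟨0, 2, 2, 2⟩,
      ⟨1, 0, 0, 1⟩, ⟨1, 1, 0, 1⟩, ⟨1, 2, 0, 1⟩, ⟨2, 0, 0, 3⟩])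
    (ss := [⟨0, 4, 1, 4⟩, ⟨0, 4, 1, 3⟩, ⟨0, 3, 3, 4⟩, ⟨0, 3, 3, 3⟩, ⟨4, 0, 0, 4⟩, ⟨4, 4, 0, 4⟩,
      ⟨4, 3, 0, 4⟩, ⟨3, 0, 0, 2⟩]) (by decide +kernel)


theorem hasIsoType_tetrahedral5 : HasIsoType SL(2, ZMod 3) (ofCodes 5 _ isGroup_tetrahedral5) := by
  obtain ⟨e⟩ := nonempty_mulEquiv_of_isoTest isGroup_tetrahedral3 isGroup_tetrahedral5
    isoTest_tetrahedral
  rw [ofCodes_eq_top isGroup_tetrahedral3 (by decide +kernel)] at e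
  exact ⟨e.symm.trans Subgroup.topEquiv⟩

/-- Order 24 decides: the triangular group has order 20, and the refuted subgroups have smaller
order. -/
theorem hasIsoType_SL2_iff {H : Subgroup SL(2, ZMod 5)} :
    HasIsoType SL(2, ZMod 3) H ↔ SubgroupConj H (ofCodes 5 _ isGroup_tetrahedral5) := by
  refine ⟨fun ⟨e⟩ => ?_, fun h => h.hasIsoType_iff.2 hasIsoType_tetrahedral5⟩
  have hcard : Nat.card H = 24 := (Nat.card_congr e.toEquiv).trans card_SL2
  have htop : H ≠ ⊤ := by
    rintro rfl
    rw [Subgroup.card_top, card_SL2] at hcard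
    norm_num at hcard
  rcases subgroupConj_or_not_isStrongGelfandPair_five htop with h | h | h
  · exact h
  · rw [h.card_eq, upperTriangular_eq_ofCodes isGroup_triangular5, card_ofCodes] at hcard
    exact absurd hcard (by decide +kernel)
  · omega

theorem isCoatom_of_card_eq {H : Subgroup SL(2, ZMod 5)} (h : Nat.card H = 24) : IsCoatom H := by
  have hG : Nat.card SL(2, ZMod 5) = 120 := card_SL2
  refine ⟨fun htop => ?_, fun K hK => ?_⟩
  · rw [htop, Subgroup.card_top, hG] at h
    norm_num at h
  · obtain ⟨k, hk⟩ := Subgroup.card_dvd_of_le hK.le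
    have h1 := Subgroup.card_subgroup_dvd_card K
    rw [hG, hk, h, show 120 = 24 * 5 from rfl, Nat.mul_dvd_mul_iff_left (by norm_num)] at h1
    rcases (Nat.dvd_prime Nat.prime_five).1 h1 with rfl | rfl
    · exact absurd (Subgroup.eq_of_le_of_card_ge hK.le (by omega)) hK.ne
    · exact Subgroup.eq_top_of_card_eq _ (by rw [hG, hk, h])

theorem isStrongGelfandPair_iff_five {H : Subgroup SL(2, ZMod 5)} (hH : H ≠ ⊤) :
    IsStrongGelfandPair H ↔ HasIsoType SL(2, ZMod 3) H ∨ SubgroupConj H (upperTriangular 5) := by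
  rw [hasIsoType_SL2_iff]
  constructor
  · intro h
    rcases subgroupConj_or_not_isStrongGelfandPair_five hH with h1 | h1 | h1
    exacts [Or.inl h1, Or.inr h1, absurd h h1.1]
  · rintro (h | h)
    · exact h.isStrongGelfandPair_iff.2 isStrongGelfandPair_tetrahedral5
    · exact h.isStrongGelfandPair_iff.2 isStrongGelfandPair_upperTriangular_five

end Matrix.SpecialLinearGroup

/-! ### The case p = 3 -/

namespace Code

/-- The quaternion subgroup of `SL(2, 3)`. -/
def quaternion3 : List Code := gen 3 4 [[], [0, 1]] ⟨0, 1, 2, 0⟩ ⟨1, 1, 1, 2⟩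

/-- The isomorphism of the abstract quaternion group with the quaternion subgroup of `SL(2, 3)`. -/
def ofQuaternionGroup : QuaternionGroup 2 → Code
  | .a i => npow 3 i.val ⟨0, 1, 2, 0⟩
  | .xa i => mul 3 ⟨1, 1, 1, 2⟩ (npow 3 i.val ⟨0, 1, 2, 0⟩)

/-- The matrix `x` or its inverse is `y`. -/
def isOneOf (p : ℕ) (x y : Code) : Bool := eqb x y || eqb (inv p x) y

end Code

namespace Matrix.SpecialLinearGroup

open Code

theorem isGroup_upper3 : isGroup 3 (powers 3 3 ⟨1, 1, 0, 1⟩) = true := by decide +kernel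

theorem isGroup_triangular3 : isGroup 3 (triangular 3) = true := by decide +kernel

theorem isGroup_quaternion3 : isGroup 3 quaternion3 = true := by decide +kernel

theorem card_upperTriangular_three : Nat.card (upperTriangular 3) = 6 := by
  rw [upperTriangular_eq_ofCodes isGroup_triangular3, card_ofCodes]
  decide +kernel

/-- Any two of the quaternions i, j, k generate the whole group. A smaller subgroup therefore
contains at most one of them up to sign and lies in a cyclic group of order four; each of the three
cyclic groups is refuted. -/
theorem eq_or_not_isStrongGelfandPair_of_le_quaternion3 {H K : Subgroup SL(2, ZMod 3)}
    (hHK : SubgroupConj H K) (hle : K ≤ ofCodes 3 _ isGroup_quaternion3) :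
    K = ofCodes 3 _ isGroup_quaternion3 ∨ (¬ IsStrongGelfandPair H ∧ Nat.card H < 5) := by
  by_cases hcard : 8 ≤ Nat.card K
  · left
    exact Subgroup.eq_of_le_of_card_ge hle (by
      rw [card_ofCodes]; exact le_trans (by decide +kernel) hcard)
  right
  have hgen : ∀ x y : Code, (∃ h : isGroup 3 (gen 3 4 [[], [0, 1]] x y) = true,
      (gen 3 4 [[], [0, 1]] x y).length = 8) → ∀ A ∈ K, ∀ B ∈ K, enc A = x → enc B = y → False := by
    rintro x y ⟨h, hlen⟩ A hA B hB rfl rfl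
    refine hcard ?_
    rw [← hlen, ← card_ofCodes h]
    refine Subgroup.card_le_of_le (ofCodes_gen_le h rfl (x := enc A) ?_ ?_ hB rfl)
    · rwa [dec_enc]
    · rw [dec_enc]
  have hmem : ∀ x, (∀ A ∈ K, enc A ≠ x) → ∀ A ∈ K, isOneOf 3 (enc A) x = false := by
    intro x hx A hA
    rw [← Bool.not_eq_true]
    simp only [isOneOf, Bool.or_eq_true, eqb_iff, ← enc_inv, not_or]
    exact ⟨hx A hA, hx _ (inv_mem hA)⟩
  have key : ∀ x y z u v : Code, (quaternion3.all fun w => isOneOf 3 w x || isOneOf 3 w y ||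
      memb w (powers 3 4 z)) = true → noProduct 3 (powers 3 4 z) u v = true →
      (powers 3 4 z).length = 4 → (∀ A ∈ K, enc A ≠ x) → (∀ A ∈ K, enc A ≠ y) →
      ¬ IsStrongGelfandPair H ∧ Nat.card H < 5 := by
    intro x y z u v h1 h2 h3 hx hy
    refine (not_isStrongGelfandPair_of_subgroupConj hHK (L := powers 3 4 z) ?_ h2).imp id
      fun h => by omega
    intro A hA
    have := List.all_eq_true.1 h1 _ (hle hA)
    rw [hmem x hx A hA, hmem y hy A hA] at this
    simpa [memb_iff] using this
  by_cases hi : ∀ A ∈ K, enc A ≠ ⟨0, 1, 2, 0⟩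
  · by_cases hj : ∀ A ∈ K, enc A ≠ ⟨1, 1, 1, 2⟩
    · exact key _ _ ⟨1, 2, 2, 2⟩ ⟨0, 1, 2, 0⟩ ⟨0, 1, 2, 1⟩ (by decide +kernel) (by decide +kernel)
        (by decide +kernel) hi hj
    · refine key _ ⟨1, 2, 2, 2⟩ ⟨1, 1, 1, 2⟩ ⟨0, 1, 2, 0⟩ ⟨0, 1, 2, 1⟩ (by decide +kernel)
        (by decide +kernel) (by decide +kernel) hi fun B hB hBk => ?_
      push Not at hj
      obtain ⟨A, hA, hAj⟩ := hj
      exact hgen _ _ (by decide +kernel) A hA B hB hAj hBk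
  · push Not at hi
    obtain ⟨A, hA, hAi⟩ := hi
    refine key ⟨1, 1, 1, 2⟩ ⟨1, 2, 2, 2⟩ ⟨0, 1, 2, 0⟩ ⟨0, 1, 2, 1⟩ ⟨0, 1, 2, 2⟩ (by decide +kernel)
        (by decide +kernel) (by decide +kernel) (fun B hB hBj => ?_) fun B hB hBk => ?_
    · exact hgen _ _ (by decide +kernel) A hA B hB hAi hBj
    · exact hgen _ _ (by decide +kernel) A hA B hB hAi hBk

/-- The triangular group has order 6, leaving only orders 3 and 6 when 3 divides |H|; all other
subgroups lie in a Sylow 2-subgroup. Divisibility of 8 is recorded with the bound in order to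
exclude order 3 later. -/
theorem subgroupConj_or_not_isStrongGelfandPair_three {H : Subgroup SL(2, ZMod 3)} (hH : H ≠ ⊤) :
    SubgroupConj H (ofCodes 3 _ isGroup_upper3) ∨ SubgroupConj H (upperTriangular 3) ∨
      SubgroupConj H (ofCodes 3 _ isGroup_quaternion3) ∨
        (¬ IsStrongGelfandPair H ∧ Nat.card H ∣ 8 ∧ Nat.card H < 5) := by
  by_cases h3 : 3 ∣ Nat.card H
  · obtain ⟨K, hHK, hu, hle⟩ := exists_subgroupConj_le_upperTriangular hH h3
    rw [hHK.card_eq] at h3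
    obtain ⟨k, hk⟩ := h3
    have hdvd := Subgroup.card_dvd_of_le hle
    rw [card_upperTriangular_three, hk, show 6 = 3 * 2 from rfl,
      Nat.mul_dvd_mul_iff_left (by norm_num)] at hdvd
    rcases (Nat.dvd_prime Nat.prime_two).1 hdvd with rfl | rfl
    · left
      rwa [eq_ofCodes isGroup_upper3 (ofCodes_powers_le _ hu (by decide +kernel)) hk.dvd
        (by decide +kernel)] at hHK
    · right; left
      rwa [Subgroup.eq_of_le_of_card_ge hle (by rw [card_upperTriangular_three, hk])] at hHK
  · right; right
    have hdvd : Nat.card H ∣ 2 ^ 3 := card_dvd_of_not_dvd h3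
    obtain ⟨K, hHK, hle⟩ := exists_subgroupConj_le (l := 2)
      (Q := ofCodes 3 _ isGroup_quaternion3) (by
        rw [Nat.factorization_eq_of_eq_mul (k := 3) (m := 3) Nat.prime_two
          (by rw [card_SL2]; norm_num) (by norm_num), card_ofCodes]
        decide +kernel) H (isPGroup_of_card_dvd Nat.prime_two hdvd)
    rcases eq_or_not_isStrongGelfandPair_of_le_quaternion3 hHK hle with rfl | h
    exacts [Or.inl hHK, Or.inr ⟨h.1, hdvd, h.2⟩]

theorem isStrongGelfandPair_upper3 : IsStrongGelfandPair (ofCodes 3 _ isGroup_upper3) :=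
  isStrongGelfandPair_ofCodes _
    (rs := [⟨0, 1, 2, 0⟩, ⟨0, 1, 2, 1⟩, ⟨0, 1, 2, 2⟩, ⟨1, 0, 0, 1⟩, ⟨1, 1, 0, 1⟩, ⟨1, 2, 0, 1⟩])
    (ss := [⟨0, 2, 1, 0⟩, ⟨0, 2, 1, 2⟩, ⟨0, 2, 1, 1⟩, ⟨2, 0, 0, 2⟩, ⟨2, 2, 0, 2⟩, ⟨2, 1, 0, 2⟩])
    (by decide +kernel)

theorem isStrongGelfandPair_quaternion3 : IsStrongGelfandPair (ofCodes 3 _ isGroup_quaternion3) :=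
  isStrongGelfandPair_ofCodes _
    (rs := [⟨0, 1, 2, 0⟩, ⟨0, 1, 2, 1⟩, ⟨0, 1, 2, 2⟩, ⟨1, 0, 0, 1⟩, ⟨1, 1, 1, 2⟩, ⟨1, 2, 2, 2⟩])
    (ss := [⟨0, 2, 1, 2⟩, ⟨0, 2, 1, 1⟩, ⟨2, 0, 0, 2⟩]) (by decide +kernel)

theorem isStrongGelfandPair_upperTriangular_three : IsStrongGelfandPair (upperTriangular 3) := by
  refine isStrongGelfandPair_upper3.mono ?_
  rw [upperTriangular_eq_ofCodes isGroup_triangular3]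
  exact fun A hA => (by decide +kernel : powers 3 3 ⟨1, 1, 0, 1⟩ ⊆ triangular 3) hA

theorem ne_top_of_card_lt {p : ℕ} [Fact p.Prime] {H : Subgroup SL(2, ZMod p)}
    (h : Nat.card H < p * (p ^ 2 - 1)) : H ≠ ⊤ := by
  rintro rfl
  rw [Subgroup.card_top, card_SL2] at h
  exact h.false

theorem hasIsoType_cyc_three_iff {H : Subgroup SL(2, ZMod 3)} :
    HasIsoType (Cyc 3) H ↔ SubgroupConj H (ofCodes 3 _ isGroup_upper3) := by
  have hU : Nat.card (ofCodes 3 _ isGroup_upper3) = 3 := by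
    rw [card_ofCodes]
    decide +kernel
  rw [hasIsoType_cyc_iff Nat.prime_three]
  refine ⟨fun hcard => ?_, fun h => h.card_eq.trans hU⟩
  rcases subgroupConj_or_not_isStrongGelfandPair_three
    (ne_top_of_card_lt (H := H) (by omega)) with h | h | h | h
  · exact h
  · rw [h.card_eq, card_upperTriangular_three] at hcard
    omega
  · rw [h.card_eq, card_ofCodes] at hcard
    exact absurd hcard (by decide +kernel)
  · rw [hcard] at h
    omega

theorem hasIsoType_upperTriangular_three : HasIsoType (Cyc 6) (upperTriangular 3) := by
  have h : upperTriangular 3 ≤ Subgroup.zpowers (dec 3 ⟨2, 1, 0, 2⟩) := by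
    refine le_zpowers_of_enc_mem (l := 6) (by decide +kernel) fun A hA => ?_
    exact (by decide +kernel : triangular 3 ⊆ powers 3 6 ⟨2, 1, 0, 2⟩)
      (mem_upperTriangular_iff_enc.1 hA)
  have := Subgroup.isCyclic_of_le h
  exact ⟨mulEquivOfCyclicCardEq (by rw [card_upperTriangular_three]; simp)⟩

theorem hasIsoType_cyc_six_iff {H : Subgroup SL(2, ZMod 3)} :
    HasIsoType (Cyc 6) H ↔ SubgroupConj H (upperTriangular 3) := by
  refine ⟨fun ⟨e⟩ => ?_, fun h => h.hasIsoType_iff.2 hasIsoType_upperTriangular_three⟩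
  have hcard : Nat.card H = 6 := (Nat.card_congr e.toEquiv).trans (by simp)
  rcases subgroupConj_or_not_isStrongGelfandPair_three
    (ne_top_of_card_lt (H := H) (by omega)) with h | h | h | h
  · rw [h.card_eq, card_ofCodes] at hcard
    exact absurd hcard (by decide +kernel)
  · exact h
  · rw [h.card_eq, card_ofCodes] at hcard
    exact absurd hcard (by decide +kernel)
  · omega

theorem hasIsoType_quaternion3 :
    HasIsoType (QuaternionGroup 2) (ofCodes 3 _ isGroup_quaternion3) := by
  obtain ⟨e⟩ := nonempty_mulEquiv_ofCodes isGroup_quaternion3 ofQuaternionGroup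
    (by decide +kernel) (by decide +kernel) (by decide +kernel)
    (by rw [Nat.card_eq_fintype_card, QuaternionGroup.card]; decide +kernel)
  exact ⟨e.symm⟩

theorem hasIsoType_quaternionGroup_iff {H : Subgroup SL(2, ZMod 3)} :
    HasIsoType (QuaternionGroup 2) H ↔ SubgroupConj H (ofCodes 3 _ isGroup_quaternion3) := by
  refine ⟨fun ⟨e⟩ => ?_, fun h => h.hasIsoType_iff.2 hasIsoType_quaternion3⟩
  have hcard : Nat.card H = 8 := (Nat.card_congr e.toEquiv).trans
    (by rw [Nat.card_eq_fintype_card, QuaternionGroup.card])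
  rcases subgroupConj_or_not_isStrongGelfandPair_three
    (ne_top_of_card_lt (H := H) (by omega)) with h | h | h | h
  · rw [h.card_eq, card_ofCodes] at hcard
    exact absurd hcard (by decide +kernel)
  · rw [h.card_eq, card_upperTriangular_three] at hcard
    omega
  · exact h
  · omega

theorem isStrongGelfandPair_iff_three {H : Subgroup SL(2, ZMod 3)} (hH : H ≠ ⊤) :
    IsStrongGelfandPair H ↔
      HasIsoType (Cyc 3) H ∨ HasIsoType (Cyc 6) H ∨ HasIsoType (QuaternionGroup 2) H := by
  rw [hasIsoType_cyc_three_iff, hasIsoType_cyc_six_iff, hasIsoType_quaternionGroup_iff]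
  constructor
  · intro h
    rcases subgroupConj_or_not_isStrongGelfandPair_three hH with h1 | h1 | h1 | h1
    exacts [Or.inl h1, Or.inr (Or.inl h1), Or.inr (Or.inr h1), absurd h h1.1]
  · rintro (h | h | h)
    · exact h.isStrongGelfandPair_iff.2 isStrongGelfandPair_upper3
    · exact h.isStrongGelfandPair_iff.2 isStrongGelfandPair_upperTriangular_three
    · exact h.isStrongGelfandPair_iff.2 isStrongGelfandPair_quaternion3


/-! ### The case p = 2 -/

theorem isGroup_upper2 : isGroup 2 (powers 2 2 ⟨1, 1, 0, 1⟩) = true := by decide +kernel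

theorem isGroup_three2 : isGroup 2 (powers 2 3 ⟨0, 1, 1, 1⟩) = true := by decide +kernel

theorem isGroup_enum2 : isGroup 2 (enum 2) = true := by decide +kernel

theorem subgroupConj_or_not_isStrongGelfandPair_two {H : Subgroup SL(2, ZMod 2)} (hH : H ≠ ⊤) :
    SubgroupConj H (ofCodes 2 _ isGroup_upper2) ∨ SubgroupConj H (ofCodes 2 _ isGroup_three2) ∨
      (¬ IsStrongGelfandPair H ∧ Nat.card H = 1) := by
  by_cases h2 : 2 ∣ Nat.card H
  · obtain ⟨K, hHK, hu, hle⟩ := exists_subgroupConj_le_upperTriangular hH h2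
    have hK := ofCodes_powers_le isGroup_upper2 hu (by decide +kernel)
    left
    rwa [le_antisymm (fun A hA => ?_) hK] at hHK
    exact (by decide +kernel : triangular 2 ⊆ powers 2 2 ⟨1, 1, 0, 1⟩)
      (mem_upperTriangular_iff_enc.1 (hle hA))
  · right
    have hdvd : Nat.card H ∣ 3 := card_dvd_of_not_dvd h2
    obtain ⟨K, hHK, hle⟩ := exists_subgroupConj_le (l := 3)
      (Q := ofCodes 2 _ isGroup_three2) (by
        rw [Nat.factorization_eq_of_eq_mul (k := 1) (m := 2) Nat.prime_three
          (by rw [card_SL2]; norm_num) (by norm_num), card_ofCodes]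
        decide +kernel) H (isPGroup_of_card_dvd (n := 1) Nat.prime_three hdvd)
    rcases (Nat.dvd_prime Nat.prime_three).1 hdvd with h | h
    · right
      -- For the trivial subgroup the criterion demands that x and y commute.
      refine ⟨(not_isStrongGelfandPair_of_subgroupConj hHK (L := [Code.one]) (x := ⟨0, 1, 1, 0⟩)
        (y := ⟨0, 1, 1, 1⟩) (fun A hA => ?_) (by decide +kernel)).1, h⟩
      rw [hHK.card_eq] at h
      rw [Subgroup.eq_bot_of_card_eq _ h, Subgroup.mem_bot] at hA
      rw [hA, enc_one]
      exact List.mem_singleton_self _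
    · left
      rwa [Subgroup.eq_of_le_of_card_ge hle (by
        rw [← hHK.card_eq, h, card_ofCodes]; decide +kernel)] at hHK

theorem hasIsoType_cyc_two_iff {H : Subgroup SL(2, ZMod 2)} :
    HasIsoType (Cyc 2) H ↔ SubgroupConj H (ofCodes 2 _ isGroup_upper2) := by
  rw [hasIsoType_cyc_iff Nat.prime_two]
  refine ⟨fun hcard => ?_, fun h => h.card_eq.trans (by rw [card_ofCodes]; decide +kernel)⟩
  rcases subgroupConj_or_not_isStrongGelfandPair_two
    (ne_top_of_card_lt (H := H) (by omega)) with h | h | h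
  · exact h
  · rw [h.card_eq, card_ofCodes] at hcard
    exact absurd hcard (by decide +kernel)
  · omega

theorem hasIsoType_cyc_three_iff_of_two {H : Subgroup SL(2, ZMod 2)} :
    HasIsoType (Cyc 3) H ↔ SubgroupConj H (ofCodes 2 _ isGroup_three2) := by
  rw [hasIsoType_cyc_iff Nat.prime_three]
  refine ⟨fun hcard => ?_, fun h => h.card_eq.trans (by rw [card_ofCodes]; decide +kernel)⟩
  rcases subgroupConj_or_not_isStrongGelfandPair_two
    (ne_top_of_card_lt (H := H) (by omega)) with h | h | h
  · rw [h.card_eq, card_ofCodes] at hcard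
    exact absurd hcard (by decide +kernel)
  · exact h
  · omega

theorem isStrongGelfandPair_iff_two {H : Subgroup SL(2, ZMod 2)} (hH : H ≠ ⊤) :
    IsStrongGelfandPair H ↔ HasIsoType (Cyc 2) H ∨ HasIsoType (Cyc 3) H := by
  rw [hasIsoType_cyc_two_iff, hasIsoType_cyc_three_iff_of_two]
  constructor
  · intro h
    rcases subgroupConj_or_not_isStrongGelfandPair_two hH with h1 | h1 | h1
    exacts [Or.inl h1, Or.inr h1, absurd h h1.1]
  · rintro (h | h)
    · exact h.isStrongGelfandPair_iff.2 (isStrongGelfandPair_ofCodes _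
        (rs := [⟨0, 1, 1, 0⟩, ⟨0, 1, 1, 1⟩, ⟨1, 0, 0, 1⟩, ⟨1, 1, 0, 1⟩]) (ss := [])
        (by decide +kernel))
    · exact h.isStrongGelfandPair_iff.2 (isStrongGelfandPair_ofCodes _
        (rs := [⟨0, 1, 1, 0⟩, ⟨0, 1, 1, 1⟩, ⟨1, 0, 0, 1⟩, ⟨1, 1, 1, 0⟩]) (ss := [])
        (by decide +kernel))

/-- Conjugation permutes the three involutions faithfully, and both groups have order six. -/
theorem nonempty_mulEquiv_perm_three : Nonempty (SL(2, ZMod 2) ≃* Equiv.Perm (Fin 3)) := by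
  obtain ⟨φ, hφ⟩ := exists_monoidHom_perm_of_actTest (n := 3) (Z := [Code.one])
    (Ps := [[⟨0, 1, 1, 0⟩], [⟨1, 1, 0, 1⟩], [⟨1, 0, 1, 1⟩]]) isGroup_enum2 (by decide +kernel)
  have hinj : Function.Injective φ := by
    rw [injective_iff_map_eq_one]
    intro A hA
    rw [hφ, List.mem_singleton, ← enc_one (p := 2), enc_inj] at hA
    exact Subtype.ext hA
  have htop := ofCodes_eq_top isGroup_enum2 (by decide +kernel)
  have e := MulEquiv.ofBijective φ ((Nat.bijective_iff_injective_and_card φ).2 ⟨hinj, by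
    rw [card_ofCodes, Nat.card_eq_fintype_card, Fintype.card_perm]; decide +kernel⟩)
  rw [htop] at e
  exact ⟨Subgroup.topEquiv.symm.trans e⟩

end Matrix.SpecialLinearGroup

/-! ### The case p = 7 -/

namespace Code

/-- No conjugation maps both `x` and `y` into `L`. -/
def notConjTest (p : ℕ) (L : List Code) (x y : Code) : Bool :=
  (enum p).all fun k => !(memb (conj p k x) L && memb (conj p k y) L)

/-- A subgroup of `SL(2, 7)` isomorphic to `SL(2, 3)`. -/
def tetrahedral7 : List Code :=
  gen 7 3 [[], [0, 1], [0, 1, 1], [0, 2], [0, 1, 2], [0, 2, 1], [0, 1, 2, 1], [0, 2, 2]]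
    ⟨2, 0, 0, 4⟩ ⟨1, 1, 4, 5⟩

/-- A second subgroup of `SL(2, 7)` isomorphic to `SL(2, 3)`. -/
def tetrahedral7' : List Code :=
  gen 7 3 [[], [0, 1], [0, 1, 1], [0, 2], [0, 1, 2], [0, 2, 1], [0, 1, 2, 1], [0, 2, 2]]
    ⟨2, 0, 0, 4⟩ ⟨1, 6, 3, 5⟩

/-- The normalizer of `tetrahedral7`, a preimage of the symmetric group on four letters. -/
def octahedral7 : List Code := conjInto 7 tetrahedral7 ⟨2, 0, 0, 4⟩

/-- The normalizer of `tetrahedral7'`. -/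
def octahedral7' : List Code := octahedral7.map (Code.flip 7)

/-- A subgroup of order sixteen of `SL(2, 7)`. -/
def quaternion7 : List Code := gen 7 8 [[], [0, 1]] ⟨0, 1, 6, 3⟩ ⟨1, 5, 1, 6⟩

end Code

namespace Matrix.SpecialLinearGroup

open Code

section General

variable {p : ℕ} [hp : Fact p.Prime]

theorem not_subgroupConj_ofCodes {L M : List Code} (hL : isGroup p L = true)
    (hM : isGroup p M = true) {x y : Code} (hx : x ∈ M) (hy : y ∈ M)
    (h : notConjTest p L x y = true) : ¬ SubgroupConj (ofCodes p L hL) (ofCodes p M hM) := by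
  rintro ⟨g, hg⟩
  have key : ∀ x ∈ M, conj p (enc g) x ∈ L := by
    intro x hx
    have hv := enc_dec (valid_of_isGroup hM hx)
    have : g * dec p x * g⁻¹ ∈ ofCodes p L hL := by
      rw [hg]
      exact ⟨dec p x, by rwa [SetLike.mem_coe, mem_ofCodes, hv], rfl⟩
    rwa [mem_ofCodes, enc_conj, hv] at this
  have := forall_of_all_enum h g
  rw [memb_iff.2 (key x hx), memb_iff.2 (key y hy)] at this
  exact Bool.false_ne_true this

theorem mem_center_iff_enc {A : SL(2, ZMod p)} :
    A ∈ Subgroup.center SL(2, ZMod p) ↔ enc A ∈ [Code.one, ⟨p - 1, 0, 0, p - 1⟩] := by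
  have h1 : (-1 : SL(2, ZMod p)) ∈ Subgroup.center SL(2, ZMod p) :=
    Subgroup.mem_center_iff.2 fun g => by simp
  have hneg : enc (-1 : SL(2, ZMod p)) = ⟨p - 1, 0, 0, p - 1⟩ := by
    simp [enc, ZMod.neg_val, ZMod.val_one'' hp.out.ne_one]
  have key : A ∈ Subgroup.center SL(2, ZMod p) ↔ A = 1 ∨ A = -1 := by
    constructor
    · intro hA
      obtain ⟨r, hr, hrA⟩ := mem_center_iff.1 hA
      rw [Fintype.card_fin] at hr
      rcases sq_eq_sq_iff_eq_or_eq_neg.1 (hr.trans (one_pow 2).symm) with rfl | rfl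
      · left
        exact Subtype.ext (hrA.symm.trans (by simp))
      · right
        refine Subtype.ext (hrA.symm.trans ?_)
        ext i j
        fin_cases i <;> fin_cases j <;> simp
    · rintro (rfl | rfl)
      exacts [one_mem _, h1]
  rw [key, List.mem_cons, List.mem_singleton, ← hneg, ← enc_one (p := p), enc_inj, enc_inj]

theorem center_eq_ofCodes (h : isGroup p [Code.one, ⟨p - 1, 0, 0, p - 1⟩] = true) :
    Subgroup.center SL(2, ZMod p) = ofCodes p _ h := Subgroup.ext fun _ => mem_center_iff_enc

omit hp in
theorem isPreimageOfS4_of_subgroupConj {H K : Subgroup SL(2, ZMod p)} (h : SubgroupConj H K)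
    (hK : IsPreimageOfS4 p K) : IsPreimageOfS4 p H := by
  obtain ⟨g, rfl⟩ := h
  obtain ⟨S, ⟨e⟩, rfl⟩ := hK
  let π := QuotientGroup.mk' (Subgroup.center SL(2, ZMod p))
  refine ⟨S.map (MulAut.conj (π g)).toMonoidHom,
    ⟨(Subgroup.equivMapOfInjective S _ (MulAut.conj (π g)).injective).symm.trans e⟩, ?_⟩
  ext A
  rw [Subgroup.mem_map_equiv, Subgroup.mem_comap, Subgroup.mem_comap, Subgroup.mem_map_equiv,
    MulAut.conj_symm_apply, MulAut.conj_symm_apply, map_mul, map_mul, map_inv]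

theorem card_of_isPreimageOfS4 {H : Subgroup SL(2, ZMod p)} (h : IsPreimageOfS4 p H) :
    Nat.card H = 24 * Nat.card (Subgroup.center SL(2, ZMod p)) := by
  obtain ⟨S, ⟨e⟩, rfl⟩ := h
  have hS : Nat.card S = 24 := by
    rw [Nat.card_congr e.toEquiv, Nat.card_eq_fintype_card, Fintype.card_perm]
    rfl
  have h1 := Subgroup.card_mul_index
    (S.comap (QuotientGroup.mk' (Subgroup.center SL(2, ZMod p))))
  rw [Subgroup.index_comap_of_surjective _ (QuotientGroup.mk'_surjective _),
    Subgroup.card_eq_card_quotient_mul_card_subgroup (Subgroup.center SL(2, ZMod p)),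
    ← Subgroup.card_mul_index S, hS, mul_right_comm] at h1
  exact Nat.eq_of_mul_eq_mul_right (Nat.pos_of_ne_zero S.index_ne_zero_of_finite) h1

/-- On the given group, the projection to PSL(2, p) and the action on the four blocks have the same
kernel ±1. The order 48 makes the action surjective, so the image in PSL(2, p) is isomorphic to the
full symmetric group. -/
theorem isPreimageOfS4_of_actTest {L : List Code} (hL : isGroup p L = true) {Ps : List (List Code)}
    (h : actTest p 4 Ps L [Code.one, ⟨p - 1, 0, 0, p - 1⟩] = true)
    (hZ : isGroup p [Code.one, ⟨p - 1, 0, 0, p - 1⟩] = true)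
    (hZL : [Code.one, ⟨p - 1, 0, 0, p - 1⟩] ⊆ L) (hcard : L.length = 48) :
    IsPreimageOfS4 p (ofCodes p L hL) := by
  obtain ⟨φ, hφ⟩ := exists_monoidHom_perm_of_actTest hL h
  have hle : Subgroup.center SL(2, ZMod p) ≤ ofCodes p L hL := fun A hA =>
    hZL (mem_center_iff_enc.1 hA)
  let f : ofCodes p L hL →* Matrix.ProjectiveSpecialLinearGroup (Fin 2) (ZMod p) :=
    (QuotientGroup.mk' (Subgroup.center SL(2, ZMod p))).comp (ofCodes p L hL).subtype
  have hrange : f.range =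
      (ofCodes p L hL).map (QuotientGroup.mk' (Subgroup.center SL(2, ZMod p))) := by
    rw [MonoidHom.range_comp, Subgroup.range_subtype]
  have hker : f.ker = φ.ker := by
    ext A
    rw [MonoidHom.mem_ker, MonoidHom.mem_ker, hφ, ← mem_center_iff_enc]
    exact QuotientGroup.eq_one_iff _
  have hkercard : Nat.card φ.ker = 2 := by
    have : φ.ker = (Subgroup.center SL(2, ZMod p)).subgroupOf (ofCodes p L hL) := by
      ext A
      rw [MonoidHom.mem_ker, hφ, ← mem_center_iff_enc, Subgroup.mem_subgroupOf]
    rw [this, Nat.card_congr (Subgroup.subgroupOfEquivOfLe hle).toEquiv, center_eq_ofCodes hZ,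
      card_ofCodes]
    rfl
  have htop : φ.range = ⊤ := by
    refine Subgroup.eq_top_of_card_eq _ ?_
    have := Subgroup.card_mul_index φ.ker
    rw [Subgroup.index_ker, hkercard, card_ofCodes, hcard] at this
    rw [Nat.card_eq_fintype_card (α := Equiv.Perm (Fin 4)), Fintype.card_perm, Fintype.card_fin,
      show Nat.factorial 4 = 24 from rfl]
    omega
  refine ⟨f.range, ⟨(QuotientGroup.quotientKerEquivRange f).symm.trans
    ((QuotientGroup.quotientMulEquivOfEq hker).trans
      ((QuotientGroup.quotientKerEquivRange φ).trans
        ((MulEquiv.subgroupCongr htop).trans Subgroup.topEquiv)))⟩, ?_⟩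
  rw [hrange, Subgroup.comap_map_eq_self]
  rwa [QuotientGroup.ker_mk']

end General

local instance : Fact (Nat.Prime 7) := ⟨by norm_num⟩

theorem isGroup_tetrahedral7 : isGroup 7 tetrahedral7 = true := by decide +kernel

theorem isGroup_tetrahedral7' : isGroup 7 tetrahedral7' = true := by decide +kernel

theorem isGroup_octahedral7 : isGroup 7 octahedral7 = true := by decide +kernel

theorem isGroup_octahedral7' : isGroup 7 octahedral7' = true := by decide +kernel

theorem isGroup_quaternion7 : isGroup 7 quaternion7 = true := by decide +kernel

theorem isGroup_triangularSq7 : isGroup 7 (triangularSq 7) = true := by decide +kernel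

theorem isGroup_triangular7 : isGroup 7 (triangular 7) = true := by decide +kernel

theorem isGroup_center7 : isGroup 7 [Code.one, ⟨7 - 1, 0, 0, 7 - 1⟩] = true := by decide +kernel

/-- K has order 24 or 48. In the first case it is the group of L, which is refuted. In the second
that group has index two and is normal, so all of K conjugates the chosen element of order three
into L, which confines K to M. -/
theorem eq_or_not_isStrongGelfandPair_of_tetrahedral_le {L M : List Code} (hL : isGroup 7 L = true)
    (hM : isGroup 7 M = true) (hlen : L.length = 24) (hlenM : M.length = 48)
    (hx : (⟨2, 0, 0, 4⟩ : Code) ∈ L) (hsub : conjInto 7 L ⟨2, 0, 0, 4⟩ ⊆ M)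
    (hw : noProduct 7 L ⟨0, 1, 6, 0⟩ ⟨0, 1, 6, 1⟩ = true) {H K : Subgroup SL(2, ZMod 7)}
    (hHK : SubgroupConj H K) (hK : ofCodes 7 L hL ≤ K) (hcard : Nat.card K ∣ 48) :
    K = ofCodes 7 M hM ∨ (¬ IsStrongGelfandPair H ∧ Nat.card H < 48) := by
  obtain ⟨k, hk⟩ := Subgroup.card_dvd_of_le hK
  rw [card_ofCodes, hlen] at hk
  rw [hk, show 48 = 24 * 2 from rfl, Nat.mul_dvd_mul_iff_left (by norm_num)] at hcard
  rcases (Nat.dvd_prime Nat.prime_two).1 hcard with rfl | rfl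
  · right
    refine (not_isStrongGelfandPair_of_subgroupConj hHK (L := L) ?_ hw).imp id fun h => by omega
    rw [← Subgroup.eq_of_le_of_card_ge hK (by rw [card_ofCodes, hlen, hk])]
    exact fun _ h => h
  · left
    have hidx : ((ofCodes 7 L hL).subgroupOf K).index = 2 := by
      have := Subgroup.card_mul_index ((ofCodes 7 L hL).subgroupOf K)
      rw [Nat.card_congr (Subgroup.subgroupOfEquivOfLe hK).toEquiv, card_ofCodes, hlen, hk] at this
      omega
    have hn := Subgroup.normal_of_index_eq_two hidx
    have hv := enc_dec (valid_of_isGroup hL hx)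
    have hX : dec 7 ⟨2, 0, 0, 4⟩ ∈ ofCodes 7 L hL := by rwa [mem_ofCodes, hv]
    refine Subgroup.eq_of_le_of_card_ge (fun A hA => ?_) (by rw [card_ofCodes, hlenM, hk])
    have h1 := hn.conj_mem ⟨dec 7 ⟨2, 0, 0, 4⟩, hK hX⟩ (Subgroup.mem_subgroupOf.2 hX) ⟨A, hA⟩
    have h2 : A * dec 7 ⟨2, 0, 0, 4⟩ * A⁻¹ ∈ ofCodes 7 L hL := Subgroup.mem_subgroupOf.1 h1
    rw [mem_ofCodes, enc_conj, hv] at h2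
    exact hsub (List.mem_filter.2 ⟨enc_mem_enum A, memb_iff.2 h2⟩)

theorem subgroupConj_or_not_isStrongGelfandPair_seven {H : Subgroup SL(2, ZMod 7)} (hH : H ≠ ⊤) :
    SubgroupConj H (upperTriangular 7) ∨ SubgroupConj H (upperTriangularSq 7) ∨
      (SubgroupConj H (ofCodes 7 _ isGroup_octahedral7) ∨
        SubgroupConj H (ofCodes 7 _ isGroup_octahedral7')) ∨
      (¬ IsStrongGelfandPair H ∧ Nat.card H < 48) := by
  by_cases h7 : 7 ∣ Nat.card H
  · obtain ⟨K, hHK, hu, hle⟩ := exists_subgroupConj_le_upperTriangular hH h7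
    rcases eq_of_le_upperTriangular (by decide +kernel) (by decide +kernel) hu hle
      with h | rfl | rfl
    · exact Or.inr (Or.inr (Or.inr ((not_isStrongGelfandPair_of_subgroupConj hHK h
        (x := ⟨0, 1, 6, 0⟩) (y := ⟨0, 2, 3, 0⟩) (by decide +kernel)).imp id
          fun h => h.trans_lt (by decide +kernel))))
    · exact Or.inr (Or.inl hHK)
    · exact Or.inl hHK
  · have hdvd : Nat.card H ∣ 48 := card_dvd_of_not_dvd h7
    right; right
    by_cases h3 : 3 ∣ Nat.card H
    · obtain ⟨K, hHK, he, hx, h | ⟨A, hA, hAt⟩⟩ := exists_subgroupConj_of_pairTest (p := 7) (l := 3)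
        (x := ⟨2, 0, 0, 4⟩) (ns := [2, 2, 2, 2, 3])
        (ws := [[0, 1, 1, 2, 2], [0, 1, 1, 1, 2], [0, 1, 1, 2], [0, 2, 1, 1], [0, 1], [0, 2]].map
          (altWord true))
        (ts := [⟨1, 1, 4, 5⟩, ⟨1, 6, 3, 5⟩]) (by decide +kernel) (by decide +kernel)
        (Nat.factorization_eq_of_eq_mul (k := 1) (m := 112) Nat.prime_three
          (by rw [card_SL2]; norm_num) (by norm_num)) h3 hdvd
      · right
        exact (not_isStrongGelfandPair_of_subgroupConj hHK h (x := ⟨0, 1, 6, 1⟩)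
          (y := ⟨0, 1, 6, 3⟩) (by decide +kernel)).imp id fun h => h.trans_lt (by decide +kernel)
      · rw [hHK.card_eq] at hdvd
        simp only [List.mem_cons, List.not_mem_nil, or_false] at hAt
        rcases hAt with hAt | hAt
        · rcases eq_or_not_isStrongGelfandPair_of_tetrahedral_le isGroup_tetrahedral7
            isGroup_octahedral7 (by decide +kernel) (by decide +kernel) (by decide +kernel)
            (by decide +kernel) (by decide +kernel) hHK (ofCodes_gen_le _ rfl hx he hA hAt) hdvd
            with rfl | h
          exacts [Or.inl (Or.inl hHK), Or.inr h]
        · rcases eq_or_not_isStrongGelfandPair_of_tetrahedral_le isGroup_tetrahedral7'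
            isGroup_octahedral7' (by decide +kernel) (by decide +kernel) (by decide +kernel)
            (by decide +kernel) (by decide +kernel) hHK (ofCodes_gen_le _ rfl hx he hA hAt) hdvd
            with rfl | h
          exacts [Or.inl (Or.inr hHK), Or.inr h]
    · have h16 : Nat.card H ∣ 2 ^ 4 :=
        ((Nat.Prime.coprime_iff_not_dvd Nat.prime_three).2 h3).symm.dvd_of_dvd_mul_left
          (show _ ∣ 3 * 16 from hdvd)
      obtain ⟨K, hHK, hle⟩ := exists_subgroupConj_le (l := 2)
        (Q := ofCodes 7 _ isGroup_quaternion7) (by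
          rw [Nat.factorization_eq_of_eq_mul (k := 4) (m := 21) Nat.prime_two
            (by rw [card_SL2]; norm_num) (by norm_num), card_ofCodes]
          decide +kernel) H (isPGroup_of_card_dvd Nat.prime_two h16)
      exact Or.inr ((not_isStrongGelfandPair_of_subgroupConj hHK hle (x := ⟨0, 1, 6, 0⟩)
        (y := ⟨0, 2, 3, 0⟩) (by decide +kernel)).imp id fun h => h.trans_lt (by decide +kernel))

theorem isStrongGelfandPair_upperTriangularSq_seven :
    IsStrongGelfandPair (upperTriangularSq 7) := by
  rw [upperTriangularSq_eq_ofCodes isGroup_triangularSq7]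
  exact isStrongGelfandPair_ofCodes _
    (rs := [⟨0, 1, 6, 0⟩, ⟨0, 1, 6, 1⟩, ⟨0, 1, 6, 2⟩, ⟨0, 1, 6, 3⟩, ⟨0, 1, 6, 4⟩, ⟨0, 1, 6, 5⟩,
      ⟨0, 1, 6, 6⟩, ⟨1, 0, 0, 1⟩, ⟨1, 1, 0, 1⟩, ⟨1, 3, 0, 1⟩, ⟨2, 0, 0, 4⟩, ⟨3, 0, 0, 5⟩])
    (ss := [⟨0, 6, 1, 0⟩, ⟨0, 6, 1, 6⟩, ⟨0, 6, 1, 5⟩, ⟨0, 6, 1, 4⟩, ⟨0, 6, 1, 3⟩, ⟨0, 6, 1, 2⟩,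
      ⟨0, 6, 1, 1⟩, ⟨6, 0, 0, 6⟩, ⟨6, 6, 0, 6⟩, ⟨6, 4, 0, 6⟩, ⟨5, 0, 0, 3⟩, ⟨4, 0, 0, 2⟩])
    (by decide +kernel)

theorem isStrongGelfandPair_octahedral7 : IsStrongGelfandPair (ofCodes 7 _ isGroup_octahedral7) :=
  isStrongGelfandPair_ofCodes _
    (rs := [⟨0, 1, 6, 0⟩, ⟨0, 1, 6, 1⟩, ⟨0, 1, 6, 2⟩, ⟨0, 1, 6, 3⟩, ⟨0, 1, 6, 5⟩, ⟨1, 0, 0, 1⟩,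
      ⟨1, 1, 1, 2⟩, ⟨1, 1, 4, 5⟩, ⟨1, 1, 5, 6⟩, ⟨1, 3, 3, 3⟩, ⟨1, 3, 6, 5⟩, ⟨3, 3, 6, 4⟩])
    (ss := [⟨0, 6, 1, 6⟩, ⟨0, 6, 1, 5⟩, ⟨0, 6, 1, 4⟩, ⟨0, 6, 1, 2⟩, ⟨6, 0, 0, 6⟩, ⟨6, 6, 6, 5⟩,
      ⟨6, 6, 3, 2⟩, ⟨6, 4, 4, 4⟩, ⟨6, 4, 1, 2⟩]) (by decide +kernel)

theorem isStrongGelfandPair_octahedral7' :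
    IsStrongGelfandPair (ofCodes 7 _ isGroup_octahedral7') := by
  rw [← map_flipEquiv_ofCodes isGroup_octahedral7 isGroup_octahedral7' rfl]
  exact isStrongGelfandPair_octahedral7.map_equiv _

/-- A preimage has order 48, whereas the triangular groups have orders 42 and 21 and the refuted
subgroups have order below 48. -/
theorem isPreimageOfS4_seven_iff {H : Subgroup SL(2, ZMod 7)} :
    IsPreimageOfS4 7 H ↔ SubgroupConj H (ofCodes 7 _ isGroup_octahedral7) ∨
      SubgroupConj H (ofCodes 7 _ isGroup_octahedral7') := by
  constructor
  · intro h
    have hcard : Nat.card H = 48 := by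
      rw [card_of_isPreimageOfS4 h, center_eq_ofCodes isGroup_center7, card_ofCodes]
      rfl
    rcases subgroupConj_or_not_isStrongGelfandPair_seven
      (ne_top_of_card_lt (H := H) (by omega)) with h | h | h | h
    · rw [h.card_eq, upperTriangular_eq_ofCodes isGroup_triangular7, card_ofCodes] at hcard
      exact absurd hcard (by decide +kernel)
    · rw [h.card_eq, upperTriangularSq_eq_ofCodes isGroup_triangularSq7, card_ofCodes] at hcard
      exact absurd hcard (by decide +kernel)
    · exact h
    · omega
  · rintro (h | h)
    · exact isPreimageOfS4_of_subgroupConj h (isPreimageOfS4_of_actTest _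
        -- Each block consists of the two generators of one of the four subgroups of order three.
        (Ps := [[⟨2, 0, 0, 4⟩, ⟨4, 0, 0, 2⟩], [⟨1, 2, 2, 5⟩, ⟨5, 5, 5, 1⟩],
          [⟨1, 4, 1, 5⟩, ⟨5, 3, 6, 1⟩], [⟨1, 1, 4, 5⟩, ⟨5, 6, 3, 1⟩]])
        (by decide +kernel) isGroup_center7 (by decide +kernel) (by decide +kernel))
    · exact isPreimageOfS4_of_subgroupConj h (isPreimageOfS4_of_actTest _
        (Ps := [[⟨2, 0, 0, 4⟩, ⟨4, 0, 0, 2⟩], [⟨1, 6, 3, 5⟩, ⟨5, 1, 4, 1⟩],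
          [⟨1, 3, 6, 5⟩, ⟨5, 4, 1, 1⟩], [⟨1, 5, 5, 5⟩, ⟨5, 2, 2, 1⟩]])
        (by decide +kernel) isGroup_center7 (by decide +kernel) (by decide +kernel))

theorem not_subgroupConj_octahedral7 : ¬ SubgroupConj (ofCodes 7 _ isGroup_octahedral7)
    (ofCodes 7 _ isGroup_octahedral7') :=
  -- These two elements generate `tetrahedral7'`; no matrix conjugates both of them into the first
  -- group.
  not_subgroupConj_ofCodes _ _ (x := ⟨2, 0, 0, 4⟩) (y := ⟨1, 6, 3, 5⟩) (by decide +kernel)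
    (by decide +kernel) (by decide +kernel)

theorem isStrongGelfandPair_iff_seven {H : Subgroup SL(2, ZMod 7)} (hH : H ≠ ⊤) :
    IsStrongGelfandPair H ↔ SubgroupConj H (upperTriangular 7) ∨
      SubgroupConj H (upperTriangularSq 7) ∨ IsPreimageOfS4 7 H := by
  rw [isPreimageOfS4_seven_iff]
  constructor
  · intro h
    rcases subgroupConj_or_not_isStrongGelfandPair_seven hH with h1 | h1 | h1 | h1
    exacts [Or.inl h1, Or.inr (Or.inl h1), Or.inr (Or.inr h1), absurd h h1.1]
  · rintro (h | h | h | h)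
    · exact h.isStrongGelfandPair_iff.2
        (isStrongGelfandPair_upperTriangularSq_seven.mono upperTriangularSq_le)
    · exact h.isStrongGelfandPair_iff.2 isStrongGelfandPair_upperTriangularSq_seven
    · exact h.isStrongGelfandPair_iff.2 isStrongGelfandPair_octahedral7
    · exact h.isStrongGelfandPair_iff.2 isStrongGelfandPair_octahedral7'

end Matrix.SpecialLinearGroup

/-! ### The order of the binary icosahedral group by coset enumeration -/

section BinaryIcosahedral

theorem mul_mul_eq_of_mul_eq {G : Type*} [Group G] {t a b c u v : G} {m n : ℤ}
    (h₁ : a * u = t ^ m * b) (h₂ : b * v = t ^ n * c) : a * (u * v) = t ^ (m + n) * c := by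
  rw [← mul_assoc, h₁, mul_assoc, h₂, ← mul_assoc, zpow_add]

/-- A relator w x = t ^ 5 traced from the coset representative a up to its last letter determines
the missing table entry, because t ^ 5 is central. -/
theorem mul_eq_of_mul_mul_eq {G : Type*} [Group G] {t a d w x : G} (ht : Commute (t ^ 5) a) {n : ℤ}
    (h : a * w = t ^ n * d) (hw : w * x = t ^ 5) (m : ℤ) (hm : n + m = 5) : d * x = t ^ m * a := by
  rw [← eq_sub_iff_add_eq'] at hm
  have h5 : t ^ (5 : ℤ) = t ^ 5 := zpow_natCast t 5
  have hc : Commute (t ^ 5) (t ^ n)⁻¹ := ((Commute.refl t).pow_left 5).zpow_right n |>.inv_right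
  rw [hm, zpow_sub, h5, hc.eq, mul_assoc, ht.eq, ← hw, ← mul_assoc, ← mul_assoc,
    mul_assoc _ a, h, inv_mul_cancel_left]

/-- The coset enumeration of the subgroup generated by `t` in the binary icosahedral group. -/
theorem finite_and_card_le_of_binaryIcosahedral {G : Type*} [Group G] {s t : G}
    (hs : s ^ 3 = t ^ 5) (hst : s * t * s * t = t ^ 5) (hgen : Subgroup.closure {s, t} = ⊤) :
    Finite G ∧ Nat.card G ≤ 120 := by
  have hcs : Commute (t ^ 5) s := hs ▸ Commute.pow_self s 3
  have hct : Commute (t ^ 5) t := Commute.pow_self t 5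
  have hz : ∀ g : G, Commute (t ^ 5) g := fun g => by
    have hle : Subgroup.closure {s, t} ≤ Subgroup.centralizer {t ^ 5} := by
      rw [Subgroup.closure_le]
      rintro x (rfl | rfl) <;> rw [SetLike.mem_coe, Subgroup.mem_centralizer_singleton_iff]
      exacts [hcs.symm.eq, hct.symm.eq]
    rw [hgen] at hle
    exact (Subgroup.mem_centralizer_singleton_iff.1 (hle (Subgroup.mem_top g))).symm
  have hs' : s * s * s = t ^ 5 := by rw [← hs, pow_three, mul_assoc]
  have ht' : t * t * t * t * t = t ^ 5 := by simp only [pow_succ, pow_zero, one_mul]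
  have sss : ∀ {a b c : G} {m n : ℤ}, a * s = t ^ m * b → b * s = t ^ n * c →
      ∀ k, m + n + k = 5 → c * s = t ^ k * a := fun h₁ h₂ =>
    mul_eq_of_mul_mul_eq (hz _) (mul_mul_eq_of_mul_eq h₁ h₂) hs'
  have stst : ∀ {a b c d : G} {l m n : ℤ}, a * s = t ^ l * b → b * t = t ^ m * c →
      c * s = t ^ n * d → ∀ k, l + m + n + k = 5 → d * t = t ^ k * a := fun h₁ h₂ h₃ =>
    mul_eq_of_mul_mul_eq (hz _) (mul_mul_eq_of_mul_eq (mul_mul_eq_of_mul_eq h₁ h₂) h₃) hst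
  have ttttt : ∀ {a b c d e : G} {j l m n : ℤ}, a * t = t ^ j * b → b * t = t ^ l * c →
      c * t = t ^ m * d → d * t = t ^ n * e → ∀ k, j + l + m + n + k = 5 → e * t = t ^ k * a :=
    fun h₁ h₂ h₃ h₄ => mul_eq_of_mul_mul_eq (hz _) (mul_mul_eq_of_mul_eq
      (mul_mul_eq_of_mul_eq (mul_mul_eq_of_mul_eq h₁ h₂) h₃) h₄) ht'
  -- A new entry introduces a representative; the other entries are deduced by closing one of the
  -- relators. Exponents of t are kept in the table, since they yield the order of t at the end.
  have new : ∀ a x : G, ∃ b, a * x = t ^ (0 : ℤ) * b := fun a x => ⟨a * x, by simp⟩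
  have t0 : (1 : G) * t = t ^ (1 : ℤ) * 1 := by simp
  obtain ⟨g1, s0⟩ := new 1 s
  obtain ⟨g2, s1⟩ := new g1 s
  have s2 := sss s0 s1 5 (by norm_num)
  have t1 := stst s2 t0 s0 (-1) (by norm_num)
  obtain ⟨g3, t2⟩ := new g2 t
  obtain ⟨g4, s3⟩ := new g3 s
  have t4 := stst s1 t2 s3 5 (by norm_num)
  obtain ⟨g5, s4⟩ := new g4 s
  have s5 := sss s3 s4 5 (by norm_num)
  obtain ⟨g6, t5⟩ := new g5 t
  obtain ⟨g7, s6⟩ := new g6 s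
  have t7 := stst s4 t5 s6 5 (by norm_num)
  have t3 := ttttt t7 t4 t1 t2 (-4) (by norm_num)
  obtain ⟨g8, s7⟩ := new g7 s
  have t8 := stst s5 t3 s7 4 (by norm_num)
  have s8 := sss s6 s7 5 (by norm_num)
  obtain ⟨g9, t6⟩ := new g6 t
  obtain ⟨g10, s9⟩ := new g9 s
  have t10 := stst s8 t6 s9 0 (by norm_num)
  have t9 := ttttt t10 t8 t5 t6 1 (by norm_num)
  obtain ⟨g11, s10⟩ := new g10 s
  have s11 := sss s9 s10 5 (by norm_num)
  have t11 := stst s11 t9 s10 (-1) (by norm_num)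
  -- The table gives both g11 * t = t⁻¹ * g11 and g11 * t = t ^ 9 * g11. So ⟨t⟩ has order at most
  -- 10, and with twelve cosets the bound 120 results.
  have htt : t ^ 10 = 1 := by
    have h := mul_right_cancel (t11.symm.trans (ttttt t11 t11 t11 t11 9 (by norm_num)))
    rw [← zpow_natCast, show ((10 : ℕ) : ℤ) = 9 - -1 by norm_num, zpow_sub, h, mul_inv_cancel]
  have hss : s ^ 6 = 1 := by rw [show 6 = 3 * 2 from rfl, pow_mul, hs, ← pow_mul, htt]
  let g : Fin 12 → G := ![1, g1, g2, g3, g4, g5, g6, g7, g8, g9, g10, g11]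
  have hgs : ∀ i, ∃ n : ℤ, ∃ j, g i * s = t ^ n * g j := by
    intro i
    fin_cases i
    exacts [⟨_, 1, s0⟩, ⟨_, 2, s1⟩, ⟨_, 0, s2⟩, ⟨_, 4, s3⟩, ⟨_, 5, s4⟩, ⟨_, 3, s5⟩, ⟨_, 7, s6⟩,
      ⟨_, 8, s7⟩, ⟨_, 6, s8⟩, ⟨_, 10, s9⟩, ⟨_, 11, s10⟩, ⟨_, 9, s11⟩]
  have hgt : ∀ i, ∃ n : ℤ, ∃ j, g i * t = t ^ n * g j := by
    intro i
    fin_cases i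
    exacts [⟨_, 0, t0⟩, ⟨_, 2, t1⟩, ⟨_, 3, t2⟩, ⟨_, 7, t3⟩, ⟨_, 1, t4⟩, ⟨_, 6, t5⟩, ⟨_, 9, t6⟩,
      ⟨_, 4, t7⟩, ⟨_, 5, t8⟩, ⟨_, 10, t9⟩, ⟨_, 8, t10⟩, ⟨_, 11, t11⟩]
  have step : ∀ x, (∀ i, ∃ n : ℤ, ∃ j, g i * x = t ^ n * g j) →
      ∀ y, (∃ n : ℤ, ∃ i, y = t ^ n * g i) → ∃ n : ℤ, ∃ i, y * x = t ^ n * g i := by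
    rintro x hx _ ⟨n, i, rfl⟩
    obtain ⟨m, j, h⟩ := hx i
    exact ⟨n + m, j, by rw [mul_assoc, h, ← mul_assoc, zpow_add]⟩
  have steps : ∀ x, (∀ i, ∃ n : ℤ, ∃ j, g i * x = t ^ n * g j) → ∀ k : ℕ,
      ∀ y, (∃ n : ℤ, ∃ i, y = t ^ n * g i) → ∃ n : ℤ, ∃ i, y * x ^ k = t ^ n * g i := by
    intro x hx k
    induction k with
    | zero => simp
    | succ k ih =>
      intro y hy
      rw [pow_succ, ← mul_assoc]
      exact step x hx _ (ih y hy)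
  have hall : ∀ y : G, ∃ n : ℤ, ∃ i, y = t ^ n * g i := by
    intro y
    have hy : y ∈ Subgroup.closure {s, t} := hgen ▸ Subgroup.mem_top y
    induction hy using Subgroup.closure_induction_right with
    | one => exact ⟨0, 0, by simp [g]⟩
    | mul_right y _ x hx ih =>
      rcases hx with rfl | rfl
      exacts [step _ hgs y ih, step _ hgt y ih]
    | mul_inv_cancel y _ x hx ih =>
      rcases hx with rfl | rfl
      · rw [inv_eq_of_mul_eq_one_right (b := x ^ 5) (by rw [← pow_succ', hss])]
        exact steps _ hgs 5 y ih
      · rw [inv_eq_of_mul_eq_one_right (b := x ^ 9) (by rw [← pow_succ', htt])]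
        exact steps _ hgt 9 y ih
  have hsurj : Function.Surjective fun a : Fin 10 × Fin 12 => t ^ (a.1 : ℕ) * g a.2 := by
    intro y
    obtain ⟨n, i, rfl⟩ := hall y
    have h0 : 0 ≤ n % 10 := Int.emod_nonneg n (by norm_num)
    have h1 : n % 10 < 10 := Int.emod_lt_of_pos n (by norm_num)
    refine ⟨(⟨(n % 10).toNat, by omega⟩, i), ?_⟩
    have h2 : t ^ n = t ^ (n % 10) := zpow_eq_zpow_emod' n htt
    change t ^ (n % 10).toNat * g i = _
    rw [h2, ← zpow_natCast, Int.toNat_of_nonneg h0]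
  refine ⟨Finite.of_surjective _ hsurj, ?_⟩
  have := Nat.card_le_card_of_surjective _ hsurj
  simpa using this

theorem binaryIcosahedral_relations :
    (PresentedGroup.of 0 : BinaryIcosahedral) = PresentedGroup.of 1 * PresentedGroup.of 2 ∧
    (PresentedGroup.of 1 : BinaryIcosahedral) ^ 3 = PresentedGroup.of 2 ^ 5 ∧
    (PresentedGroup.of 1 * PresentedGroup.of 2 * PresentedGroup.of 1 * PresentedGroup.of 2 :
      BinaryIcosahedral) = PresentedGroup.of 2 ^ 5 := by
  have h1 : (PresentedGroup.of 0 : BinaryIcosahedral) ^ 2 *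
      (PresentedGroup.of 0 * PresentedGroup.of 1 * PresentedGroup.of 2)⁻¹ = 1 :=
    PresentedGroup.one_of_mem (Or.inl rfl)
  have h2 : (PresentedGroup.of 1 : BinaryIcosahedral) ^ 3 *
      (PresentedGroup.of 0 * PresentedGroup.of 1 * PresentedGroup.of 2)⁻¹ = 1 :=
    PresentedGroup.one_of_mem (Or.inr (Or.inl rfl))
  have h3 : (PresentedGroup.of 2 : BinaryIcosahedral) ^ 5 *
      (PresentedGroup.of 0 * PresentedGroup.of 1 * PresentedGroup.of 2)⁻¹ = 1 :=
    PresentedGroup.one_of_mem (Or.inr (Or.inr rfl))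
  rw [mul_inv_eq_one] at h1 h2 h3
  have h0 : (PresentedGroup.of 0 : BinaryIcosahedral) =
      PresentedGroup.of 1 * PresentedGroup.of 2 := by
    rw [sq, mul_assoc] at h1
    exact mul_left_cancel h1
  refine ⟨h0, h2.trans h3.symm, ?_⟩
  rw [h3, h0]

theorem finite_and_card_binaryIcosahedral_le :
    Finite BinaryIcosahedral ∧ Nat.card BinaryIcosahedral ≤ 120 := by
  obtain ⟨h0, h1, h2⟩ := binaryIcosahedral_relations
  refine finite_and_card_le_of_binaryIcosahedral h1 h2 ?_
  rw [eq_top_iff, ← PresentedGroup.closure_range_of, Subgroup.closure_le]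
  have hs : (PresentedGroup.of 1 : BinaryIcosahedral) ∈ Subgroup.closure
      {(PresentedGroup.of 1 : BinaryIcosahedral), PresentedGroup.of 2} :=
    Subgroup.subset_closure (Or.inl rfl)
  have ht : (PresentedGroup.of 2 : BinaryIcosahedral) ∈ Subgroup.closure
      {(PresentedGroup.of 1 : BinaryIcosahedral), PresentedGroup.of 2} :=
    Subgroup.subset_closure (Or.inr rfl)
  rintro _ ⟨i, rfl⟩
  fin_cases i
  · exact h0 ▸ mul_mem hs ht
  · exact hs
  · exact ht

/-- A group of order `120` generated by matrices satisfying the relations of the binary icosahedral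
group is isomorphic to it. -/
theorem hasIsoType_binaryIcosahedral {G : Type*} [Group G] {K : Subgroup G} (hK : Nat.card K = 120)
    {s t : G} (hs : s ^ 3 = t ^ 5) (hst : s * t * s * t = t ^ 5)
    (hgen : Subgroup.closure {s, t} = K) : HasIsoType BinaryIcosahedral K := by
  obtain ⟨hfin, hcard⟩ := finite_and_card_binaryIcosahedral_le
  let f : Fin 3 → G := ![s * t, s, t]
  have hst' : s * t * s * t = s * t * (s * t) := by group
  have hf : ∀ r ∈ binaryIcosahedralRels, FreeGroup.lift f r = 1 := by
    rintro r (rfl | rfl | rfl) <;>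
      simp only [map_mul, map_inv, map_pow, FreeGroup.lift_apply_of, f, mul_inv_eq_one,
        Matrix.cons_val_zero, Matrix.cons_val_one, Matrix.cons_val]
    · rw [sq, hst']
    · rw [hs, hst]
    · rw [hst]
  let φ : BinaryIcosahedral →* G := PresentedGroup.toGroup hf
  have hφ : ∀ i, φ (PresentedGroup.of i) = f i := fun i => PresentedGroup.toGroup.of hf
  have hle : K ≤ φ.range := by
    rw [← hgen, Subgroup.closure_le]
    rintro x (rfl | rfl)
    exacts [⟨_, hφ 1⟩, ⟨_, hφ 2⟩]
  have hsub : φ.range ≤ K := by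
    rw [MonoidHom.range_eq_map, ← PresentedGroup.closure_range_of, MonoidHom.map_closure,
      Subgroup.closure_le]
    have h1 : s ∈ K := hgen ▸ Subgroup.subset_closure (Or.inl rfl)
    have h2 : t ∈ K := hgen ▸ Subgroup.subset_closure (Or.inr rfl)
    rintro _ ⟨_, ⟨i, rfl⟩, rfl⟩
    rw [hφ]
    fin_cases i
    exacts [mul_mem h1 h2, h1, h2]
  have hrange : φ.range = K := le_antisymm hsub hle
  -- The bound from the coset enumeration meets the order of K, so the surjection onto K is
  -- injective.
  have e : BinaryIcosahedral ≃* φ.range := MulEquiv.ofBijective φ.rangeRestrict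
    (Function.Surjective.bijective_of_nat_card_le φ.rangeRestrict_surjective
      (by rw [hrange, hK]; exact hcard))
  exact ⟨(e.trans (MulEquiv.subgroupCongr hrange)).symm⟩

end BinaryIcosahedral

/-! ### The case p = 11 -/

namespace Code

/-- A subgroup of `SL(2, 11)` isomorphic to the binary icosahedral group, for suitable `y`. -/
def icosahedral11 (y : Code) : List Code :=
  gen 11 5 [[], [0, 1], [0, 1, 1], [0, 2], [0, 1, 2], [0, 1, 1, 1], [0, 2, 1], [0, 3], [0, 1, 3],
    [0, 1, 1, 1, 1], [0, 1, 1, 2], [0, 2, 2], [0, 3, 1], [0, 1, 4], [0, 1, 1, 1, 2],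
    [0, 1, 1, 2, 1], [0, 1, 1, 3], [0, 3, 2], [0, 3, 1, 1], [0, 1, 4, 1], [0, 1, 1, 1, 3],
    [0, 1, 1, 1, 2, 1], [0, 1, 1, 1, 4], [0, 1, 1, 1, 2, 1, 1]] ⟨4, 0, 0, 3⟩ y

/-- A subgroup of `SL(2, 11)` isomorphic to `SL(2, 3)`, for suitable `y`. -/
def tetrahedral11 (y : Code) : List Code :=
  gen 11 3 [[], [0, 1], [0, 1, 1], [0, 2], [0, 1, 2], [0, 2, 1], [0, 1, 2, 1], [0, 2, 2]]
    ⟨0, 10, 1, 10⟩ y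

/-- A subgroup of `SL(2, 11)` isomorphic to `SL(2, 3)`, for suitable `y`. -/
def tetrahedral11' (y : Code) : List Code :=
  gen 11 3 [[], [0, 1], [0, 1, 1], [0, 2], [0, 1, 2], [0, 1, 1, 1], [0, 2, 1], [0, 1, 1, 2]]
    ⟨0, 10, 1, 10⟩ y

/-- A subgroup of order eight of `SL(2, 11)`. -/
def quaternion11 : List Code := gen 11 4 [[], [0, 1]] ⟨0, 1, 10, 0⟩ ⟨1, 3, 3, 10⟩

end Code

namespace Matrix.SpecialLinearGroup

open Code

local instance : Fact (Nat.Prime 11) := ⟨by norm_num⟩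

theorem isGroup_icosahedral11 : isGroup 11 (icosahedral11 ⟨1, 1, 1, 2⟩) = true := by
  decide +kernel

theorem isGroup_icosahedral11' : isGroup 11 (icosahedral11 ⟨1, 10, 10, 2⟩) = true := by
  decide +kernel

theorem isGroup_quaternion11 : isGroup 11 quaternion11 = true := by decide +kernel

theorem isGroup_triangularSq11 : isGroup 11 (triangularSq 11) = true := by decide +kernel

theorem isGroup_triangular11 : isGroup 11 (triangular 11) = true := by decide +kernel

/-- If 3 divides the order, a conjugate of H normalizes ⟨x⟩ or equals one of four copies of SL(2, 3)
containing x; otherwise H lies in a Sylow 2-subgroup up to conjugation. Each of these is refuted. -/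
theorem not_isStrongGelfandPair_of_card_dvd_24 {H : Subgroup SL(2, ZMod 11)}
    (hdvd : Nat.card H ∣ 24) : ¬ IsStrongGelfandPair H := by
  by_cases h3 : 3 ∣ Nat.card H
  · obtain ⟨K, hHK, he, hx, h | ⟨A, hA, hAt⟩⟩ := exists_subgroupConj_of_pairTest (p := 11) (l := 3)
      (x := ⟨0, 10, 1, 10⟩) (ns := [2, 2, 2, 3])
      (ws := [[0, 1, 1, 1, 1], [0, 1, 1, 1, 2], [0, 1], [0, 2], [0, 1, 1, 2], [0, 1, 2, 2],
        [0, 2, 2, 1], [0, 2, 1, 1]].map (altWord true))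
      (ts := [⟨1, 2, 4, 9⟩, ⟨1, 5, 6, 9⟩, ⟨1, 7, 9, 9⟩, ⟨2, 3, 5, 8⟩]) (by decide +kernel)
      (by decide +kernel)
      (Nat.factorization_eq_of_eq_mul (k := 1) (m := 440) Nat.prime_three
        (by rw [card_SL2]; norm_num) (by norm_num)) h3 hdvd
    · exact (not_isStrongGelfandPair_of_subgroupConj hHK h (x := ⟨0, 1, 10, 0⟩)
        (y := ⟨0, 2, 5, 0⟩) (by decide +kernel)).1
    · rw [hHK.card_eq] at hdvd
      have key : ∀ L : List Code, (∃ h : isGroup 11 L = true, ofCodes 11 L h ≤ K) →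
          L.length = 24 → ∀ x y, noProduct 11 L x y = true → ¬ IsStrongGelfandPair H := by
        rintro L ⟨h, hle⟩ hlen x y hxy
        rw [eq_ofCodes h hle hdvd hlen] at hHK
        exact (not_isStrongGelfandPair_of_subgroupConj hHK (fun _ h => h) hxy).1
      simp only [List.mem_cons, List.not_mem_nil, or_false] at hAt
      rcases hAt with hAt | hAt | hAt | hAt
      · exact key (tetrahedral11' ⟨1, 2, 4, 9⟩)
          ⟨by decide +kernel, ofCodes_gen_le _ rfl hx he hA hAt⟩
          (by decide +kernel) ⟨0, 1, 10, 0⟩ ⟨0, 2, 5, 0⟩ (by decide +kernel)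
      · exact key (tetrahedral11 ⟨1, 5, 6, 9⟩)
          ⟨by decide +kernel, ofCodes_gen_le _ rfl hx he hA hAt⟩
          (by decide +kernel) ⟨0, 1, 10, 0⟩ ⟨0, 2, 5, 0⟩ (by decide +kernel)
      · exact key (tetrahedral11' ⟨1, 7, 9, 9⟩)
          ⟨by decide +kernel, ofCodes_gen_le _ rfl hx he hA hAt⟩
          (by decide +kernel) ⟨0, 1, 10, 0⟩ ⟨0, 2, 5, 1⟩ (by decide +kernel)
      · exact key (tetrahedral11 ⟨2, 3, 5, 8⟩)
          ⟨by decide +kernel, ofCodes_gen_le _ rfl hx he hA hAt⟩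
          (by decide +kernel) ⟨0, 1, 10, 0⟩ ⟨0, 2, 5, 0⟩ (by decide +kernel)
  · have h8 : Nat.card H ∣ 2 ^ 3 :=
      ((Nat.Prime.coprime_iff_not_dvd Nat.prime_three).2 h3).symm.dvd_of_dvd_mul_left
        (show _ ∣ 3 * 8 from hdvd)
    obtain ⟨K, hHK, hle⟩ := exists_subgroupConj_le (l := 2)
      (Q := ofCodes 11 _ isGroup_quaternion11) (by
        rw [Nat.factorization_eq_of_eq_mul (k := 3) (m := 165) Nat.prime_two
          (by rw [card_SL2]; norm_num) (by norm_num), card_ofCodes]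
        decide +kernel) H (isPGroup_of_card_dvd Nat.prime_two h8)
    exact (not_isStrongGelfandPair_of_subgroupConj hHK hle (x := ⟨0, 1, 10, 1⟩)
      (y := ⟨0, 1, 10, 2⟩) (by decide +kernel)).1

/-- A subgroup of order prime to 11 has order dividing 120. If 5 divides the order, a conjugate
normalizes ⟨x⟩ or contains one of two listed elements. Each of these generates with x a group of
order 120, which leaves no room for a larger one. -/
theorem subgroupConj_or_not_isStrongGelfandPair_eleven {H : Subgroup SL(2, ZMod 11)}
    (hH : H ≠ ⊤) :
    SubgroupConj H (upperTriangularSq 11) ∨ SubgroupConj H (upperTriangular 11) ∨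
      (SubgroupConj H (ofCodes 11 _ isGroup_icosahedral11) ∨
        SubgroupConj H (ofCodes 11 _ isGroup_icosahedral11')) ∨
      (¬ IsStrongGelfandPair H ∧ Nat.card H < 120) := by
  by_cases h11 : 11 ∣ Nat.card H
  · obtain ⟨K, hHK, hu, hle⟩ := exists_subgroupConj_le_upperTriangular hH h11
    rcases eq_of_le_upperTriangular (by decide +kernel) (by decide +kernel) hu hle
      with h | rfl | rfl
    · exact Or.inr (Or.inr (Or.inr ((not_isStrongGelfandPair_of_subgroupConj hHK h
        (x := ⟨0, 1, 10, 0⟩) (y := ⟨0, 2, 5, 0⟩) (by decide +kernel)).imp id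
          fun h => h.trans_lt (by decide +kernel))))
    · exact Or.inl hHK
    · exact Or.inr (Or.inl hHK)
  · have hdvd : Nat.card H ∣ 120 := card_dvd_of_not_dvd h11
    right; right
    by_cases h5 : 5 ∣ Nat.card H
    · have := Fact.mk Nat.prime_five
      obtain ⟨K, hHK, he, hx, h | ⟨A, hA, hAt⟩⟩ := exists_subgroupConj_of_pairTest (p := 11)
        (l := 5) (x := ⟨4, 0, 0, 3⟩) (ns := [2, 2, 2, 3, 5])
        (ws := [[0, 1, 2, 4, 3], [1, 1, 1, 4], [1, 2, 2, 3], [0, 1, 2, 1, 3], [0, 1, 2, 4],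
          [0, 1, 3, 4], [0, 2, 2, 3], [0, 2, 3, 3], [0, 3, 2, 2], [0, 3, 3, 2], [0, 4, 2, 1],
          [0, 4, 3, 1], [0, 1], [0, 2], [0, 3], [0, 4]].map (altWord true))
        (ts := [⟨1, 1, 1, 2⟩, ⟨1, 10, 10, 2⟩]) (by decide +kernel) (by decide +kernel)
        (Nat.factorization_eq_of_eq_mul (k := 1) (m := 264) Nat.prime_five
          (by rw [card_SL2]; norm_num) (by norm_num)) h5 hdvd
      · right
        exact (not_isStrongGelfandPair_of_subgroupConj hHK h (x := ⟨0, 1, 10, 1⟩)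
          (y := ⟨0, 1, 10, 2⟩) (by decide +kernel)).imp id fun h => h.trans_lt (by decide +kernel)
      · left
        rw [hHK.card_eq] at hdvd
        simp only [List.mem_cons, List.not_mem_nil, or_false] at hAt
        rcases hAt with hAt | hAt
        · left
          rwa [eq_ofCodes isGroup_icosahedral11 (ofCodes_gen_le _ rfl hx he hA hAt) hdvd
            (by decide +kernel)] at hHK
        · right
          rwa [eq_ofCodes isGroup_icosahedral11' (ofCodes_gen_le _ rfl hx he hA hAt) hdvd
            (by decide +kernel)] at hHK
    · have h24 : Nat.card H ∣ 24 :=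
        ((Nat.Prime.coprime_iff_not_dvd Nat.prime_five).2 h5).symm.dvd_of_dvd_mul_left
          (show _ ∣ 5 * 24 from hdvd)
      have := Nat.le_of_dvd (by norm_num) h24
      exact Or.inr ⟨not_isStrongGelfandPair_of_card_dvd_24 h24, by omega⟩

theorem isStrongGelfandPair_upperTriangularSq_eleven :
    IsStrongGelfandPair (upperTriangularSq 11) := by
  rw [upperTriangularSq_eq_ofCodes isGroup_triangularSq11]
  exact isStrongGelfandPair_ofCodes _
    (rs := [⟨0, 1, 10, 0⟩, ⟨0, 1, 10, 1⟩, ⟨0, 1, 10, 2⟩, ⟨0, 1, 10, 3⟩, ⟨0, 1, 10, 4⟩,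
      ⟨0, 1, 10, 5⟩, ⟨0, 1, 10, 6⟩, ⟨0, 1, 10, 7⟩, ⟨0, 1, 10, 8⟩, ⟨0, 1, 10, 9⟩, ⟨0, 1, 10, 10⟩,
      ⟨1, 0, 0, 1⟩, ⟨1, 1, 0, 1⟩, ⟨1, 2, 0, 1⟩, ⟨2, 0, 0, 6⟩, ⟨3, 0, 0, 4⟩, ⟨4, 0, 0, 3⟩,
      ⟨5, 0, 0, 9⟩])
    (ss := [⟨0, 10, 1, 0⟩, ⟨0, 10, 1, 10⟩, ⟨0, 10, 1, 9⟩, ⟨0, 10, 1, 8⟩, ⟨0, 10, 1, 7⟩,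
      ⟨0, 10, 1, 6⟩, ⟨0, 10, 1, 5⟩, ⟨0, 10, 1, 4⟩, ⟨0, 10, 1, 3⟩, ⟨0, 10, 1, 2⟩, ⟨0, 10, 1, 1⟩,
      ⟨10, 0, 0, 10⟩, ⟨10, 10, 0, 10⟩, ⟨10, 9, 0, 10⟩, ⟨9, 0, 0, 5⟩, ⟨8, 0, 0, 7⟩, ⟨7, 0, 0, 8⟩,
      ⟨6, 0, 0, 2⟩])
    (by decide +kernel)

theorem isStrongGelfandPair_icosahedral11 :
    IsStrongGelfandPair (ofCodes 11 _ isGroup_icosahedral11) :=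
  isStrongGelfandPair_ofCodes _
    (rs := [⟨0, 1, 10, 0⟩, ⟨0, 1, 10, 1⟩, ⟨0, 1, 10, 2⟩, ⟨0, 1, 10, 3⟩, ⟨0, 1, 10, 4⟩,
      ⟨0, 1, 10, 5⟩, ⟨0, 1, 10, 9⟩, ⟨1, 0, 0, 1⟩, ⟨1, 1, 1, 2⟩, ⟨1, 1, 2, 3⟩, ⟨1, 1, 3, 4⟩,
      ⟨1, 1, 6, 7⟩, ⟨1, 1, 9, 10⟩, ⟨1, 2, 2, 5⟩, ⟨2, 1, 4, 8⟩, ⟨2, 1, 9, 5⟩, ⟨3, 2, 6, 8⟩,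
      ⟨3, 2, 10, 7⟩])
    (ss := [⟨0, 10, 1, 10⟩, ⟨0, 10, 1, 9⟩, ⟨0, 10, 1, 8⟩, ⟨0, 10, 1, 7⟩, ⟨0, 10, 1, 6⟩,
      ⟨0, 10, 1, 2⟩, ⟨10, 0, 0, 10⟩, ⟨10, 10, 10, 9⟩, ⟨10, 10, 9, 8⟩, ⟨10, 10, 8, 7⟩,
      ⟨10, 10, 5, 4⟩, ⟨10, 9, 9, 6⟩, ⟨9, 10, 7, 3⟩, ⟨9, 10, 2, 6⟩, ⟨8, 9, 1, 4⟩])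
    (by decide +kernel)

theorem map_flipEquiv_icosahedral11 :
    (ofCodes 11 _ isGroup_icosahedral11).map (flipEquiv 11).toMonoidHom =
      ofCodes 11 _ isGroup_icosahedral11' :=
  map_flipEquiv_ofCodes _ _ (by decide +kernel)

theorem isStrongGelfandPair_icosahedral11' :
    IsStrongGelfandPair (ofCodes 11 _ isGroup_icosahedral11') := by
  rw [← map_flipEquiv_icosahedral11]
  exact isStrongGelfandPair_icosahedral11.map_equiv _

theorem card_icosahedral11 : Nat.card (ofCodes 11 _ isGroup_icosahedral11) = 120 := by
  rw [card_ofCodes]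
  decide +kernel

theorem hasIsoType_icosahedral11 :
    HasIsoType BinaryIcosahedral (ofCodes 11 _ isGroup_icosahedral11) := by
  have hs : enc (dec 11 ⟨8, 1, 9, 4⟩) = ⟨8, 1, 9, 4⟩ := enc_dec (by decide +kernel)
  have ht : enc (dec 11 ⟨7, 0, 0, 8⟩) = ⟨7, 0, 0, 8⟩ := enc_dec (by decide +kernel)
  have hsmem : dec 11 ⟨8, 1, 9, 4⟩ ∈
      Subgroup.closure {dec 11 ⟨8, 1, 9, 4⟩, dec 11 ⟨7, 0, 0, 8⟩} :=
    Subgroup.subset_closure (Or.inl rfl)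
  have htmem : dec 11 ⟨7, 0, 0, 8⟩ ∈
      Subgroup.closure {dec 11 ⟨8, 1, 9, 4⟩, dec 11 ⟨7, 0, 0, 8⟩} :=
    Subgroup.subset_closure (Or.inr rfl)
  refine hasIsoType_binaryIcosahedral card_icosahedral11 (s := dec 11 ⟨8, 1, 9, 4⟩)
    (t := dec 11 ⟨7, 0, 0, 8⟩) ?_ ?_ (le_antisymm ?_ ?_)
  · apply enc_injective
    rw [enc_pow, enc_pow, hs, ht]
    decide +kernel
  · apply enc_injective
    rw [enc_mul, enc_mul, enc_mul, enc_pow, hs, ht]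
    decide +kernel
  · rw [Subgroup.closure_le]
    rintro x (rfl | rfl) <;> rw [SetLike.mem_coe, mem_ofCodes]
    · rw [hs]
      decide +kernel
    · rw [ht]
      decide +kernel
  -- The generators used for the list are s³ t and (s² t)² in terms of s and t.
  · have hx : enc (evalWord (dec 11 ⟨8, 1, 9, 4⟩) (dec 11 ⟨7, 0, 0, 8⟩)
        [true, true, true, false]) = ⟨4, 0, 0, 3⟩ := by
      rw [enc_evalWord, hs, ht]
      decide +kernel
    have hy : enc (evalWord (dec 11 ⟨8, 1, 9, 4⟩) (dec 11 ⟨7, 0, 0, 8⟩)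
        [true, true, false, true, true, false]) = ⟨1, 1, 1, 2⟩ := by
      rw [enc_evalWord, hs, ht]
      decide +kernel
    refine ofCodes_gen_le isGroup_icosahedral11 rfl ?_ (enc_dec (by decide +kernel))
      (evalWord_mem hsmem htmem _) hy
    rw [← hx, dec_enc]
    exact evalWord_mem hsmem htmem _

theorem hasIsoType_icosahedral11' :
    HasIsoType BinaryIcosahedral (ofCodes 11 _ isGroup_icosahedral11') := by
  rw [← map_flipEquiv_icosahedral11]
  obtain ⟨e⟩ := hasIsoType_icosahedral11
  exact ⟨(Subgroup.equivMapOfInjective _ _ (flipEquiv 11).injective).symm.trans e⟩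

/-- Order 120 excludes the triangular groups, of orders 110 and 55, and all refuted subgroups. -/
theorem hasIsoType_binaryIcosahedral_iff {H : Subgroup SL(2, ZMod 11)} :
    HasIsoType BinaryIcosahedral H ↔ SubgroupConj H (ofCodes 11 _ isGroup_icosahedral11) ∨
      SubgroupConj H (ofCodes 11 _ isGroup_icosahedral11') := by
  constructor
  · rintro ⟨e⟩
    obtain ⟨f⟩ := hasIsoType_icosahedral11
    have hcard : Nat.card H = 120 :=
      (Nat.card_congr (e.trans f.symm).toEquiv).trans card_icosahedral11
    rcases subgroupConj_or_not_isStrongGelfandPair_eleven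
      (ne_top_of_card_lt (H := H) (by omega)) with h | h | h | h
    · rw [h.card_eq, upperTriangularSq_eq_ofCodes isGroup_triangularSq11, card_ofCodes] at hcard
      exact absurd hcard (by decide +kernel)
    · rw [h.card_eq, upperTriangular_eq_ofCodes isGroup_triangular11, card_ofCodes] at hcard
      exact absurd hcard (by decide +kernel)
    · exact h
    · omega
  · rintro (h | h)
    exacts [h.hasIsoType_iff.2 hasIsoType_icosahedral11,
      h.hasIsoType_iff.2 hasIsoType_icosahedral11']

theorem not_subgroupConj_icosahedral11 : ¬ SubgroupConj (ofCodes 11 _ isGroup_icosahedral11)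
    (ofCodes 11 _ isGroup_icosahedral11') :=
  not_subgroupConj_ofCodes _ _ (x := ⟨4, 0, 0, 3⟩) (y := ⟨1, 10, 10, 2⟩) (by decide +kernel)
    (by decide +kernel) (by decide +kernel)

theorem isStrongGelfandPair_iff_eleven {H : Subgroup SL(2, ZMod 11)} (hH : H ≠ ⊤) :
    IsStrongGelfandPair H ↔ SubgroupConj H (upperTriangularSq 11) ∨
      SubgroupConj H (upperTriangular 11) ∨ HasIsoType BinaryIcosahedral H := by
  rw [hasIsoType_binaryIcosahedral_iff]
  constructor
  · intro h
    rcases subgroupConj_or_not_isStrongGelfandPair_eleven hH with h1 | h1 | h1 | h1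
    exacts [Or.inl h1, Or.inr (Or.inl h1), Or.inr (Or.inr h1), absurd h h1.1]
  · rintro (h | h | h | h)
    · exact h.isStrongGelfandPair_iff.2 isStrongGelfandPair_upperTriangularSq_eleven
    · exact h.isStrongGelfandPair_iff.2
        (isStrongGelfandPair_upperTriangularSq_eleven.mono upperTriangularSq_le)
    · exact h.isStrongGelfandPair_iff.2 isStrongGelfandPair_icosahedral11
    · exact h.isStrongGelfandPair_iff.2 isStrongGelfandPair_icosahedral11'

end Matrix.SpecialLinearGroup

theorem theorem3 :
    -- p = 2
    (Nonempty (SL(2, ZMod 2) ≃* Equiv.Perm (Fin 3)) ∧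
      (∀ H : Subgroup SL(2, ZMod 2), H ≠ ⊤ →
        (IsStrongGelfandPair H ↔ HasIsoType (Cyc 2) H ∨ HasIsoType (Cyc 3) H)) ∧
      OneConjClass (fun H : Subgroup SL(2, ZMod 2) => HasIsoType (Cyc 2) H) ∧
      OneConjClass (fun H : Subgroup SL(2, ZMod 2) => HasIsoType (Cyc 3) H)) ∧
    -- p = 3
    ((∀ H : Subgroup SL(2, ZMod 3), H ≠ ⊤ →
        (IsStrongGelfandPair H ↔
          HasIsoType (Cyc 3) H ∨ HasIsoType (Cyc 6) H ∨ HasIsoType (QuaternionGroup 2) H)) ∧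
      OneConjClass (fun H : Subgroup SL(2, ZMod 3) => HasIsoType (Cyc 3) H) ∧
      OneConjClass (fun H : Subgroup SL(2, ZMod 3) => HasIsoType (Cyc 6) H) ∧
      OneConjClass (fun H : Subgroup SL(2, ZMod 3) => HasIsoType (QuaternionGroup 2) H) ∧
      HasIsoType (Cyc 6) (upperTriangular 3)) ∧
    -- p = 5
    ((∀ H : Subgroup SL(2, ZMod 5), H ≠ ⊤ →
        (IsStrongGelfandPair H ↔
          HasIsoType SL(2, ZMod 3) H ∨ SubgroupConj H (upperTriangular 5))) ∧
      OneConjClass (fun H : Subgroup SL(2, ZMod 5) => HasIsoType SL(2, ZMod 3) H) ∧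
      (∀ H : Subgroup SL(2, ZMod 5), HasIsoType SL(2, ZMod 3) H → IsCoatom H)) ∧
    -- p = 7
    ((∀ H : Subgroup SL(2, ZMod 7), H ≠ ⊤ →
        (IsStrongGelfandPair H ↔
          SubgroupConj H (upperTriangular 7) ∨ SubgroupConj H (upperTriangularSq 7) ∨
            IsPreimageOfS4 7 H)) ∧
      TwoConjClasses (fun H : Subgroup SL(2, ZMod 7) => IsPreimageOfS4 7 H)) ∧
    -- p = 11
    ((∀ H : Subgroup SL(2, ZMod 11), H ≠ ⊤ →
        (IsStrongGelfandPair H ↔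
          SubgroupConj H (upperTriangularSq 11) ∨ SubgroupConj H (upperTriangular 11) ∨
            HasIsoType BinaryIcosahedral H)) ∧
      TwoConjClasses (fun H : Subgroup SL(2, ZMod 11) => HasIsoType BinaryIcosahedral H)) := by
  exact ⟨⟨Matrix.SpecialLinearGroup.nonempty_mulEquiv_perm_three,
      fun _ => Matrix.SpecialLinearGroup.isStrongGelfandPair_iff_two,
      ⟨_, fun _ => Matrix.SpecialLinearGroup.hasIsoType_cyc_two_iff⟩,
      ⟨_, fun _ => Matrix.SpecialLinearGroup.hasIsoType_cyc_three_iff_of_two⟩⟩,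
    ⟨fun _ => Matrix.SpecialLinearGroup.isStrongGelfandPair_iff_three,
      ⟨_, fun _ => Matrix.SpecialLinearGroup.hasIsoType_cyc_three_iff⟩,
      ⟨_, fun _ => Matrix.SpecialLinearGroup.hasIsoType_cyc_six_iff⟩,
      ⟨_, fun _ => Matrix.SpecialLinearGroup.hasIsoType_quaternionGroup_iff⟩,
      Matrix.SpecialLinearGroup.hasIsoType_upperTriangular_three⟩,
    ⟨fun _ => Matrix.SpecialLinearGroup.isStrongGelfandPair_iff_five,
      ⟨_, fun _ => Matrix.SpecialLinearGroup.hasIsoType_SL2_iff⟩,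
      fun _ ⟨e⟩ => Matrix.SpecialLinearGroup.isCoatom_of_card_eq
        ((Nat.card_congr e.toEquiv).trans Matrix.SpecialLinearGroup.card_SL2)⟩,
    ⟨fun _ => Matrix.SpecialLinearGroup.isStrongGelfandPair_iff_seven,
      ⟨_, _, Matrix.SpecialLinearGroup.not_subgroupConj_octahedral7,
        fun _ => Matrix.SpecialLinearGroup.isPreimageOfS4_seven_iff⟩⟩,
    ⟨fun _ => Matrix.SpecialLinearGroup.isStrongGelfandPair_iff_eleven,
      ⟨_, _, Matrix.SpecialLinearGroup.not_subgroupConj_icosahedral11,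
        fun _ => Matrix.SpecialLinearGroup.hasIsoType_binaryIcosahedral_iff⟩⟩⟩
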